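/- **Setting.** Graphs are finite and simple, with vertices $0,\dots,n-1$ and maximum degree $\Delta=\Delta(G)$. For an integer $D$ and a vertex $u$, let $d(u)$ be the degree of $u$ and $d^D(u)$ the number of neighbours of $u$ of degree $D$. An edge $uv$ is *$(D,u)$-weak* if $d^D(u)\le D-d(v)+[d(v)=D]$, where $[P]$ is $1$ if $P$ holds and $0$ otherwise. It is *weak* if it is $(D,u)$-weak or $(D,v)$-weak for $D=\Delta(G)$. A *partial $\Delta$-edge-coloring* of $G$ assigns to each edge one of $\Delta$ colors or leaves it uncolored, so that no two colored edges with a common endpoint have the same color. **Model.** Algorithms are programs of a deterministic word RAM with unit-cost addition, truncated subtraction, multiplication, array access and comparison, on words of $O(\log (n+2))$ bits; memory that holds no input is initially $0$. The input $G$ is given by adjacency lists together with the degrees, $E_w$ by a list of its edges, each listed once, and $n$, $|E(G)|$, $\Delta$, $|E_w|$ are given as numbers. A partial coloring is given by arrays $M_v$, one for each vertex $v$, of size $\Delta$, where $M_v[c]$ is the edge of color $c$ at $v$ if there is one and is empty otherwise; the output coloring is returned in the same form, in place. **Lemma.** There is one deterministic algorithm with the following property. Let $G$ be a simple graph, let $E_w\subseteq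 E(G)$ be a set of weak edges, and let $E_0=E(G)\setminus E_w$. Given $G$, $E_w$ and a partial $\Delta$-edge-coloring $\pi$ of $G$ whose set of colored edges is $E_0$, the algorithm finds a partial $\Delta$-edge-coloring $\pi'$ of $G$ whose set $E_1$ of colored edges satisfies $$E_0\subseteq E_1\qquad\text{and}\qquad |E_1\setminus E_0|\ \ge\ \frac{|E_w|}{9\,\Delta(G)^5}$$ (the right-hand side is read as $0$ if $G$ has no edges). It runs in time $O(|E(G)|+|E_w|\,\Delta(G))$, that is, in at most $C\,(|E(G)|+|E_w|\,\Delta(G)+1)$ steps for an absolute constant $C$. The edges of $E_0$ may receive new colors but stay colored. -/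

import Mathlib

namespace EdgeColoringRAM

/-! ### Weak edges -/

/-- `d^i(v)`: the number of neighbours of `v` whose degree is `i`. -/
def degCount {n : ℕ} (G : SimpleGraph (Fin n)) [DecidableRel G.Adj] (i : ℕ) (v : Fin n) : ℕ :=
  ((G.neighborFinset v).filter (fun u => G.degree u = i)).card

/-- The edge `uv` is `(D,u)`-weak: `d^D(u) ≤ D - d(v) + [d(v) = D]`, read in the integers. -/
def IsWeakAt {n : ℕ} (G : SimpleGraph (Fin n)) [DecidableRel G.Adj] (D : ℕ) (u v : Fin n) : Prop :=
  (degCount G D u : ℤ) ≤ (D : ℤ) - (G.degree v : ℤ) + (if G.degree v = D then 1 else 0)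

/-- `e` is a `D`-weak edge of `G`: it can be written `uv` so that it is `(D,u)`-weak.  Both
orientations of `e` are allowed, so this says `(D,u)`-weak or `(D,v)`-weak. -/
def IsWeakEdge {n : ℕ} (G : SimpleGraph (Fin n)) [DecidableRel G.Adj] (D : ℕ)
    (e : Sym2 (Fin n)) : Prop :=
  ∃ u v : Fin n, e = s(u, v) ∧ G.Adj u v ∧ IsWeakAt G D u v

/-! ### Partial edge-colorings -/

/-- A partial `D`-edge-coloring of `G`.  The value `none` means uncolored; pairs that are
not edges of `G` carry no color; distinct edges with a common endpoint never have the same color. -/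
structure PartialEdgeColoring {n : ℕ} (G : SimpleGraph (Fin n)) (D : ℕ) where
  color : Sym2 (Fin n) → Option (Fin D)
  color_eq_none : ∀ e, e ∉ G.edgeSet → color e = none
  proper : ∀ (u v w : Fin n) (c : Fin D),
    color s(u, v) = some c → color s(u, w) = some c → v = w

/-- The set of edges that are colored by `π`. -/
def PartialEdgeColoring.colored {n : ℕ} {G : SimpleGraph (Fin n)} {D : ℕ}
    (π : PartialEdgeColoring G D) : Finset (Sym2 (Fin n)) :=
  Finset.univ.filter (fun e => π.color e ≠ none)

/-! ### A word RAM

The memory consists of scalar variables and of arrays, both numbered by natural numbers, that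
hold natural numbers.  A program mentions finitely many variables and finitely many arrays. -/

structure State where
  var : ℕ → ℕ
  arr : ℕ → ℕ → ℕ

def State.setVar (s : State) (x v : ℕ) : State :=
  { s with var := Function.update s.var x v }

def State.setArr (s : State) (a i v : ℕ) : State :=
  { s with arr := Function.update s.arr a (Function.update (s.arr a) i v) }

/-- The arithmetic operations of the machine; subtraction is truncated at `0`. -/
inductive Op
  | add
  | sub
  | mul

def Op.eval : Op → ℕ → ℕ → ℕ
  | .add, a, b => a + b
  | .sub, a, b => a - b
  | .mul, a, b => a * b

/-- Programs:
`const x k` is `x := k`; `arith o x y z` is `x := y o z`; `load x a y` is `x := a[y]`;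
`store a x y` is `a[x] := y`; the tests of `ifLt x y` and `whileLt x y` are `x < y`. -/
inductive Prog
  | skip
  | const (x k : ℕ)
  | arith (o : Op) (x y z : ℕ)
  | load (x a y : ℕ)
  | store (a x y : ℕ)
  | seq (p q : Prog)
  | ifLt (x y : ℕ) (p q : Prog)
  | whileLt (x y : ℕ) (p : Prog)

/-- `p.Runs W s s' t`: on a machine whose words hold the numbers less than `W`, the program `p`
started in the state `s` halts in the state `s'` after exactly `t` elementary steps (assignments,
array accesses, tests).  A computation that produces a number `≥ W` has no run. -/
inductive Prog.Runs (W : ℕ) : Prog → State → State → ℕ → Prop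
  | skip (s : State) : Runs W .skip s s 1
  | const (s : State) (x k : ℕ) : k < W → Runs W (.const x k) s (s.setVar x k) 1
  | arith (s : State) (o : Op) (x y z : ℕ) : o.eval (s.var y) (s.var z) < W →
      Runs W (.arith o x y z) s (s.setVar x (o.eval (s.var y) (s.var z))) 1
  | load (s : State) (x a y : ℕ) : Runs W (.load x a y) s (s.setVar x (s.arr a (s.var y))) 1
  | store (s : State) (a x y : ℕ) : Runs W (.store a x y) s (s.setArr a (s.var x) (s.var y)) 1
  | seq {p q : Prog} {s s₁ s₂ : State} {t₁ t₂ : ℕ} : Runs W p s s₁ t₁ → Runs W q s₁ s₂ t₂ →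
      Runs W (.seq p q) s s₂ (t₁ + t₂)
  | ifTrue {x y : ℕ} {p q : Prog} {s s₁ : State} {t : ℕ} : s.var x < s.var y →
      Runs W p s s₁ t → Runs W (.ifLt x y p q) s s₁ (t + 1)
  | ifFalse {x y : ℕ} {p q : Prog} {s s₁ : State} {t : ℕ} : ¬ s.var x < s.var y →
      Runs W q s s₁ t → Runs W (.ifLt x y p q) s s₁ (t + 1)
  | whileTrue {x y : ℕ} {p : Prog} {s s₁ s₂ : State} {t₁ t₂ : ℕ} : s.var x < s.var y →
      Runs W p s s₁ t₁ → Runs W (.whileLt x y p) s₁ s₂ t₂ →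
      Runs W (.whileLt x y p) s s₂ (t₁ + t₂ + 1)
  | whileFalse (s : State) (x y : ℕ) (p : Prog) : ¬ s.var x < s.var y →
      Runs W (.whileLt x y p) s s 1

/-- The machine is deterministic: a program has at most one run from a given state. -/
theorem Prog.Runs.deterministic {W : ℕ} {p : Prog} {s s₁ s₂ : State} {t₁ t₂ : ℕ}
    (h₁ : p.Runs W s s₁ t₁) (h₂ : p.Runs W s s₂ t₂) : s₁ = s₂ ∧ t₁ = t₂ := by
  induction h₁ generalizing s₂ t₂ with
  | skip | const | arith | load | store => cases h₂; exact ⟨rfl, rfl⟩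
  | seq _ _ ih₁ ih₂ =>
    cases h₂ with
    | seq a b =>
      obtain ⟨rfl, rfl⟩ := ih₁ a
      obtain ⟨rfl, rfl⟩ := ih₂ b
      exact ⟨rfl, rfl⟩
  | ifTrue h _ ih =>
    cases h₂ with
    | ifTrue _ a => obtain ⟨rfl, rfl⟩ := ih a; exact ⟨rfl, rfl⟩
    | ifFalse h' _ => exact absurd h h'
  | ifFalse h _ ih =>
    cases h₂ with
    | ifTrue h' _ => exact absurd h' h
    | ifFalse _ a => obtain ⟨rfl, rfl⟩ := ih a; exact ⟨rfl, rfl⟩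
  | whileTrue h _ _ ih₁ ih₂ =>
    cases h₂ with
    | whileTrue _ a b =>
      obtain ⟨rfl, rfl⟩ := ih₁ a
      obtain ⟨rfl, rfl⟩ := ih₂ b
      exact ⟨rfl, rfl⟩
    | whileFalse _ _ _ _ h' => exact absurd h h'
  | whileFalse s x y p h =>
    cases h₂ with
    | whileTrue h' _ _ => exact absurd h' h
    | whileFalse => exact ⟨rfl, rfl⟩

/-! ### Input and output -/

/-- The array `M` stores `π` as the associative arrays `M_v` that map each color used at `v`
to the edge with that color: `M_v` is the block of `D` cells that starts at `v * D`, the cell of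
the color `c` holds `w + 1` if the edge `vw` has color `c`, and `0` if no edge at `v` does. -/
def EncodesColoring {n : ℕ} {G : SimpleGraph (Fin n)} {D : ℕ} (π : PartialEdgeColoring G D)
    (M : ℕ → ℕ) : Prop :=
  ∀ (v : Fin n) (c : Fin D),
    (∀ w : Fin n, π.color s(v, w) = some c → M (v * D + c) = w + 1) ∧
    ((∀ w : Fin n, π.color s(v, w) ≠ some c) → M (v * D + c) = 0)

/-- `s` is an initial memory that holds the graph `G`, the set of edges `Ew` and the coloring `π`.

* Variables `0, 1, 2, 3` hold the numbers of vertices, of edges, of colors, and `|Ew|`.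
* Adjacency lists: array `0` holds the degrees, array `1` the positions in array `2` at which the
  neighbour lists start.  The list of `v` occupies `d(v)` cells and contains every neighbour, so
  it contains each neighbour once.
* Array `3` holds the coloring.
* Arrays `4` and `5` hold the endpoints of the edges in `Ew`, which are listed in any order and
  orientation.  There are `|Ew|` entries, so each edge is listed once.
* All other variables and arrays are `0`; cells of arrays `0` to `5` not mentioned above are arbitrary. -/
structure IsInput {n : ℕ} (G : SimpleGraph (Fin n)) [DecidableRel G.Adj] {D : ℕ}
    (Ew : Finset (Sym2 (Fin n))) (π : PartialEdgeColoring G D) (s : State) : Prop where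
  vertices : s.var 0 = n
  edges : s.var 1 = G.edgeFinset.card
  colors : s.var 2 = D
  weak : s.var 3 = Ew.card
  degree : ∀ v : Fin n, s.arr 0 v = G.degree v
  start_le : ∀ v : Fin n, s.arr 1 v + G.degree v ≤ 2 * G.edgeFinset.card
  adjacent : ∀ v w : Fin n, G.Adj v w ↔ ∃ i < G.degree v, s.arr 2 (s.arr 1 v + i) = w
  coloring : EncodesColoring π (s.arr 3)
  weakList : ∀ u v : Fin n, s(u, v) ∈ Ew ↔
    ∃ i < Ew.card, (s.arr 4 i = u ∧ s.arr 5 i = v) ∨ (s.arr 4 i = v ∧ s.arr 5 i = u)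
  var_zero : ∀ x, 4 ≤ x → s.var x = 0
  arr_zero : ∀ a, 6 ≤ a → ∀ i, s.arr a i = 0

end EdgeColoringRAM

open EdgeColoringRAM

/-! A fan at $u$ for an uncolored edge $uv$ is a tree of neighbors of $u$ with root $v$ in which the
color of each edge $uw$ is free at the parent of $w$. If a vertex $t$ of the tree and $u$ have a
common free color, $ut$ can take that color, the old color of $ut$ passes to the parent's edge, and
so on down to $uv$ (`ShiftInv.step`, `ShiftInv.finish`). A fan grows by letting its current vertex
$x$ claim a color $c$ free at $x$. If $c$ is also free at $u$, the fan is shifted at once. If $c$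
was claimed before by some $y$, then $x$ and $y$ share a free color $\beta$, and the fan is stored.
Otherwise the edge of color $c$ at $u$ leads to a new vertex. Only a vertex without free colors,
hence of degree $D = \Delta$, is a dead end; the root then claims its next free color. At least $D -
d(v) + 1$ colors are free at the root, and weakness says precisely that there are fewer possible
dead ends (`NatGraph.Col.exists_free`).

For a stored fan let $\alpha$ be free at $u$. The $\alpha\beta$-path from $u$ ends in at most one of
$x$, $y$. Let $t$ be $y$ if the path does not end at $y$, and $x$ otherwise. Exchanging the two
colors on the path from $t$ makes $\alpha$ free at $t$ and leaves it free at $u$. The fan can still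
be shifted from $t$: no key is $\alpha$, and the key $\beta$ has parent $y$, which is either not
exchanged or has smaller rank than the vertex with that key (`ValidFan.shiftInv`).

Many fans have to be treated in linear time. The first pass picks centers greedily, with pairwise
disjoint closed neighborhoods, so that fans do not interact and the cost of building them is charged
to disjoint sets of vertices. If $S$ is the set of centers, every edge of $E_w$ is within reach of a
center, so $|E_w| \le |S| (D+1)^2 D$ (`NatGraph.card_near_le`). Let $R \subseteq S$ be the centers
of the fans shifted at once.

The second pass keeps only the most frequent of the $D^2 - D$ ordered pairs $(\alpha, \beta)$. All
paths then live in one two-colored subgraph. Touched vertices are marked, and a fan is skipped when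
one of $u, x, y$ is touched. Every treated fan touches two paths and so at most four path ends. In a
skipped fan the touched vertex lacked $\alpha$ or $\beta$ at the start of the pass, so it is one of
those ends, and by disjointness an end belongs to only one fan. Thus the best class has at most
$4|P|$ fans, where $P$ is the set of centers treated (`Collected.card_class_le`), and pigeonhole
(`Collected.card_stored_le`) gives $|S| \le |R| + 4(D^2-D)|P|$. With `card_bound` this yields $|E_w|
\le 9D^5(|R|+|P|)$, and each center in $R \cup P$ accounts for its own newly colored edge.

For the time, each entry of the list costs $O(D)$ for scanning, each shift costs $O(D)$, and fan
building and walks sum to a multiple of $\sum (d(w)+1)$ over non-isolated vertices, which is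
$O(|E|)$ (`cost_natGraph_le`). -/

/-! ### Weakest preconditions with a running clock -/

/-- The program `p`, started in `s` at time `τ`, halts in a state and at a time that satisfy `Q`. -/
def WP (W : ℕ) (p : Prog) (Q : State → ℕ → Prop) (s : State) (τ : ℕ) : Prop :=
  ∃ s' t, p.Runs W s s' t ∧ Q s' (τ + t)

section Calculus

variable {W : ℕ} {Q : State → ℕ → Prop} {s : State} {τ : ℕ}

theorem wp_skip : WP W .skip Q s τ ↔ Q s (τ + 1) := by
  constructor
  · rintro ⟨s', t, h, hq⟩; cases h; exact hq
  · exact fun h => ⟨_, _, .skip _, h⟩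

theorem wp_const {x k : ℕ} : WP W (.const x k) Q s τ ↔ k < W ∧ Q (s.setVar x k) (τ + 1) := by
  constructor
  · rintro ⟨s', t, h, hq⟩; cases h with | const _ _ _ h => exact ⟨h, hq⟩
  · exact fun h => ⟨_, _, .const _ _ _ h.1, h.2⟩

theorem wp_arith {o : Op} {x y z : ℕ} : WP W (.arith o x y z) Q s τ ↔
    o.eval (s.var y) (s.var z) < W ∧ Q (s.setVar x (o.eval (s.var y) (s.var z))) (τ + 1) := by
  constructor
  · rintro ⟨s', t, h, hq⟩; cases h with | arith _ _ _ _ _ h => exact ⟨h, hq⟩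
  · exact fun h => ⟨_, _, .arith _ _ _ _ _ h.1, h.2⟩

theorem wp_load {x a y : ℕ} :
    WP W (.load x a y) Q s τ ↔ Q (s.setVar x (s.arr a (s.var y))) (τ + 1) := by
  constructor
  · rintro ⟨s', t, h, hq⟩; cases h; exact hq
  · exact fun h => ⟨_, _, .load _ _ _ _, h⟩

theorem wp_store {x a y : ℕ} :
    WP W (.store a x y) Q s τ ↔ Q (s.setArr a (s.var x) (s.var y)) (τ + 1) := by
  constructor
  · rintro ⟨s', t, h, hq⟩; cases h; exact hq
  · exact fun h => ⟨_, _, .store _ _ _ _, h⟩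

/-- An equality of predicate transformers, unlike the pointwise rules for single instructions, so
that it also rewrites inside postconditions. -/
theorem wp_seq {p q : Prog} : WP W (.seq p q) Q = WP W p (WP W q Q) := by
  funext s τ
  refine propext ⟨?_, ?_⟩
  · rintro ⟨s', t, h, hq⟩
    cases h with
    | seq h₁ h₂ => exact ⟨_, _, h₁, _, _, h₂, by rwa [add_assoc]⟩
  · rintro ⟨s₁, t₁, h₁, s₂, t₂, h₂, hq⟩
    exact ⟨_, _, .seq h₁ h₂, by rwa [← add_assoc]⟩

theorem wp_ifLt {x y : ℕ} {p q : Prog} : WP W (.ifLt x y p q) Q s τ ↔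
    (s.var x < s.var y → WP W p Q s (τ + 1)) ∧ (¬ s.var x < s.var y → WP W q Q s (τ + 1)) := by
  constructor
  · rintro ⟨s', t, h, hq⟩
    cases h with
    | ifTrue h₁ h₂ =>
      exact ⟨fun _ => ⟨_, _, h₂, by convert hq using 1; omega⟩, fun h => absurd h₁ h⟩
    | ifFalse h₁ h₂ =>
      exact ⟨fun h => absurd h h₁, fun _ => ⟨_, _, h₂, by convert hq using 1; omega⟩⟩
  · rintro ⟨h₁, h₂⟩
    by_cases h : s.var x < s.var y
    · obtain ⟨s', t, hr, hq⟩ := h₁ h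
      exact ⟨_, _, .ifTrue h hr, by convert hq using 1; omega⟩
    · obtain ⟨s', t, hr, hq⟩ := h₂ h
      exact ⟨_, _, .ifFalse h hr, by convert hq using 1; omega⟩

/-- Total correctness of a loop with invariant `I` and a variant that decreases. -/
theorem wp_while {x y : ℕ} {p : Prog} (I : ℕ → State → ℕ → Prop)
    (step : ∀ k s τ, I k s τ → s.var x < s.var y →
      WP W p (fun s' τ' => ∃ k' < k, I k' s' (τ' + 1)) s τ)
    (exit : ∀ k s τ, I k s τ → ¬ s.var x < s.var y → Q s (τ + 1))
    (k : ℕ) (h : I k s τ) : WP W (.whileLt x y p) Q s τ := by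
  induction k using Nat.strong_induction_on generalizing s τ with
  | _ k ih =>
    by_cases hc : s.var x < s.var y
    · obtain ⟨s₁, t₁, h₁, k', hk, hI⟩ := step k s τ h hc
      obtain ⟨s₂, t₂, h₂, hq⟩ := ih k' hk hI
      exact ⟨s₂, _, .whileTrue hc h₁ h₂, by convert hq using 1; omega⟩
    · exact ⟨s, 1, .whileFalse _ _ _ _ hc, exit k s τ h hc⟩

@[simp] theorem var_setVar {x v y : ℕ} :
    (s.setVar x v).var y = if y = x then v else s.var y := by
  simp [State.setVar, Function.update_apply]

@[simp] theorem arr_setVar {x v : ℕ} : (s.setVar x v).arr = s.arr := rfl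

@[simp] theorem var_setArr {a i v : ℕ} : (s.setArr a i v).var = s.var := rfl

@[simp] theorem arr_setArr {a i v b : ℕ} :
    (s.setArr a i v).arr b = if b = a then Function.update (s.arr a) i v else s.arr b := by
  by_cases h : b = a <;> simp [State.setArr, h]

@[simp] theorem eval_add {a b : ℕ} : Op.eval .add a b = a + b := rfl
@[simp] theorem eval_sub {a b : ℕ} : Op.eval .sub a b = a - b := rfl
@[simp] theorem eval_mul {a b : ℕ} : Op.eval .mul a b = a * b := rfl

end Calculus

/-- `s'` differs from `s` at most in the variables in `X` and the arrays in `A`. -/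
def Frame (X A : List ℕ) (s s' : State) : Prop :=
  (∀ x, x ∉ X → s'.var x = s.var x) ∧ ∀ a, a ∉ A → s'.arr a = s.arr a

/-! ### Registers -/

notation "rD" => (2 : ℕ)
notation "rE" => (3 : ℕ)
notation "rT" => (4 : ℕ)
notation "r1" => (5 : ℕ)
notation "r0" => (6 : ℕ)
notation "rI" => (7 : ℕ)
notation "rA" => (8 : ℕ)
notation "rB" => (9 : ℕ)
notation "rU" => (10 : ℕ)
notation "rV" => (11 : ℕ)
notation "rJ" => (12 : ℕ)
notation "rS" => (13 : ℕ)
notation "rG" => (14 : ℕ)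
notation "rW" => (15 : ℕ)
notation "rQ" => (16 : ℕ)
notation "rAcc" => (17 : ℕ)
notation "rCnt" => (18 : ℕ)
notation "rAl" => (19 : ℕ)
notation "rC" => (20 : ℕ)
notation "rP" => (21 : ℕ)
notation "rGo" => (22 : ℕ)
notation "rX" => (23 : ℕ)
notation "rY" => (24 : ℕ)
notation "rF" => (25 : ℕ)
notation "rBn" => (26 : ℕ)
notation "rBc" => (27 : ℕ)
notation "rBa" => (28 : ℕ)
notation "rBb" => (29 : ℕ)
notation "rCl" => (30 : ℕ)
notation "rLim" => (31 : ℕ)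
notation "rH" => (32 : ℕ)
notation "rZ" => (33 : ℕ)

/-! ### Arrays -/

notation "aDeg" => (0 : ℕ)
notation "aStart" => (1 : ℕ)
notation "aAdj" => (2 : ℕ)
notation "aM" => (3 : ℕ)
notation "aEu" => (4 : ℕ)
notation "aEv" => (5 : ℕ)
notation "aMark" => (6 : ℕ)
notation "aPred" => (7 : ℕ)
notation "aKey" => (8 : ℕ)
notation "aFu" => (9 : ℕ)
notation "aFv" => (10 : ℕ)
notation "aFx" => (11 : ℕ)
notation "aFy" => (12 : ℕ)
notation "aFc" => (13 : ℕ)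
notation "aCount" => (14 : ℕ)
notation "aTouch" => (15 : ℕ)

/-! ### The program -/

namespace Prog

infixr:60 " ;; " => Prog.seq

/-- The machine has no copy instruction; `r0` holds 0 throughout the run (`Base`). -/
def mov (x y : ℕ) : Prog := .arith .add x y r0

/-- `x := a[v * D + c]` -/
def ld2 (x a v c : ℕ) : Prog := .arith .mul rT v rD ;; .arith .add rT rT c ;; .load x a rT

/-- `a[v * D + c] := x` -/
def st2 (a v c x : ℕ) : Prog := .arith .mul rT v rD ;; .arith .add rT rT c ;; .store a rT x

/-- The `skip` pads the branch decided by the first test, so that the test costs two steps in every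
case. -/
def ifEq (x y : ℕ) (p q : Prog) : Prog := .ifLt x y (.skip ;; q) (.ifLt y x q p)

/-- Advances `rC` to the next color that is free at `rW`, or to `D`. -/
def nextFree : Prog :=
  mov rLim rD ;;
  -- Setting the bound `rLim` to 0 leaves the loop with `rC` at the color found.
  .whileLt rC rLim (ld2 rQ aM rW rC ;; .ifLt rQ r1 (mov rLim r0) (.arith .add rC rC r1))

/-- Colors the edge between `rU` and `rX` with `rC`. -/
def putColor : Prog :=
  .arith .add rQ rX r1 ;; st2 aM rU rC rQ ;; .arith .add rQ rU r1 ;; st2 aM rX rC rQ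

/-- Removes the color `rH` from the edge between `rU` and `rX`. -/
def delColor : Prog := st2 aM rU rH r0 ;; st2 aM rX rH r0

/-- Moves the colors of the fan with center `rU` and uncolored edge to `rV` up to `rX`,
whose edge to `rU` gets the color `rC`. -/
def shiftFan : Prog :=
  .const rGo 0 ;;
  .whileLt rGo r1
    (ifEq rX rV (.const rGo 1)
      (.load rH aKey rX ;; delColor ;; putColor ;;
        ld2 rQ aPred rU rH ;; .arith .sub rX rQ r1 ;; mov rC rH)) ;;
  putColor

/-- Sums the marks over the closed neighborhood of `rU` and counts its neighbors of degree `D`. -/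
def scanNbrs : Prog :=
  .load rAcc aMark rU ;; .const rCnt 0 ;; .load rS aStart rU ;; .load rG aDeg rU ;; .const rJ 0 ;;
  .whileLt rJ rG
    (.arith .add rT rS rJ ;; .load rW aAdj rT ;; .load rQ aMark rW ;; .arith .add rAcc rAcc rQ ;;
      .load rQ aDeg rW ;; .ifLt rQ rD .skip (.arith .add rCnt rCnt r1) ;; .arith .add rJ rJ r1)

/-- Relies on `rS` and `rG` as left behind by `scanNbrs`. -/
def markNbrs : Prog :=
  .store aMark rU r1 ;; .const rJ 0 ;;
  .whileLt rJ rG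
    (.arith .add rT rS rJ ;; .load rW aAdj rT ;; .store aMark rW r1 ;; .arith .add rJ rJ r1)

/-- One step of the construction of a fan: `rX` claims the color `rC`. -/
def fanStep : Prog :=
  ld2 rQ aPred rU rC ;;
  -- The flag `rGo` becomes 2 if the color was claimed before, by the vertex put into `rY`, and 1 if
  -- the color is free at the center.
  .ifLt r0 rQ (.arith .sub rY rQ r1 ;; .const rGo 2)
    (.arith .add rH rX r1 ;; st2 aPred rU rC rH ;; ld2 rQ aM rU rC ;;
      .ifLt rQ r1 (.const rGo 1)
        (.arith .sub rX rQ r1 ;; .store aKey rX rC ;; mov rW rX ;; .const rC 0 ;; nextFree ;;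
          .ifLt rC rD .skip
            (mov rX rV ;; mov rW rV ;; mov rC rP ;; nextFree ;; .arith .add rP rC r1)))

/-- Stores a fan whose edge cannot be colored at once, and counts its pair of colors. -/
def recordFan : Prog :=
  .arith .mul rCl rAl rD ;; .arith .add rCl rCl rC ;;
  .store aFu rF rU ;; .store aFv rF rV ;; .store aFx rF rX ;; .store aFy rF rY ;;
  .store aFc rF rCl ;;
  .load rQ aCount rCl ;; .arith .add rQ rQ r1 ;; .store aCount rCl rQ ;;
  .ifLt rBn rQ (mov rBn rQ ;; mov rBc rCl ;; mov rBa rAl ;; mov rBb rC) .skip ;;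
  .arith .add rF rF r1

/-- `rAl` receives the least color free at the center; it becomes the color $\alpha$ if the fan is
stored. -/
def buildFan : Prog :=
  mov rW rU ;; .const rC 0 ;; nextFree ;; mov rAl rC ;;
  mov rW rV ;; .const rC 0 ;; nextFree ;; .arith .add rP rC r1 ;;
  mov rX rV ;; .const rGo 0 ;; .whileLt rGo r1 fanStep

/-- Treats the edge from `rU` to `rV` if it is weak at `rU` and meets no earlier fan. -/
def tryEdge : Prog :=
  scanNbrs ;;
  -- Weakness is tested in the form $d^D(u) + d(v) \le D + [d(v) = D]$, which needs no subtraction.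
  .load rQ aDeg rV ;; .arith .add rCnt rCnt rQ ;; mov rLim rD ;;
  .ifLt rQ rD .skip (.arith .add rLim rLim r1) ;;
  .ifLt rAcc r1
    (.ifLt rLim rCnt .skip (markNbrs ;; buildFan ;; .ifLt r1 rGo recordFan shiftFan)) .skip

def collectFans : Prog :=
  .const r1 1 ;;
  .whileLt rI rE
    (.load rA aEu rI ;; .load rB aEv rI ;;
      mov rU rA ;; mov rV rB ;; tryEdge ;;
      mov rU rB ;; mov rV rA ;; tryEdge ;; .arith .add rI rI r1)

/-- Exchanges the cells of the colors `rC` and `rAl` at `rZ`, where `rQ` is the cell of `rC`. -/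
def swapCells : Prog := ld2 rH aM rZ rAl ;; st2 aM rZ rAl rQ ;; st2 aM rZ rC rH

/-- Follows the alternating path that leaves `rZ` through the color `rC`, and touches it. -/
def walk (swap : Bool) : Prog :=
  .const rGo 0 ;;
  .whileLt rGo r1
    (.store aTouch rZ r1 ;; ld2 rQ aM rZ rC ;; (if swap then swapCells else .skip) ;;
      .ifLt rQ r1 (.const rGo 1)
        (.arith .sub rZ rQ r1 ;; mov rH rC ;; mov rC rAl ;; mov rAl rH))

def colorFan : Prog :=
  mov rZ rU ;; mov rC rBb ;; mov rAl rBa ;; walk false ;;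
  -- The path from the center has only one other end. If that is `y`, then `x` is off the path and
  -- serves as the start of the shift; otherwise `y` does.
  ifEq rZ rY .skip (mov rX rY) ;;
  mov rZ rX ;; mov rC rBa ;; mov rAl rBb ;; walk true ;;
  mov rC rBa ;; shiftFan

def colorStep : Prog :=
  .load rU aFu rI ;; .load rV aFv rI ;; .load rX aFx rI ;; .load rY aFy rI ;;
  .load rQ aTouch rU ;; .load rH aTouch rX ;; .arith .add rQ rQ rH ;;
  .load rH aTouch rY ;; .arith .add rQ rQ rH ;;
  .ifLt rQ r1 colorFan .skip

def colorFans : Prog :=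
  .const rI 0 ;;
  .whileLt rI rF
    (.load rQ aFc rI ;; ifEq rQ rBc colorStep .skip ;; .arith .add rI rI r1)

def main : Prog := collectFans ;; colorFans

end Prog

/-! ### Rules for the derived instructions -/

section Macros

variable {W : ℕ} {Q : State → ℕ → Prop} {s : State} {τ : ℕ}

theorem wp_mov {x y : ℕ} : WP W (Prog.mov x y) Q s τ ↔
    s.var y + s.var r0 < W ∧ Q (s.setVar x (s.var y + s.var r0)) (τ + 1) := wp_arith

theorem wp_ifEq {x y : ℕ} {p q : Prog} : WP W (Prog.ifEq x y p q) Q s τ ↔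
    (s.var x = s.var y → WP W p Q s (τ + 2)) ∧ (s.var x ≠ s.var y → WP W q Q s (τ + 2)) := by
  rw [Prog.ifEq, wp_ifLt, wp_ifLt, wp_seq, wp_skip]
  rcases lt_trichotomy (s.var x) (s.var y) with h | h | h
  · simp [h, h.ne]
  · simp [h]
  · simp [h, h.ne', h.le]

theorem wp_ld2 {x a v c : ℕ} : WP W (Prog.ld2 x a v c) Q =
    WP W (.arith .mul rT v rD) (WP W (.arith .add rT rT c) (WP W (.load x a rT) Q)) := by
  rw [Prog.ld2, wp_seq, wp_seq]

theorem wp_st2 {x a v c : ℕ} : WP W (Prog.st2 a v c x) Q =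
    WP W (.arith .mul rT v rD) (WP W (.arith .add rT rT c) (WP W (.store a rT x) Q)) := by
  rw [Prog.st2, wp_seq, wp_seq]

end Macros

/-! ### Graphs and colorings on natural numbers -/

/-- A simple graph on `0, …, n - 1` with degrees at most `D`, given by its neighborhoods. -/
structure NatGraph (n D : ℕ) where
  N : ℕ → Finset ℕ
  lt : ∀ {v w}, w ∈ N v → w < n
  symm : ∀ {v w}, w ∈ N v → v ∈ N w
  irrefl : ∀ v, v ∉ N v
  deg_le : ∀ v, (N v).card ≤ D

namespace NatGraph

variable {n D : ℕ} (g : NatGraph n D)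

/-- The closed neighborhood. -/
def ball (v : ℕ) : Finset ℕ := insert v (g.N v)

/-- The cell `m v c` is `w + 1` if the edge `vw` has color `c`, and `0` if no edge at `v` has. -/
structure Col (m : ℕ → ℕ → ℕ) : Prop where
  adj : ∀ v < n, ∀ c < D, ∀ w, m v c = w + 1 → w ∈ g.N v
  symm : ∀ v < n, ∀ c < D, ∀ w, m v c = w + 1 → m w c = v + 1
  inj : ∀ v < n, ∀ c < D, ∀ c' < D, ∀ w, m v c = w + 1 → m v c' = w + 1 → c = c'

end NatGraph

def Colored (D : ℕ) (m : ℕ → ℕ → ℕ) (v w : ℕ) : Prop := ∃ c < D, m v c = w + 1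

section Coloring

variable {n D : ℕ} {g : NatGraph n D} {m m' : ℕ → ℕ → ℕ}

theorem NatGraph.lt' {v w : ℕ} (h : w ∈ g.N v) : v < n := g.lt (g.symm h)

theorem NatGraph.Col.congr (hm : g.Col m) (h : ∀ v < n, ∀ c < D, m' v c = m v c) : g.Col m' where
  adj v hv c hc w hw := hm.adj v hv c hc w (h v hv c hc ▸ hw)
  symm v hv c hc w hw := by
    rw [h v hv c hc] at hw
    rw [h w (g.lt (hm.adj v hv c hc w hw)) c hc]
    exact hm.symm v hv c hc w hw
  inj v hv c hc c' hc' w hw hw' :=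
    hm.inj v hv c hc c' hc' w (h v hv c hc ▸ hw) (h v hv c' hc' ▸ hw')

/-- Giving the color `c`, free at both ends, to an uncolored edge. -/
theorem NatGraph.Col.put (hm : g.Col m) {u w c : ℕ} (huw : w ∈ g.N u) (hu : m u c = 0)
    (hw : m w c = 0) (hunc : ∀ c < D, m u c ≠ w + 1)
    (h : ∀ a, ∀ b < D, m' a b =
      if a = u ∧ b = c then w + 1 else if a = w ∧ b = c then u + 1 else m a b) : g.Col m' := by
  have hne : u ≠ w := fun h => g.irrefl u (h ▸ huw)
  have hunw : ∀ c < D, m w c ≠ u + 1 := fun c hc h =>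
    hunc c hc (hm.symm w (g.lt huw) c hc u h)
  refine ⟨?_, ?_, ?_⟩
  · intro v hv b hb x hx
    rw [h v b hb] at hx
    split_ifs at hx with h1 h2
    · obtain ⟨rfl, rfl⟩ := h1; obtain rfl : w = x := by omega
      exact huw
    · obtain ⟨rfl, rfl⟩ := h2; obtain rfl : u = x := by omega
      exact g.symm huw
    · exact hm.adj v hv b hb x hx
  · intro v hv b hb x hx
    rw [h v b hb] at hx
    rw [h x b hb]
    split_ifs at hx with h1 h2
    · obtain ⟨rfl, rfl⟩ := h1; obtain rfl : w = x := by omega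
      rw [if_neg (by tauto), if_pos (by tauto)]
    · obtain ⟨rfl, rfl⟩ := h2; obtain rfl : u = x := by omega
      rw [if_pos (by tauto)]
    · have hs := hm.symm v hv b hb x hx
      rw [if_neg, if_neg, hs]
      · rintro ⟨rfl, rfl⟩; omega
      · rintro ⟨rfl, rfl⟩; omega
  · intro v hv b hb b' hb' x hx hx'
    rw [h v b hb] at hx
    rw [h v b' hb'] at hx'
    have := hm.inj v hv b hb b' hb' x
    have h1 := hunc b hb
    have h2 := hunc b' hb'
    have h3 := hunw b hb
    have h4 := hunw b' hb'
    grind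

/-- Removing the color of an edge. -/
theorem NatGraph.Col.del (hm : g.Col m) {u w c : ℕ} (hun : u < n) (hc : c < D)
    (hu : m u c = w + 1)
    (h : ∀ a, ∀ b < D, m' a b = if (a = u ∨ a = w) ∧ b = c then 0 else m a b) : g.Col m' := by
  have hw := hm.symm u hun c hc w hu
  refine ⟨?_, ?_, ?_⟩
  · intro v hv b hb x hx
    rw [h v b hb] at hx
    have := hm.adj v hv b hb x
    grind
  · intro v hv b hb x hx
    rw [h v b hb] at hx
    rw [h x b hb]
    split_ifs at hx with h1
    have := hm.symm v hv b hb x hx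
    grind
  · intro v hv b hb b' hb' x hx hx'
    rw [h v b hb] at hx
    rw [h v b' hb'] at hx'
    have := hm.inj v hv b hb b' hb' x
    grind

/-- `S` is closed under the edges of colors `α` and `β`. -/
def Closed (m : ℕ → ℕ → ℕ) (α β : ℕ) (S : Finset ℕ) : Prop :=
  ∀ v ∈ S, ∀ c, c = α ∨ c = β → ∀ w, m v c = w + 1 → w ∈ S

theorem Closed.union {α β : ℕ} {S T : Finset ℕ} (hS : Closed m α β S) (hT : Closed m α β T) :
    Closed m α β (S ∪ T) := by
  intro v hv c hc w hw
  rcases Finset.mem_union.1 hv with h | h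
  · exact Finset.mem_union_left _ (hS v h c hc w hw)
  · exact Finset.mem_union_right _ (hT v h c hc w hw)

theorem Closed.symm {α β : ℕ} {S : Finset ℕ} (hS : Closed m α β S) : Closed m β α S :=
  fun v hv c hc w hw => hS v hv c hc.symm w hw

/-- The colors `α` and `β` exchanged at the vertices in `S`. -/
def flipAt (α β : ℕ) (S : Finset ℕ) (m : ℕ → ℕ → ℕ) (v c : ℕ) : ℕ :=
  if v ∈ S then m v (Equiv.swap α β c) else m v c

theorem flipAt_of_notMem {α β v c : ℕ} {S : Finset ℕ} (h : v ∉ S) : flipAt α β S m v c = m v c :=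
  if_neg h

theorem flipAt_of_ne {α β v c : ℕ} {S : Finset ℕ} (h₁ : c ≠ α) (h₂ : c ≠ β) :
    flipAt α β S m v c = m v c := by
  simp [flipAt, Equiv.swap_apply_of_ne_of_ne h₁ h₂]

theorem flipAt_left {α β v : ℕ} {S : Finset ℕ} (h : v ∈ S) : flipAt α β S m v α = m v β := by
  simp [flipAt, h]

theorem swap_lt {α β c : ℕ} (hα : α < D) (hβ : β < D) (hc : c < D) : Equiv.swap α β c < D := by
  rw [Equiv.swap_apply_def]; split_ifs <;> assumption

/-- Closedness puts both ends of every edge of color `α` or `β` on the same side of `S`, so the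
exchange is made at both ends or at neither. -/
theorem NatGraph.Col.flipAt (hm : g.Col m) {α β : ℕ} {S : Finset ℕ} (hα : α < D) (hβ : β < D)
    (hS : Closed m α β S) : g.Col (flipAt α β S m) := by
  have key : ∀ v < n, ∀ c < D, ∀ w, m v c = w + 1 → (c = α ∨ c = β) → (v ∈ S ↔ w ∈ S) :=
    fun v hv c hc w hw hcc => ⟨fun h => hS v h c hcc w hw,
      fun h => hS w h c hcc v (hm.symm v hv c hc w hw)⟩
  have hsw : ∀ c, Equiv.swap α β c = α ∨ Equiv.swap α β c = β ∨
      (Equiv.swap α β c = c ∧ c ≠ α ∧ c ≠ β) := by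
    intro c; rw [Equiv.swap_apply_def]; split_ifs <;> tauto
  refine ⟨?_, ?_, ?_⟩
  · intro v hv c hc w hw
    unfold _root_.flipAt at hw
    split_ifs at hw
    · exact hm.adj v hv _ (swap_lt hα hβ hc) w hw
    · exact hm.adj v hv _ hc w hw
  · intro v hv c hc w hw
    unfold _root_.flipAt at hw ⊢
    split_ifs at hw with h
    · have h1 := hm.symm v hv _ (swap_lt hα hβ hc) w hw
      have h2 := key v hv _ (swap_lt hα hβ hc) w hw
      rcases hsw c with h3 | h3 | h3
      · rw [if_pos ((h2 (Or.inl h3)).1 h), h1]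
      · rw [if_pos ((h2 (Or.inr h3)).1 h), h1]
      · rw [h3.1] at h1 ⊢; simp [h1]
    · have h1 := hm.symm v hv _ hc w hw
      have h2 := key v hv _ hc w hw
      rcases hsw c with h3 | h3 | h3
      · rw [if_neg (fun hw' => h ((h2 ?_).2 hw')), h1]
        have := (Equiv.swap_apply_eq_iff).1 h3; simp at this; exact Or.inr this
      · rw [if_neg (fun hw' => h ((h2 ?_).2 hw')), h1]
        have := (Equiv.swap_apply_eq_iff).1 h3; simp at this; exact Or.inl this
      · rw [h3.1]; simp [h1]
  · intro v hv c hc c' hc' w hw hw'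
    unfold _root_.flipAt at hw hw'
    split_ifs at hw hw' with h
    · exact (Equiv.swap α β).injective
        (hm.inj v hv _ (swap_lt hα hβ hc) _ (swap_lt hα hβ hc') w hw hw')
    · exact hm.inj v hv c hc c' hc' w hw hw'

theorem Colored.flipAt {α β : ℕ} {S : Finset ℕ} (hα : α < D) (hβ : β < D) {v w : ℕ}
    (h : Colored D m v w) : Colored D (flipAt α β S m) v w := by
  obtain ⟨c, hc, h⟩ := h
  by_cases hv : v ∈ S
  · exact ⟨_, swap_lt hα hβ hc, by simp [_root_.flipAt, hv, h]⟩
  · exact ⟨c, hc, by simp [_root_.flipAt, hv, h]⟩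

theorem Closed.flipAt {α β : ℕ} {S T : Finset ℕ} (h : Closed m α β T) :
    Closed (flipAt α β S m) α β T := by
  intro v hv c hc w hw
  unfold _root_.flipAt at hw
  split_ifs at hw
  · refine h v hv _ ?_ w hw
    rcases hc with rfl | rfl <;> simp
  · exact h v hv c hc w hw

/-- The colors in use at `v` number at most its degree, less one if an edge is uncolored. -/
theorem NatGraph.Col.card_le (hm : g.Col m) {v : ℕ} (hv : v < n) {C : Finset ℕ}
    (hC : ∀ c ∈ C, c < D ∧ m v c ≠ 0) : C.card ≤ (g.N v).card := by
  refine Finset.card_le_card_of_injOn (fun c => m v c - 1) ?_ ?_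
  · intro c hc
    exact hm.adj v hv c (hC c hc).1 _ (by have := (hC c hc).2; dsimp only; omega)
  · intro c hc c' hc' h
    have h1 := (hC c hc).2
    have h2 := (hC c' hc').2
    dsimp only at h
    exact hm.inj v hv c (hC c hc).1 c' (hC c' hc').1 (m v c - 1) (by omega) (by omega)

theorem NatGraph.Col.card_lt (hm : g.Col m) {v w : ℕ} (hw : w ∈ g.N v) {C : Finset ℕ}
    (hC : ∀ c ∈ C, c < D ∧ m v c ≠ 0) (hunc : ∀ c < D, m v c ≠ w + 1) :
    C.card < (g.N v).card := by
  have hv := g.lt' hw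
  have : C.card ≤ ((g.N v).erase w).card := by
    refine Finset.card_le_card_of_injOn (fun c => m v c - 1) ?_ ?_
    · intro c hc
      have h1 := (hC c hc).2
      have h2 := hunc c (hC c hc).1
      refine Finset.mem_coe.2 (Finset.mem_erase.2 ⟨by dsimp only; omega, ?_⟩)
      exact hm.adj v hv c (hC c hc).1 _ (by dsimp only; omega)
    · intro c hc c' hc' h
      have h1 := (hC c hc).2
      have h2 := (hC c' hc').2
      dsimp only at h
      exact hm.inj v hv c (hC c hc).1 c' (hC c' hc').1 (m v c - 1) (by omega) (by omega)
  have h2 := Finset.card_erase_lt_of_mem hw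
  omega

/-! ### Alternating paths -/

/-- A walk along the edges of colors `c` and `d` started at `p₀`, where `d` is free, has
left the vertices in `S`, is at `p`, and leaves next through `c`. -/
structure WalkInv (m : ℕ → ℕ → ℕ) (p₀ : ℕ) (S : Finset ℕ) (p c d : ℕ) : Prop where
  fresh : p ∉ S
  mates : ∀ q ∈ S, ∀ e, e = c ∨ e = d → ∀ w, m q e = w + 1 → w ∈ insert p S
  back : ∀ w, m p d = w + 1 → w ∈ S
  sep : ∀ q ∈ S, m q c ≠ p + 1
  inner : ∀ q ∈ S, q ≠ p₀ → m q c ≠ 0 ∧ m q d ≠ 0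
  last : p ≠ p₀ → m p d ≠ 0
  start : p₀ ∈ insert p S

theorem WalkInv.init {p c d : ℕ} (h : m p d = 0) : WalkInv m p ∅ p c d := by
  constructor <;> simp [h]

/-- The next vertex is new, because `sep` excludes an edge of color `c` from `p` to a vertex already
left. It was entered through `c`, so the two colors change roles. -/
theorem WalkInv.step (hm : g.Col m) {p₀ p c d w : ℕ} {S : Finset ℕ} (h : WalkInv m p₀ S p c d)
    (hcd : c ≠ d) (hc : c < D) (hd : d < D) (hp : p < n) (hw : m p c = w + 1) :
    WalkInv m p₀ (insert p S) w d c := by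
  have hs := hm.symm p hp c hc w hw
  have hadj := hm.adj p hp c hc w hw
  have hwp : w ≠ p := fun h => g.irrefl p (h ▸ hadj)
  have hwS : w ∉ insert p S := by
    rw [Finset.mem_insert, not_or]
    exact ⟨hwp, fun h' => h.sep w h' hs⟩
  refine ⟨hwS, ?_, ?_, ?_, ?_, ?_, ?_⟩
  · intro q hq e he x hx
    rcases Finset.mem_insert.1 hq with rfl | hq
    · rcases he with rfl | rfl
      · exact Finset.mem_insert_of_mem (Finset.mem_insert_of_mem (h.back x hx))
      · obtain rfl : w = x := by omega
        exact Finset.mem_insert_self _ _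
    · exact Finset.mem_insert_of_mem (h.mates q hq e he.symm x hx)
  · intro x hx
    obtain rfl : x = p := by omega
    exact Finset.mem_insert_self _ _
  · intro q hq hx
    rcases Finset.mem_insert.1 hq with rfl | hq
    · exact hcd (hm.inj q hp c hc d hd w hw hx)
    · exact hwS (h.mates q hq d (Or.inr rfl) w hx)
  · intro q hq hq0
    rcases Finset.mem_insert.1 hq with rfl | hq
    · exact ⟨h.last hq0, by omega⟩
    · exact (h.inner q hq hq0).symm
  · intro; omega
  · exact Finset.mem_insert_of_mem h.start

theorem WalkInv.closed {p₀ p c d : ℕ} {S : Finset ℕ} (h : WalkInv m p₀ S p c d)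
    (hp : m p c = 0) : Closed m c d (insert p S) := by
  intro q hq e he w hw
  rcases Finset.mem_insert.1 hq with rfl | hq
  · rcases he with rfl | rfl
    · omega
    · exact Finset.mem_insert_of_mem (h.back w hw)
  · exact h.mates q hq e he w hw

/-- Inner vertices of the path use both colors. This is why one path contributes at most two
vertices to the count of ends in the second pass. -/
theorem WalkInv.ends {p₀ p c d : ℕ} {S : Finset ℕ} (h : WalkInv m p₀ S p c d) :
    ∀ q ∈ insert p S, m q c = 0 ∨ m q d = 0 → q = p₀ ∨ q = p := by
  intro q hq h0
  rcases Finset.mem_insert.1 hq with rfl | hq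
  · exact Or.inr rfl
  · by_contra! hne
    have := h.inner q hq hne.1
    omega

/-! ### Fans -/

/-- A tree of neighbors of `u` with root `v`: the edge from `u` to a vertex `w` of the tree has,
at the start, the color `K w`, which is free at the parent of `w`; the parent is `pc (K w) - 1`.
Ranks increase away from the root. -/
structure FanTree (g : NatGraph n D) (pc K : ℕ → ℕ) (u v : ℕ) (T : Finset ℕ) (r : ℕ → ℕ) :
    Prop where
  root : v ∈ g.N u
  root_notMem : v ∉ T
  root_rank : r v = 0
  sub : T ⊆ g.N u
  key_lt : ∀ w ∈ T, K w < D
  rank_le : ∀ w ∈ T, r w ≤ D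
  parent : ∀ w ∈ T, ∃ p, pc (K w) = p + 1 ∧ (p = v ∨ p ∈ T) ∧ r p < r w

/-- The coloring `m` still has, at the vertices of rank at most `R`, the colors of the tree. -/
def Live (m : ℕ → ℕ → ℕ) (pc K : ℕ → ℕ) (u : ℕ) (T : Finset ℕ) (r : ℕ → ℕ) (R : ℕ) : Prop :=
  ∀ w ∈ T, r w ≤ R → m u (K w) = w + 1 ∧ ∀ p, pc (K w) = p + 1 → m p (K w) = 0

theorem FanTree.mem_nbr {pc K : ℕ → ℕ} {u v t : ℕ} {T : Finset ℕ} {r : ℕ → ℕ}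
    (hT : FanTree g pc K u v T r) (ht : t = v ∨ t ∈ T) : t ∈ g.N u :=
  ht.elim (fun h => h ▸ hT.root) fun h => hT.sub h

/-- The invariant of the shift of a fan, which started with the coloring `m₀` and is about to
give the color `c` to the edge `ut`.  Edges of the colors `α` and `β` are changed inside `X`. -/
structure ShiftInv (g : NatGraph n D) (m₀ m : ℕ → ℕ → ℕ) (pc K : ℕ → ℕ) (u v : ℕ) (T : Finset ℕ)
    (r : ℕ → ℕ) (t c : ℕ) (X : Set ℕ) (α β : ℕ) : Prop where
  col : g.Col m
  tree : FanTree g pc K u v T r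
  live : Live m pc K u T r (r t)
  target : t = v ∨ t ∈ T
  lt : c < D
  free : m u c = 0
  free' : m t c = 0
  uncolored : ∀ c < D, m u c ≠ v + 1
  colored : ∀ a < n, ∀ b, Colored D m₀ a b → Colored D m a b
  rows : ∀ a, a ∉ g.ball u → ∀ b < D, m a b = m₀ a b
  closed : ∀ a ∈ X, ∀ e < D, e = α ∨ e = β → ∀ w, m a e = w + 1 → w ∈ X
  outside : ∀ a < n, a ∉ X → ∀ e < D, e = α ∨ e = β → m a e = m₀ a e
  center : u ∈ X
  target_mem : c = α ∨ c = β → t ∈ X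
  parent_mem : ∀ w ∈ T, r w ≤ r t → K w = α ∨ K w = β → ∀ p, pc (K w) = p + 1 → p ∈ X

/-- The edge to `t` gives up the color `K t`, which is then free at the center and, by `live`, at
the parent. Vertices of smaller rank keep their keys, since colors at the center are distinct. An
edge changed in color `α` or `β` has both ends in `X`, so `X` stays closed. -/
theorem ShiftInv.step {m₀ : ℕ → ℕ → ℕ} {pc K : ℕ → ℕ} {u v t c p α β : ℕ} {T : Finset ℕ}
    {r : ℕ → ℕ} {X : Set ℕ} (h : ShiftInv g m₀ m pc K u v T r t c X α β) (htv : t ≠ v)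
    (hp : pc (K t) = p + 1)
    (hm' : ∀ a, ∀ b < D, m' a b = if a = u ∧ b = c then t + 1 else if a = t ∧ b = c then u + 1
      else if (a = u ∨ a = t) ∧ b = K t then 0 else m a b) :
    ShiftInv g m₀ m' pc K u v T r p (K t) X α β := by
  have htT : t ∈ T := h.target.resolve_left htv
  have hun : u < n := g.lt' (h.tree.sub htT)
  have hk := h.tree.key_lt t htT
  obtain ⟨hmu, hmp⟩ := h.live t htT le_rfl
  have hmp := hmp p hp
  have hck : c ≠ K t := fun e => by have := h.free; rw [e] at this; omega
  obtain ⟨p', hp', hpT, hr⟩ := h.tree.parent t htT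
  obtain rfl : p = p' := by omega
  have htu : t ≠ u := fun e => g.irrefl u (e ▸ h.tree.sub htT)
  have hpt : p ≠ t := fun e => by subst e; omega
  have hpu : p ≠ u := fun e => g.irrefl u (e ▸ h.tree.mem_nbr hpT)
  have hmt : m t (K t) = u + 1 := h.col.symm u hun _ hk _ hmu
  have hdel : g.Col (fun a b => if (a = u ∨ a = t) ∧ b = K t then 0 else m a b) :=
    h.col.del hun hk hmu (fun _ _ _ => rfl)
  have hunc' : ∀ b < D, (if (u = u ∨ u = t) ∧ b = K t then 0 else m u b) ≠ t + 1 := by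
    intro b hb hbt
    split_ifs at hbt with h1
    exact h1 ⟨Or.inl rfl, h.col.inj u hun b hb _ hk t hbt hmu⟩
  refine ⟨?_, h.tree, ?_, hpT, hk, ?_, ?_, ?_, ?_, ?_, ?_, ?_, h.center, ?_, ?_⟩
  · refine hdel.put (h.tree.mem_nbr h.target) ?_ ?_ hunc' hm'
    · simp [hck, h.free]
    · simp [hck, h.free']
  · intro w hw hrw
    obtain ⟨h1, h2⟩ := h.live w hw (by omega)
    have hwt : w ≠ t := fun e => by subst e; omega
    have hkw := h.tree.key_lt w hw
    have hkk : K w ≠ K t := fun e => by rw [e] at h1; omega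
    have hkc : K w ≠ c := fun e => by rw [e, h.free] at h1; omega
    refine ⟨by rw [hm' _ _ hkw]; simp [hkk, hkc, h1], fun q hq => ?_⟩
    rw [hm' _ _ hkw]; simp [hkk, hkc, h2 q hq]
  · rw [hm' _ _ hk]; simp [hck.symm]
  · rw [hm' _ _ hk]; simp [hpt, hpu, hmp]
  · intro b hb
    rw [hm' _ _ hb]
    have := h.uncolored b hb
    grind
  · intro a ha b hab
    obtain ⟨e, he, hab⟩ := h.colored a ha b hab
    have h1 := hm' a c h.lt
    have h2 := hm' a e he
    by_cases hae : (a = u ∨ a = t) ∧ e = K t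
    · refine ⟨c, h.lt, ?_⟩
      rcases hae with ⟨rfl | rfl, rfl⟩
      · simp [h1]; omega
      · simp [h1, htu]; omega
    · refine ⟨e, he, ?_⟩
      have := h.free
      have := h.free'
      grind
  · intro a ha b hb
    have hau : a ≠ u := fun e => ha (e ▸ Finset.mem_insert_self _ _)
    have hat : a ≠ t := fun e => ha (e ▸ Finset.mem_insert_of_mem (h.tree.sub htT))
    rw [hm' a b hb, ← h.rows a ha b hb]
    simp [hau, hat]
  · intro a ha e he hee w hw
    rw [hm' a e he] at hw
    split_ifs at hw with h1 h2 h3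
    · obtain rfl : t = w := by omega
      exact h.target_mem (by rw [← h1.2]; exact hee)
    · obtain rfl : u = w := by omega
      exact h.center
    · exact h.closed a ha e he hee w hw
  · intro a han ha e he hee
    rw [← h.outside a han ha e he hee, hm' a e he]
    have hau : a ≠ u := fun e => ha (e ▸ h.center)
    have h1 : ¬ (a = t ∧ e = c) := fun h1 => ha (by
      rw [h1.1]; exact h.target_mem (by rw [← h1.2]; exact hee))
    have h2 : ¬ (a = t ∧ e = K t) := fun h2 => ha (by
      rw [h2.1]
      refine h.closed u h.center (K t) hk (by rw [← h2.2]; exact hee) t hmu)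
    grind
  · exact fun hkk => h.parent_mem t htT le_rfl hkk p hp
  · exact fun w hw hrw => h.parent_mem w hw (by omega)

/-- The result of the shift, in which the root has got a color. -/
structure Shifted (g : NatGraph n D) (m₀ m : ℕ → ℕ → ℕ) (u v : ℕ) (X : Set ℕ) (α β : ℕ) :
    Prop where
  col : g.Col m
  new : Colored D m u v
  colored : ∀ a < n, ∀ b, Colored D m₀ a b → Colored D m a b
  rows : ∀ a, a ∉ g.ball u → ∀ b < D, m a b = m₀ a b
  closed : ∀ a ∈ X, ∀ e < D, e = α ∨ e = β → ∀ w, m a e = w + 1 → w ∈ X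
  outside : ∀ a < n, a ∉ X → ∀ e < D, e = α ∨ e = β → m a e = m₀ a e

theorem ShiftInv.finish {m₀ : ℕ → ℕ → ℕ} {pc K : ℕ → ℕ} {u v c α β : ℕ} {T : Finset ℕ}
    {r : ℕ → ℕ} {X : Set ℕ} (h : ShiftInv g m₀ m pc K u v T r v c X α β)
    (hm' : ∀ a, ∀ b < D, m' a b =
      if a = u ∧ b = c then v + 1 else if a = v ∧ b = c then u + 1 else m a b) :
    Shifted g m₀ m' u v X α β := by
  have hvu : v ≠ u := fun e => g.irrefl u (e ▸ h.tree.root)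
  refine ⟨h.col.put h.tree.root h.free h.free' h.uncolored hm', ⟨c, h.lt, ?_⟩, ?_, ?_, ?_, ?_⟩
  · rw [hm' _ _ h.lt]; simp
  · intro a ha b hab
    obtain ⟨e, he, hab⟩ := h.colored a ha b hab
    refine ⟨e, he, ?_⟩
    have := h.free
    have := h.free'
    have := hm' a e he
    grind
  · intro a ha b hb
    have hau : a ≠ u := fun e => ha (e ▸ Finset.mem_insert_self _ _)
    have hat : a ≠ v := fun e => ha (e ▸ Finset.mem_insert_of_mem h.tree.root)
    rw [hm' a b hb, ← h.rows a ha b hb]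
    simp [hau, hat]
  · intro a ha e he hee w hw
    rw [hm' a e he] at hw
    split_ifs at hw with h1 h2
    · obtain rfl : v = w := by omega
      exact h.target_mem (by rw [← h1.2]; exact hee)
    · obtain rfl : u = w := by omega
      exact h.center
    · exact h.closed a ha e he hee w hw
  · intro a han ha e he hee
    rw [← h.outside a han ha e he hee, hm' a e he]
    have hau : a ≠ u := fun e => ha (e ▸ h.center)
    have h1 : ¬ (a = v ∧ e = c) := fun h1 => ha (by
      rw [h1.1]; exact h.target_mem (by rw [← h1.2]; exact hee))
    grind

/-- A fan with center `u` and uncolored edge `uv` whose vertices `x` and `y` share the free color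
`β`, while `α` is free at `u`. -/
structure ValidFan (g : NatGraph n D) (m : ℕ → ℕ → ℕ) (pc K : ℕ → ℕ) (u v x y α β : ℕ)
    (T : Finset ℕ) (r : ℕ → ℕ) : Prop where
  tree : FanTree g pc K u v T r
  live : Live m pc K u T r D
  uncolored : ∀ c < D, m u c ≠ v + 1
  left : x = v ∨ x ∈ T
  right : y = v ∨ y ∈ T
  ne : x ≠ y
  ltα : α < D
  ltβ : β < D
  color_ne : α ≠ β
  freeα : m u α = 0
  free_left : m x β = 0
  free_right : m y β = 0
  claim : pc β = y + 1

/-- A fan depends only on the rows of the closed neighborhood of its center, so recoloring around a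
center with a disjoint closed neighborhood leaves it intact. -/
theorem ValidFan.congr {pc K : ℕ → ℕ} {u v x y α β : ℕ} {T : Finset ℕ} {r : ℕ → ℕ}
    (h : ValidFan g m pc K u v x y α β T r)
    (he : ∀ a ∈ g.ball u, ∀ c < D, m' a c = m a c) : ValidFan g m' pc K u v x y α β T r := by
  have hb : ∀ {t}, t = v ∨ t ∈ T → t ∈ g.ball u := fun ht =>
    Finset.mem_insert_of_mem (h.tree.mem_nbr ht)
  have hu : u ∈ g.ball u := Finset.mem_insert_self _ _
  refine ⟨h.tree, ?_, ?_, h.left, h.right, h.ne, h.ltα, h.ltβ, h.color_ne, ?_, ?_, ?_, h.claim⟩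
  · intro w hw hr
    have hk := h.tree.key_lt w hw
    obtain ⟨h1, h2⟩ := h.live w hw hr
    refine ⟨by rw [he _ hu _ hk, h1], fun p hp => ?_⟩
    obtain ⟨p', hp', hpT, -⟩ := h.tree.parent w hw
    obtain rfl : p = p' := by omega
    rw [he _ (hb hpT) _ hk, h2 p hp]
  · intro c hc; rw [he _ hu _ hc]; exact h.uncolored c hc
  · rw [he _ hu _ h.ltα, h.freeα]
  · rw [he _ (hb h.left) _ h.ltβ, h.free_left]
  · rw [he _ (hb h.right) _ h.ltβ, h.free_right]

/-- No key is `α`, which is free at the center, and a vertex with key `β` has the parent `y`, the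
claimant of `β`. Hence the exchange can do harm only at `y`. -/
theorem Live.flipAt {pc K : ℕ → ℕ} {u α β y R : ℕ} {T S : Finset ℕ} {r : ℕ → ℕ}
    (h : Live m pc K u T r R) (hu : u ∉ S) (hα : m u α = 0) (hβ : pc β = y + 1)
    (hy : y ∈ S → ∀ w ∈ T, r w ≤ R → K w ≠ β) : Live (flipAt α β S m) pc K u T r R := by
  intro w hw hr
  obtain ⟨h1, h2⟩ := h w hw hr
  refine ⟨by rw [flipAt_of_notMem hu, h1], fun p hp => ?_⟩
  have hka : K w ≠ α := fun e => by rw [e, hα] at h1; omega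
  by_cases hkb : K w = β
  · rw [flipAt_of_notMem, h2 p hp]
    obtain rfl : p = y := by rw [hkb] at hp; omega
    exact fun hp => hy hp w hw hr hkb
  · rw [flipAt_of_ne hka hkb, h2 p hp]

/-- The exchanged set may contain other vertices of the tree. This is why it is enough to test `u`,
`x` and `y` for being touched. -/
theorem ValidFan.flipAt {pc K : ℕ → ℕ} {u v x y α β : ℕ} {T S : Finset ℕ} {r : ℕ → ℕ}
    (h : ValidFan g m pc K u v x y α β T r) (hu : u ∉ S) (hx : x ∉ S) (hy : y ∉ S) :
    ValidFan g (flipAt α β S m) pc K u v x y α β T r := by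
  refine ⟨h.tree, h.live.flipAt hu h.freeα h.claim (fun h => absurd h hy), ?_, h.left, h.right,
    h.ne, h.ltα, h.ltβ, h.color_ne, ?_, ?_, ?_, h.claim⟩
  · intro c hc; rw [flipAt_of_notMem hu]; exact h.uncolored c hc
  · rw [flipAt_of_notMem hu, h.freeα]
  · rw [flipAt_of_notMem hx, h.free_left]
  · rw [flipAt_of_notMem hy, h.free_right]

theorem Live.mono {pc K : ℕ → ℕ} {u R R' : ℕ} {T : Finset ℕ} {r : ℕ → ℕ}
    (h : Live m pc K u T r R) (hR : R' ≤ R) : Live m pc K u T r R' :=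
  fun w hw hr => h w hw (hr.trans hR)

/-- After the exchange of `α` and `β` on a closed set that contains `t` but not `u`, the fan can
be shifted from `t`, where `t` is `x` or `y`, and `y` if `y` is exchanged. -/
theorem ValidFan.shiftInv {pc K : ℕ → ℕ} {u v x y α β t : ℕ} {T S : Finset ℕ} {r : ℕ → ℕ}
    {X : Finset ℕ} (h : ValidFan g m pc K u v x y α β T r) (hm : g.Col m)
    (hS : Closed m α β S) (hu : u ∉ S) (ht : t ∈ S)
    (hty : t = y ∨ (t = x ∧ y ∉ S ∧ y ∈ X)) (hX : Closed m α β X) (huX : u ∈ X) (htX : t ∈ X) :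
    ShiftInv g (_root_.flipAt α β S m) (_root_.flipAt α β S m) pc K u v T r t α X α β := by
  have htT : t = v ∨ t ∈ T := by
    rcases hty with rfl | ⟨rfl, -⟩
    · exact h.right
    · exact h.left
  have htD : r t ≤ D := by
    rcases htT with rfl | htT
    · simp [h.tree.root_rank]
    · exact h.tree.rank_le t htT
  -- If the shift starts at `y`, it never meets the key `β`: that vertex has parent `y` and hence
  -- larger rank than `y`.
  have hkey : ∀ w ∈ T, r w ≤ r t → K w = β → t = x ∧ y ∉ S ∧ y ∈ X := by
    intro w hw hrw hkb
    rcases hty with rfl | hty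
    · obtain ⟨p, hp, -, hlt⟩ := h.tree.parent w hw
      rw [hkb, h.claim] at hp
      obtain rfl : t = p := by omega
      omega
    · exact hty
  refine ⟨hm.flipAt h.ltα h.ltβ hS, h.tree, ?_, htT, h.ltα, ?_, ?_, ?_, fun _ _ _ h => h,
    fun _ _ _ _ => rfl, ?_, fun _ _ _ _ _ _ => rfl, huX, fun _ => htX, ?_⟩
  · exact (h.live.mono htD).flipAt hu h.freeα h.claim
      (fun hy w hw hrw hkb => (hkey w hw hrw hkb).2.1 hy)
  · rw [flipAt_of_notMem hu, h.freeα]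
  · rw [flipAt_left ht]
    rcases hty with rfl | ⟨rfl, -⟩
    · exact h.free_right
    · exact h.free_left
  · intro c hc; rw [flipAt_of_notMem hu]; exact h.uncolored c hc
  · exact fun a ha e _ hee w hw => hX.flipAt a ha e hee w hw
  · intro w hw hrw hkk p hp
    rcases hkk with hkk | hkk
    · have := (h.live w hw (hrw.trans htD)).1
      rw [hkk, h.freeα] at this; omega
    · have := (hkey w hw hrw hkk).2.2
      rw [hkk, h.claim] at hp
      obtain rfl : y = p := by omega
      exact this

/-! ### Memory -/

/-- The array `f` read as a matrix with rows of length `D`. -/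
def mat (D : ℕ) (f : ℕ → ℕ) (v c : ℕ) : ℕ := f (v * D + c)

theorem mat_update {D v c x : ℕ} {f : ℕ → ℕ} (hc : c < D) (v' : ℕ) {c' : ℕ} (hc' : c' < D) :
    mat D (Function.update f (v * D + c) x) v' c' =
      if v' = v ∧ c' = c then x else mat D f v' c' := by
  unfold mat
  by_cases h : v' = v ∧ c' = c
  · rw [h.1, h.2]; simp
  · rw [if_neg h, Function.update_of_ne]
    intro he
    apply h
    have h1 : (c' + D * v') / D = (c + D * v) / D := by
      rw [mul_comm D, mul_comm D, add_comm c', add_comm c, he]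
    rw [Nat.add_mul_div_left _ _ (by omega), Nat.add_mul_div_left _ _ (by omega),
      Nat.div_eq_of_lt hc, Nat.div_eq_of_lt hc', zero_add, zero_add] at h1
    subst h1
    exact ⟨rfl, by omega⟩

/-- The words are long enough for a graph with `n` vertices. -/
structure WordSize (n D W : ℕ) : Prop where
  deg_le : D ≤ n
  le : 4 * ((n + 1) * (n + 1)) ≤ W

theorem WordSize.row {n D W : ℕ} (h : WordSize n D W) {v : ℕ} (hv : v < n) : v * D < W := by
  have := h.deg_le; have := h.le; nlinarith

theorem WordSize.addr {n D W : ℕ} (h : WordSize n D W) {v c : ℕ} (hv : v < n) (hc : c ≤ n) :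
    v * D + c < W := by
  have := h.deg_le; have := h.le; nlinarith

theorem WordSize.small {n D W : ℕ} (h : WordSize n D W) {c : ℕ} (hc : c ≤ n + 3) : c < W := by
  have := h.le; nlinarith

theorem WordSize.sq {n D W : ℕ} (h : WordSize n D W) {c : ℕ} (hc : c ≤ 2 * (n * n) + 3) :
    c < W := by
  have := h.le; nlinarith

/-- The registers that keep their values throughout. -/
structure Base (D : ℕ) (s : State) : Prop where
  D : s.var rD = D
  one : s.var r1 = 1
  zero : s.var r0 = 0

theorem Frame.refl {X A : List ℕ} (s : State) : Frame X A s s := ⟨fun _ _ => rfl, fun _ _ => rfl⟩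

theorem Frame.setVar {X A : List ℕ} {s t : State} {x v : ℕ} (hx : x ∈ X) (h : Frame X A s t) :
    Frame X A s (t.setVar x v) := by
  refine ⟨fun y hy => ?_, h.2⟩
  rw [var_setVar, if_neg (by rintro rfl; exact hy hx), h.1 y hy]

theorem Frame.setArr {X A : List ℕ} {s t : State} {a i v : ℕ} (ha : a ∈ A) (h : Frame X A s t) :
    Frame X A s (t.setArr a i v) := by
  refine ⟨h.1, fun b hb => ?_⟩
  rw [arr_setArr, if_neg (by rintro rfl; exact hb ha), h.2 b hb]

theorem Frame.trans {X A X' A' : List ℕ} {s t t' : State} (h : Frame X A s t)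
    (h' : Frame X' A' t t') (hX : X' ⊆ X) (hA : A' ⊆ A) : Frame X A s t' :=
  ⟨fun x hx => (h'.1 x fun e => hx (hX e)).trans (h.1 x hx),
    fun a ha => (h'.2 a fun e => ha (hA e)).trans (h.2 a ha)⟩

theorem Base.frame {D : ℕ} {X A : List ℕ} {s s' : State} (h : Base D s) (hf : Frame X A s s')
    (hX : rD ∉ X ∧ r1 ∉ X ∧ r0 ∉ X) : Base D s' :=
  ⟨by rw [hf.1 _ hX.1, h.D], by rw [hf.1 _ hX.2.1, h.one], by rw [hf.1 _ hX.2.2, h.zero]⟩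

/-! ### Searching for a free color, recoloring one edge, shifting a fan -/

section Subprograms

variable {W : ℕ} {Q : State → ℕ → Prop} {s : State} {τ : ℕ}

theorem wp_nextFree (hW : WordSize n D W) (hb : Base D s) (hw : s.var rW < n)
    (hc : s.var rC ≤ D)
    (post : ∀ s' τ', Frame [rC, rLim, rQ, rT] [] s s' → s.var rC ≤ s'.var rC → s'.var rC ≤ D →
      (∀ e, s.var rC ≤ e → e < s'.var rC → mat D (s.arr aM) (s.var rW) e ≠ 0) →
      (s'.var rC < D → mat D (s.arr aM) (s.var rW) (s'.var rC) = 0) →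
      τ' ≤ τ + 10 * (s'.var rC - s.var rC) + 20 → Q s' τ') :
    WP W Prog.nextFree Q s τ := by
  have hDn := hW.deg_le
  have hDW : D < W := hW.small (by omega)
  have h1W : 1 < W := hW.small (by omega)
  simp only [Prog.nextFree, wp_seq, wp_mov, hb.D, hb.zero, add_zero]
  refine ⟨hDW, ?_⟩
  -- Either the search continues, with `rLim = D`, or a color has been found and `rLim = 0` forces
  -- the exit, with variant 0.
  refine wp_while (fun k s' τ' => Frame [rC, rLim, rQ, rT] [] s s' ∧ s.var rC ≤ s'.var rC ∧
      s'.var rC ≤ D ∧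
      (∀ e, s.var rC ≤ e → e < s'.var rC → mat D (s.arr aM) (s.var rW) e ≠ 0) ∧
      ((s'.var rLim = D ∧ k = D - s'.var rC + 1 ∧
          τ' ≤ τ + 10 * (s'.var rC - s.var rC) + 1) ∨
        (s'.var rLim = 0 ∧ k = 0 ∧ s'.var rC < D ∧
          mat D (s.arr aM) (s.var rW) (s'.var rC) = 0 ∧
          τ' ≤ τ + 10 * (s'.var rC - s.var rC) + 11))) ?_ ?_ (D - s.var rC + 1) ?_
  · rintro k t σ ⟨hf, hlo, hhi, hne, h⟩ hlt
    have hbt := hb.frame hf (by simp)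
    have ht : t.var rW = s.var rW := hf.1 _ (by simp)
    have hta : t.arr aM = s.arr aM := hf.2 _ (by simp)
    rcases h with ⟨hl, rfl, hτ⟩ | ⟨hl, -⟩
    swap
    · omega
    rw [hl] at hlt
    simp only [wp_seq, wp_ld2, wp_arith, wp_load, wp_ifLt, wp_mov, eval_mul, eval_add, var_setVar,
      arr_setVar, hbt.D, hbt.one, hbt.zero, ht, hta]
    norm_num
    refine ⟨hW.row hw, hW.addr hw (by omega), fun h0 => ⟨by omega, 0, by omega, ?_⟩,
      fun h0 => ⟨hW.small (by omega), D - (t.var rC + 1) + 1, by omega, ?_⟩⟩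
    · exact ⟨by simp (maxDischargeDepth := 20) [Frame.setVar, hf], hlo, hhi, hne, Or.inr ⟨rfl, hlt, h0, by omega⟩⟩
    · refine ⟨by simp (maxDischargeDepth := 20) [Frame.setVar, hf], by omega, by omega, ?_, Or.inl ⟨hl, by omega⟩⟩
      intro e he he'
      rcases Nat.lt_or_eq_of_le he' with h | rfl
      · exact hne e he h
      · exact h0
  · rintro k t σ ⟨hf, hlo, hhi, hne, h⟩ hlt
    refine post t _ hf hlo hhi hne ?_ ?_
    · intro hD
      rcases h with ⟨hl, -, -⟩ | ⟨-, -, -, h, -⟩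
      · omega
      · exact h
    · rcases h with ⟨hl, -, h⟩ | ⟨-, -, -, -, h⟩ <;> omega
  · refine ⟨by simp (maxDischargeDepth := 20) [Frame.setVar, Frame.refl], by simp, by simpa using hc, ?_,
      Or.inl ⟨by simp, by simp, by simp⟩⟩
    simp only [var_setVar]
    norm_num
    omega

theorem wp_putColor (hW : WordSize n D W) (hb : Base D s) (hu : s.var rU < n)
    (hx : s.var rX < n) (hc : s.var rC < D)
    (post : ∀ s' τ', Frame [rQ, rT] [aM] s s' →
      (∀ a, ∀ b < D, mat D (s'.arr aM) a b =
        if a = s.var rX ∧ b = s.var rC then s.var rU + 1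
        else if a = s.var rU ∧ b = s.var rC then s.var rX + 1 else mat D (s.arr aM) a b) →
      τ' ≤ τ + 8 → Q s' τ') :
    WP W Prog.putColor Q s τ := by
  have hDn := hW.deg_le
  simp only [Prog.putColor, wp_seq, wp_st2, wp_arith, wp_store, eval_mul, eval_add, var_setVar,
    var_setArr, hb.D, hb.one]
  norm_num
  refine ⟨hW.small (by omega), hW.row hu, hW.addr hu (by omega), hW.small (by omega), hW.row hx,
    hW.addr hx (by omega), post _ _ ?_ ?_ le_rfl⟩
  · simp (maxDischargeDepth := 20) [Frame.setVar, Frame.setArr, Frame.refl]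
  · intro a b hb
    simp [mat_update hc _ hb]

theorem wp_delColor (hW : WordSize n D W) (hb : Base D s) (hu : s.var rU < n)
    (hx : s.var rX < n) (hc : s.var rH < D)
    (post : ∀ s' τ', Frame [rT] [aM] s s' →
      (∀ a, ∀ b < D, mat D (s'.arr aM) a b =
        if (a = s.var rU ∨ a = s.var rX) ∧ b = s.var rH then 0 else mat D (s.arr aM) a b) →
      τ' ≤ τ + 6 → Q s' τ') :
    WP W Prog.delColor Q s τ := by
  have hDn := hW.deg_le
  simp only [Prog.delColor, wp_seq, wp_st2, wp_arith, wp_store, eval_mul, eval_add, var_setVar,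
    var_setArr, hb.D, hb.zero]
  norm_num
  refine ⟨hW.row hu, hW.addr hu (by omega), hW.row hx, hW.addr hx (by omega), post _ _ ?_ ?_ le_rfl⟩
  · simp (maxDischargeDepth := 20) [Frame.setVar, Frame.setArr, Frame.refl]
  · intro a b hb
    simp [mat_update hc _ hb]
    grind

theorem wp_shiftFan {g : NatGraph n D} {u v α β : ℕ} {T : Finset ℕ} {r : ℕ → ℕ}
    {X : Set ℕ} (hW : WordSize n D W) (hb : Base D s) (hu : s.var rU = u) (hv : s.var rV = v)
    (h : ShiftInv g (mat D (s.arr aM)) (mat D (s.arr aM)) (mat D (s.arr aPred) u) (s.arr aKey)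
      u v T r (s.var rX) (s.var rC) X α β)
    (post : ∀ s' τ', Frame [rGo, rH, rX, rC, rQ, rT] [aM] s s' →
      Shifted g (mat D (s.arr aM)) (mat D (s'.arr aM)) u v X α β →
      τ' ≤ τ + 40 * D + 60 → Q s' τ') :
    WP W Prog.shiftFan Q s τ := by
  have hDn := hW.deg_le
  have hun : u < n := g.lt' h.tree.root
  have hvn : v < n := g.lt h.tree.root
  have h1W : 1 < W := hW.small (by omega)
  simp only [Prog.shiftFan, wp_seq, wp_const]
  refine ⟨by omega, ?_⟩
  have htD : r (s.var rX) ≤ D := by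
    rcases h.target with h' | h'
    · rw [h', h.tree.root_rank]; omega
    · exact h.tree.rank_le _ h'
  -- The shift descends strictly in rank, which gives the variant; ranks are at most `D`, whence the
  -- term `40 * D` in the time.
  refine wp_while (fun k t σ => Frame [rGo, rH, rX, rC, rQ, rT] [aM] s t ∧
      ShiftInv g (mat D (s.arr aM)) (mat D (t.arr aM)) (mat D (s.arr aPred) u) (s.arr aKey)
        u v T r (t.var rX) (t.var rC) X α β ∧
      ((t.var rGo = 0 ∧ k = r (t.var rX) + 1 ∧ σ + 40 * r (t.var rX) ≤ τ + 40 * D + 10) ∨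
        (t.var rGo = 1 ∧ k = 0 ∧ t.var rX = v ∧ σ ≤ τ + 40 * D + 20))) ?_ ?_
      (r (s.var rX) + 1) ?_
  · rintro k t σ ⟨hf, hI, hk⟩ hlt
    have hbt := hb.frame hf (by simp)
    have htu : t.var rU = u := by rw [hf.1 _ (by simp), hu]
    have htv : t.var rV = v := by rw [hf.1 _ (by simp), hv]
    have htK : t.arr aKey = s.arr aKey := hf.2 _ (by simp)
    have htP : t.arr aPred = s.arr aPred := hf.2 _ (by simp)
    have htn : t.var rX < n := g.lt (h.tree.mem_nbr hI.target)
    rcases hk with ⟨hgo, rfl, hσ⟩ | ⟨hgo, -⟩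
    swap
    · rw [hbt.one, hgo] at hlt; omega
    rw [wp_ifEq]
    refine ⟨fun he => ?_, fun he => ?_⟩
    · rw [wp_const]
      refine ⟨h1W, 0, by omega, by simp (maxDischargeDepth := 20) [Frame.setVar, hf], by simpa using hI, Or.inr ?_⟩
      simp
      omega
    · rw [htv] at he
      have htT := hI.target.resolve_left he
      have hKD := hI.tree.key_lt _ htT
      obtain ⟨p, hp, -, hr⟩ := hI.tree.parent _ htT
      simp only [wp_seq, wp_load]
      refine wp_delColor hW ?_ ?_ ?_ ?_ ?_
      · exact hbt.frame (X := [rH]) (A := []) (Frame.setVar (by simp) (Frame.refl t)) (by simp)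
      · simpa [htu] using hun
      · simpa using htn
      · simpa [htK] using hKD
      intro t1 σ1 hf1 hm1 hσ1
      simp [htu, htK] at hm1
      have hf1' : Frame [rH, rT] [aM] t t1 :=
        Frame.trans (Frame.setVar (by simp) (Frame.refl t)) hf1 (by simp) (by simp)
      have hH1 : t1.var rH = s.arr aKey (t.var rX) := by rw [hf1.1 _ (by simp)]; simp [htK]
      refine wp_putColor hW (hbt.frame hf1' (by simp)) ?_ ?_ ?_ ?_
      · simpa [hf1'.1, htu] using hun
      · simpa [hf1'.1] using htn
      · simpa [hf1'.1] using hI.lt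
      intro t2 σ2 hf2 hm2 hσ2
      simp [hf1'.1, htu] at hm2
      have hf2' : Frame [rH, rT, rQ] [aM] t t2 :=
        Frame.trans (Frame.trans (Frame.refl t) hf1' (by simp) (by simp)) hf2 (by simp) (by simp)
      have hbt2 := hbt.frame hf2' (by simp)
      have hH2 : t2.var rH = s.arr aKey (t.var rX) := by rw [hf2.1 _ (by simp), hH1]
      have hpr : t2.arr aPred (u * D + s.arr aKey (t.var rX)) = p + 1 := by
        rw [hf2'.2 _ (by simp), htP]; exact hp
      have hpn : p < n := by
        obtain ⟨p', hp', hpT, -⟩ := hI.tree.parent _ htT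
        obtain rfl : p = p' := by omega
        exact g.lt (h.tree.mem_nbr hpT)
      have htu2 : t2.var rU = u := by rw [hf2'.1 _ (by simp), htu]
      simp only [wp_ld2, wp_arith, wp_load, wp_mov, eval_mul, eval_add, eval_sub, var_setVar,
        arr_setVar, hbt2.D, hbt2.one, hbt2.zero, hH2, htu2]
      norm_num
      simp only [hpr]
      refine ⟨hW.row hun, hW.addr hun (by omega), hW.small (by omega), hW.small (by omega),
        r p + 1, by omega, ?_, ?_, Or.inl ⟨?_, rfl, ?_⟩⟩
      · have : Frame [rGo, rH, rX, rC, rQ, rT] [aM] s t2 := hf.trans hf2' (by simp) (by simp)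
        simp (maxDischargeDepth := 20) [Frame.setVar, this]
      · refine hI.step he hp ?_
        intro a b hb
        rw [hm2 a b hb, hm1 a b hb]
        have : t.var rX ≠ u := fun e => g.irrefl u (e ▸ h.tree.sub htT)
        grind
      · rw [hf2'.1 _ (by simp), hgo]
      · simp only [Nat.add_sub_cancel]; omega
  · rintro k t σ ⟨hf, hI, hk⟩ hlt
    have hbt := hb.frame hf (by simp)
    have htu : t.var rU = u := by rw [hf.1 _ (by simp), hu]
    rcases hk with ⟨hgo, -⟩ | ⟨hgo, -, hX, hσ⟩
    · rw [hbt.one, hgo] at hlt; omega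
    refine wp_putColor hW hbt (by rwa [htu]) (by rwa [hX]) hI.lt ?_
    intro t2 σ2 hf2 hm2 hσ2
    rw [htu, hX] at hm2
    rw [hX] at hI
    refine post _ _ (hf.trans hf2 (by simp) (by simp)) (hI.finish ?_) (by omega)
    intro a b hb
    rw [hm2 a b hb]
    have : v ≠ u := fun e => g.irrefl u (e ▸ h.tree.root)
    grind
  · refine ⟨by simp (maxDischargeDepth := 20) [Frame.setVar, Frame.refl], by simpa using h, Or.inl ?_⟩
    simp
    omega

end Subprograms

/-! ### Walks and neighborhoods -/

/-- The vertices with a neighbor. -/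
def NatGraph.active {n D : ℕ} (g : NatGraph n D) : Finset ℕ :=
  (Finset.range n).filter fun v => (g.N v).Nonempty

theorem NatGraph.mem_active {n D : ℕ} {g : NatGraph n D} {v w : ℕ} (h : w ∈ g.N v) :
    w ∈ g.active ∧ v ∈ g.active :=
  ⟨Finset.mem_filter.2 ⟨Finset.mem_range.2 (g.lt h), v, g.symm h⟩,
    Finset.mem_filter.2 ⟨Finset.mem_range.2 (g.lt' h), w, h⟩⟩

theorem NatGraph.active_lt {n D : ℕ} {g : NatGraph n D} {v : ℕ} (h : v ∈ g.active) : v < n :=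
  Finset.mem_range.1 (Finset.mem_filter.1 h).1

theorem flipAt_comm (α β : ℕ) (S : Finset ℕ) (m : ℕ → ℕ → ℕ) :
    flipAt α β S m = flipAt β α S m := by
  funext v c; simp [flipAt, Equiv.swap_comm]

/-- The graph as it is stored. -/
structure HasGraph {n D : ℕ} (g : NatGraph n D) (s : State) : Prop where
  deg : ∀ v < n, s.arr aDeg v = (g.N v).card
  start_le : ∀ v < n, s.arr aStart v + (g.N v).card ≤ 2 * (n * n)
  mem_iff : ∀ v < n, ∀ w, w ∈ g.N v ↔ ∃ i < (g.N v).card, s.arr aAdj (s.arr aStart v + i) = w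

theorem HasGraph.frame {n D : ℕ} {g : NatGraph n D} {X A : List ℕ} {s s' : State}
    (h : HasGraph g s) (hf : Frame X A s s') (hA : aDeg ∉ A ∧ aStart ∉ A ∧ aAdj ∉ A) :
    HasGraph g s' := by
  obtain ⟨h1, h2, h3⟩ := h
  refine ⟨?_, ?_, ?_⟩
  · rwa [hf.2 _ hA.1]
  · rwa [hf.2 _ hA.2.1]
  · rwa [hf.2 _ hA.2.1, hf.2 _ hA.2.2]

theorem HasGraph.image {n D : ℕ} {g : NatGraph n D} {s : State} (h : HasGraph g s) {v : ℕ}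
    (hv : v < n) : (Finset.range (g.N v).card).image
      (fun i => s.arr aAdj (s.arr aStart v + i)) = g.N v := by
  ext w
  simp [h.mem_iff v hv w]

/-- A list of $d(v)$ entries that takes $d(v)$ different values has no repetition. -/
theorem HasGraph.sum {n D : ℕ} {g : NatGraph n D} {s : State} (h : HasGraph g s) {v : ℕ}
    (hv : v < n) (f : ℕ → ℕ) :
    ∑ i ∈ Finset.range (g.N v).card, f (s.arr aAdj (s.arr aStart v + i)) = ∑ w ∈ g.N v, f w := by
  conv_rhs => rw [← h.image hv]
  rw [Finset.sum_image]
  apply Finset.injOn_of_card_image_eq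
  rw [h.image hv, Finset.card_range]

section Subprograms

variable {W : ℕ} {Q : State → ℕ → Prop} {s : State} {τ : ℕ}

/-- `S` is the vertex set of the path. Besides closedness, two facts are exported for the second
pass: only the two ends may lack one of the colors, and the path avoids every closed set that does
not contain its start. The latter makes successive walks disjoint, so that their lengths add up. -/
theorem wp_walk (swap : Bool) (hW : WordSize n D W) (hb : Base D s)
    (hm : g.Col (mat D (s.arr aM))) (hp : s.var rZ ∈ g.active) (hc : s.var rC < D)
    (hd : s.var rAl < D) (hcd : s.var rC ≠ s.var rAl)
    (hfree : mat D (s.arr aM) (s.var rZ) (s.var rAl) = 0)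
    (post : ∀ s' τ', ∀ S : Finset ℕ,
      Frame [rGo, rZ, rC, rAl, rH, rQ, rT] [aTouch, aM] s s' →
      s.var rZ ∈ S → s'.var rZ ∈ S → S ⊆ g.active →
      Closed (mat D (s.arr aM)) (s.var rC) (s.var rAl) S →
      (∀ q ∈ S, mat D (s.arr aM) q (s.var rC) = 0 ∨ mat D (s.arr aM) q (s.var rAl) = 0 →
        q = s.var rZ ∨ q = s'.var rZ) →
      (∀ T, Closed (mat D (s.arr aM)) (s.var rC) (s.var rAl) T → s.var rZ ∉ T → Disjoint S T) →
      (∀ a, s'.arr aTouch a = if a ∈ S then 1 else s.arr aTouch a) →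
      (∀ a, ∀ b < D, mat D (s'.arr aM) a b =
        if swap then flipAt (s.var rC) (s.var rAl) S (mat D (s.arr aM)) a b
        else mat D (s.arr aM) a b) →
      τ' ≤ τ + 40 * S.card + 10 → Q s' τ') :
    WP W (Prog.walk swap) Q s τ := by
  have hDn := hW.deg_le
  have h1W : 1 < W := hW.small (by omega)
  set m := mat D (s.arr aM) with hmdef
  set p₀ := s.var rZ with hp0
  set c₀ := s.var rC with hc0
  set d₀ := s.var rAl with hd0
  simp only [Prog.walk, wp_seq, wp_const]
  refine ⟨by omega, ?_⟩
  refine wp_while (fun k t σ => ∃ S : Finset ℕ,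
      Frame [rGo, rZ, rC, rAl, rH, rQ, rT] [aTouch, aM] s t ∧ S ⊆ g.active ∧
      (∀ a, t.arr aTouch a = if a ∈ S then 1 else s.arr aTouch a) ∧
      (∀ a, ∀ b < D, mat D (t.arr aM) a b =
        if swap then flipAt c₀ d₀ S m a b else m a b) ∧
      (∀ T, Closed m c₀ d₀ T → p₀ ∉ T → t.var rZ ∉ T ∧ Disjoint S T) ∧
      σ ≤ τ + 40 * S.card + 1 ∧
      ((t.var rGo = 0 ∧ k = n + 1 - S.card ∧ t.var rZ ∈ g.active ∧
          (t.var rC = c₀ ∧ t.var rAl = d₀ ∨ t.var rC = d₀ ∧ t.var rAl = c₀) ∧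
          WalkInv m p₀ S (t.var rZ) (t.var rC) (t.var rAl)) ∨
        (t.var rGo = 1 ∧ k = 0 ∧ t.var rZ ∈ S ∧ p₀ ∈ S ∧ Closed m c₀ d₀ S ∧
          (∀ q ∈ S, m q c₀ = 0 ∨ m q d₀ = 0 → q = p₀ ∨ q = t.var rZ)))) ?_ ?_ (n + 1) ?_
  · rintro k t σ ⟨S, hf, hSn, htouch, hmat, hdisj, hσ, h⟩ hlt
    have hbt := hb.frame hf (by simp)
    rcases h with ⟨hgo, rfl, hz, hcd', hI⟩ | ⟨hgo, -⟩
    swap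
    · rw [hbt.one, hgo] at hlt; omega
    have hzn : t.var rZ < n := NatGraph.active_lt hz
    have htc : t.var rC < D := by omega
    have htd : t.var rAl < D := by omega
    have hcde : t.var rC ≠ t.var rAl := by omega
    -- The current vertex has not been left yet, so its cells are not exchanged and the walk reads
    -- the original coloring.
    have hfz : ∀ b < D, mat D (t.arr aM) (t.var rZ) b = m (t.var rZ) b := by
      intro b hb
      rw [hmat _ _ hb, flipAt_of_notMem hI.fresh, ite_self]
    have hflip : flipAt c₀ d₀ = flipAt (t.var rC) (t.var rAl) := by
      rcases hcd' with h | h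
      · rw [h.1, h.2]
      · rw [h.1, h.2]; funext S m; exact flipAt_comm _ _ _ _
    have hSins : insert (t.var rZ) S ⊆ g.active := Finset.insert_subset hz hSn
    have hcard : (insert (t.var rZ) S).card = S.card + 1 :=
      Finset.card_insert_of_notMem hI.fresh
    have hcardn : (insert (t.var rZ) S).card ≤ n := by
      calc _ ≤ (Finset.range n).card :=
            Finset.card_le_card (hSins.trans (Finset.filter_subset _ _))
        _ = n := Finset.card_range n
    have hread : t.arr aM (t.var rZ * D + t.var rC) = m (t.var rZ) (t.var rC) := hfz _ htc
    have hread' : t.arr aM (t.var rZ * D + t.var rAl) = m (t.var rZ) (t.var rAl) := hfz _ htd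
    have hdisj' : ∀ T, Closed m c₀ d₀ T → p₀ ∉ T → Disjoint (insert (t.var rZ) S) T := by
      intro T hT hpT
      rw [Finset.disjoint_insert_left]
      exact hdisj T hT hpT
    -- the rest of the loop body, after the exchange of the cells
    suffices hrest : ∀ t' σ', Frame [rH, rQ, rT] [aTouch, aM] t t' →
        t'.var rQ = m (t.var rZ) (t.var rC) →
        (∀ a, t'.arr aTouch a = if a ∈ insert (t.var rZ) S then 1 else s.arr aTouch a) →
        (∀ a, ∀ b < D, mat D (t'.arr aM) a b =
          if swap then flipAt c₀ d₀ (insert (t.var rZ) S) m a b else m a b) →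
        σ' ≤ σ + 20 → WP W (.ifLt rQ r1 (.const rGo 1)
          (.arith .sub rZ rQ r1 ;; Prog.mov rH rC ;; Prog.mov rC rAl ;; Prog.mov rAl rH))
          (fun s' τ' => ∃ k' < n + 1 - S.card, ∃ S : Finset ℕ,
            Frame [rGo, rZ, rC, rAl, rH, rQ, rT] [aTouch, aM] s s' ∧ S ⊆ g.active ∧
            (∀ a, s'.arr aTouch a = if a ∈ S then 1 else s.arr aTouch a) ∧
            (∀ a, ∀ b < D, mat D (s'.arr aM) a b =
              if swap then flipAt c₀ d₀ S m a b else m a b) ∧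
            (∀ T, Closed m c₀ d₀ T → p₀ ∉ T → s'.var rZ ∉ T ∧ Disjoint S T) ∧
            τ' + 1 ≤ τ + 40 * S.card + 1 ∧
            ((s'.var rGo = 0 ∧ k' = n + 1 - S.card ∧ s'.var rZ ∈ g.active ∧
                (s'.var rC = c₀ ∧ s'.var rAl = d₀ ∨ s'.var rC = d₀ ∧ s'.var rAl = c₀) ∧
                WalkInv m p₀ S (s'.var rZ) (s'.var rC) (s'.var rAl)) ∨
              (s'.var rGo = 1 ∧ k' = 0 ∧ s'.var rZ ∈ S ∧ p₀ ∈ S ∧ Closed m c₀ d₀ S ∧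
                (∀ q ∈ S, m q c₀ = 0 ∨ m q d₀ = 0 → q = p₀ ∨ q = s'.var rZ)))) t' σ' by
      have haddr := hW.addr hzn (show t.var rC ≤ n by omega)
      have haddr' := hW.addr hzn (show t.var rAl ≤ n by omega)
      have hrow := hW.row hzn
      cases swap with
      | false =>
        simp only [wp_seq, wp_store, wp_ld2, wp_arith, wp_load, wp_skip, eval_mul, eval_add,
          var_setVar, var_setArr, arr_setVar, arr_setArr, hbt.D, hbt.one, Bool.false_eq_true,
          if_false, Nat.reduceEqDiff, reduceIte]
        refine ⟨hrow, haddr, hrest _ _ ?_ ?_ ?_ ?_ (by omega)⟩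
        · simp (maxDischargeDepth := 20) [Frame.setVar, Frame.setArr, Frame.refl]
        · simpa using hread
        · intro a
          simp [Function.update_apply, htouch]
          grind
        · simpa using hmat
      | true =>
        simp only [Prog.swapCells, wp_seq, wp_store, wp_ld2, wp_st2, wp_arith, wp_load, eval_mul,
          eval_add, var_setVar, var_setArr, arr_setVar, arr_setArr, hbt.D, hbt.one, if_true,
          Nat.reduceEqDiff, reduceIte]
        refine ⟨hrow, haddr, hrow, haddr', hrow, haddr', hrow, haddr,
          hrest _ _ ?_ ?_ ?_ ?_ (by omega)⟩
        · simp (maxDischargeDepth := 20) [Frame.setVar, Frame.setArr, Frame.refl]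
        · simpa using hread
        · intro a
          simp [Function.update_apply, htouch]
          grind
        · intro a b hb
          simp only [arr_setVar, arr_setArr, Nat.reduceEqDiff, if_true, if_false]
          rw [mat_update htc _ hb, mat_update htd _ hb, hread, hread', hmat a b hb, hflip]
          simp only [flipAt, if_true, Finset.mem_insert, Equiv.swap_apply_def]
          grind
    intro t' σ' hft hQ htouch' hmat' hσ'
    have hbt' := hbt.frame hft (by simp)
    have hfs : Frame [rGo, rZ, rC, rAl, rH, rQ, rT] [aTouch, aM] s t' :=
      hf.trans hft (by simp) (by simp)
    have hZ' : t'.var rZ = t.var rZ := hft.1 _ (by simp)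
    have hC' : t'.var rC = t.var rC := hft.1 _ (by simp)
    have hA' : t'.var rAl = t.var rAl := hft.1 _ (by simp)
    have hG' : t'.var rGo = t.var rGo := hft.1 _ (by simp)
    simp only [wp_ifLt, wp_const, wp_seq, wp_arith, wp_mov, eval_sub, var_setVar, hbt'.one,
      hbt'.zero, hQ, hA', hC', hG', Nat.reduceEqDiff, reduceIte, Nat.lt_one_iff]
    refine ⟨fun h0 => ⟨h1W, 0, by omega, insert (t.var rZ) S, ?_, hSins, htouch', hmat', ?_, ?_,
      Or.inr ⟨trivial, rfl, by rw [hZ']; exact Finset.mem_insert_self _ _, hI.start, ?_, ?_⟩⟩,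
      fun h0 => ?_⟩
    · simp (maxDischargeDepth := 20) [Frame.setVar, hfs]
    · intro T hT hpT
      rw [hZ']
      exact ⟨(hdisj T hT hpT).1, hdisj' T hT hpT⟩
    · omega
    · rcases hcd' with h | h
      · rw [← h.1, ← h.2]; exact hI.closed h0
      · rw [← h.1, ← h.2]; exact (hI.closed h0).symm
    · intro q hq hq0
      rw [hZ']
      refine hI.ends q hq ?_
      rcases hcd' with h | h
      · rwa [h.1, h.2]
      · rw [h.1, h.2]; exact hq0.symm
    · obtain ⟨w, hw⟩ := Nat.exists_eq_succ_of_ne_zero h0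
      rw [Nat.succ_eq_add_one] at hw
      have hwN := hm.adj _ hzn _ htc w hw
      have hwn : w < n := g.lt hwN
      simp only [hw, Nat.add_sub_cancel]
      have hstep := hI.step hm hcde htc htd hzn hw
      refine ⟨hW.small (by omega), hW.small (by omega), hW.small (by omega), hW.small (by omega),
        n + 1 - (insert (t.var rZ) S).card, by omega, insert (t.var rZ) S, ?_, hSins, htouch',
        hmat', ?_, by omega, Or.inl ⟨hgo, rfl, (NatGraph.mem_active hwN).1, by tauto,
          hstep⟩⟩
      · simp (maxDischargeDepth := 20) [Frame.setVar, hfs]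
      · intro T hT hpT
        refine ⟨fun hwT => ?_, hdisj' T hT hpT⟩
        -- Edges of the two colors can be followed backwards, so entering a closed set would mean
        -- having been in it before.
        have := hT w hwT (t.var rC) (by tauto) _ (hm.symm _ hzn _ htc w hw)
        exact (hdisj T hT hpT).1 this
  · rintro k t σ ⟨S, hf, hSn, htouch, hmat, hdisj, hσ, h⟩ hlt
    have hbt := hb.frame hf (by simp)
    rcases h with ⟨hgo, -⟩ | ⟨hgo, -, hz, hp0S, hcl, hends⟩
    · rw [hbt.one, hgo] at hlt; omega
    exact post t _ S hf hp0S hz hSn hcl hends (fun T hT hpT => (hdisj T hT hpT).2) htouch hmat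
      (by omega)
  · refine ⟨∅, by simp [Frame.setVar, Frame.refl], by simp, by simp, ?_, ?_, by simp,
      Or.inl ⟨by simp, by simp, by simpa using hp, ?_, ?_⟩⟩
    · intro a b hb
      simp [flipAt, hmdef]
    · intro T hT hpT
      simpa using hpT
    · left; simp [hc0, hd0]
    · simpa using WalkInv.init hfree

theorem wp_scanNbrs (hW : WordSize n D W) (hb : Base D s) (hg : HasGraph g s)
    (hu : s.var rU < n) (hmark : ∀ a, s.arr aMark a ≤ 1)
    (post : ∀ s' τ', Frame [rAcc, rCnt, rS, rG, rJ, rT, rW, rQ] [] s s' →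
      s'.var rS = s.arr aStart (s.var rU) → s'.var rG = (g.N (s.var rU)).card →
      (s'.var rAcc = 0 ↔ ∀ w ∈ g.ball (s.var rU), s.arr aMark w = 0) →
      s'.var rCnt = ((g.N (s.var rU)).filter fun w => ¬ (g.N w).card < D).card →
      τ' ≤ τ + 12 * (g.N (s.var rU)).card + 10 → Q s' τ') :
    WP W Prog.scanNbrs Q s τ := by
  have hDn := hW.deg_le
  set u := s.var rU with hudef
  have hdeg := g.deg_le u
  set a : ℕ → ℕ := fun i => s.arr aAdj (s.arr aStart u + i) with hadef
  have hnbr : ∀ i < (g.N u).card, a i ∈ g.N u := fun i hi => (hg.mem_iff u hu _).2 ⟨i, hi, rfl⟩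
  simp only [Prog.scanNbrs, wp_seq, wp_const, wp_load, var_setVar, arr_setVar]
  refine ⟨hW.small (by omega), hW.small (by omega), ?_⟩
  refine wp_while (fun k t σ => Frame [rAcc, rCnt, rS, rG, rJ, rT, rW, rQ] [] s t ∧
      t.var rS = s.arr aStart u ∧ t.var rG = (g.N u).card ∧ t.var rJ ≤ (g.N u).card ∧
      t.var rAcc = s.arr aMark u + ∑ i ∈ Finset.range (t.var rJ), s.arr aMark (a i) ∧
      t.var rCnt = ∑ i ∈ Finset.range (t.var rJ), (if (g.N (a i)).card < D then 0 else 1) ∧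
      k = (g.N u).card - t.var rJ ∧ σ ≤ τ + 12 * t.var rJ + 5) ?_ ?_ (g.N u).card ?_
  · rintro k t σ ⟨hf, hS, hG, hJ, hacc, hcnt, rfl, hσ⟩ hlt
    have hbt := hb.frame hf (by simp)
    have hai := hnbr (t.var rJ) (by omega)
    have han := g.lt hai
    have hadj : t.arr aAdj = s.arr aAdj := hf.2 _ (by simp)
    have hmk : t.arr aMark = s.arr aMark := hf.2 _ (by simp)
    have hdg : t.arr aDeg = s.arr aDeg := hf.2 _ (by simp)
    have hreada : s.arr aAdj (s.arr aStart u + t.var rJ) = a (t.var rJ) := rfl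
    have hst := hg.start_le u hu
    have hm1 := hmark (a (t.var rJ))
    have hm0 := hmark u
    have haccle : ∑ i ∈ Finset.range (t.var rJ), s.arr aMark (a i) ≤ t.var rJ := by
      calc _ ≤ ∑ i ∈ Finset.range (t.var rJ), 1 := Finset.sum_le_sum fun i _ => hmark _
        _ = t.var rJ := by simp
    have hcntle : t.var rCnt ≤ t.var rJ := by
      rw [hcnt]
      calc _ ≤ ∑ i ∈ Finset.range (t.var rJ), 1 :=
            Finset.sum_le_sum fun i _ => by split_ifs <;> simp
        _ = t.var rJ := by simp
    simp only [wp_seq, wp_arith, wp_load, wp_ifLt, wp_skip, eval_add, var_setVar, arr_setVar,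
      hbt.D, hbt.one, hS, hadj, hmk, hdg, Nat.reduceEqDiff, reduceIte]
    simp only [hreada, hg.deg _ han]
    refine ⟨hW.sq (by omega), hW.small (by omega), fun hlt' => ⟨hW.small (by omega),
      _, ?_, ?_, trivial, hG, ?_, ?_, ?_, rfl, ?_⟩, fun hlt' => ⟨hW.small (by omega),
      hW.small (by omega), _, ?_, ?_, trivial, hG, ?_, ?_, ?_, rfl, ?_⟩⟩
    · omega
    · simp (maxDischargeDepth := 20) [Frame.setVar, hf]
    · omega
    · rw [Finset.sum_range_succ, hacc]; ring
    · rw [Finset.sum_range_succ, hcnt]; simp [hlt']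
    · omega
    · omega
    · simp (maxDischargeDepth := 20) [Frame.setVar, hf]
    · omega
    · rw [Finset.sum_range_succ, hacc]; ring
    · rw [Finset.sum_range_succ, hcnt]; simp [hlt']
    · omega
  · rintro k t σ ⟨hf, hS, hG, hJ, hacc, hcnt, rfl, hσ⟩ hlt
    have hJe : t.var rJ = (g.N u).card := by omega
    rw [hJe, hg.sum hu (fun w => s.arr aMark w)] at hacc
    rw [hJe, hg.sum hu (fun w => if (g.N w).card < D then 0 else 1)] at hcnt
    refine post t _ hf hS hG ?_ ?_ (by omega)
    · rw [hacc]
      simp [NatGraph.ball]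
    · rw [hcnt, Finset.card_filter]
      refine Finset.sum_congr rfl fun w _ => ?_
      split_ifs <;> simp_all
  · simp (maxDischargeDepth := 20) [Frame.setVar, Frame.refl, hg.deg u hu, ← hudef]

theorem wp_markNbrs (hW : WordSize n D W) (hb : Base D s) (hg : HasGraph g s)
    (hu : s.var rU < n) (hS : s.var rS = s.arr aStart (s.var rU))
    (hG : s.var rG = (g.N (s.var rU)).card)
    (post : ∀ s' τ', Frame [rJ, rT, rW] [aMark] s s' →
      (∀ a, s'.arr aMark a = if a ∈ g.ball (s.var rU) then 1 else s.arr aMark a) →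
      τ' ≤ τ + 5 * (g.N (s.var rU)).card + 3 → Q s' τ') :
    WP W Prog.markNbrs Q s τ := by
  have hDn := hW.deg_le
  set u := s.var rU with hudef
  have hdeg := g.deg_le u
  set a : ℕ → ℕ := fun i => s.arr aAdj (s.arr aStart u + i) with hadef
  simp only [Prog.markNbrs, wp_seq, wp_const, wp_store]
  refine ⟨hW.small (by omega), ?_⟩
  refine wp_while (fun k t σ => Frame [rJ, rT, rW] [aMark] s t ∧ t.var rJ ≤ (g.N u).card ∧
      (∀ b, t.arr aMark b = if b = u ∨ ∃ i < t.var rJ, a i = b then 1 else s.arr aMark b) ∧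
      k = (g.N u).card - t.var rJ ∧ σ ≤ τ + 5 * t.var rJ + 2) ?_ ?_ (g.N u).card ?_
  · rintro k t σ ⟨hf, hJ, hmk, rfl, hσ⟩ hlt
    have hbt := hb.frame hf (by simp)
    have hS' : t.var rS = s.arr aStart u := by rw [hf.1 _ (by simp), hS]
    have hG' : t.var rG = (g.N u).card := by rw [hf.1 _ (by simp), hG]
    have hadj : t.arr aAdj = s.arr aAdj := hf.2 _ (by simp)
    have hst := hg.start_le u hu
    have hreada : s.arr aAdj (s.arr aStart u + t.var rJ) = a (t.var rJ) := rfl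
    simp only [wp_seq, wp_arith, wp_load, wp_store, eval_add, var_setVar, arr_setVar, var_setArr,
      arr_setArr, hbt.one, hS', hadj,
      Nat.reduceEqDiff, reduceIte]
    simp only [hreada]
    refine ⟨hW.sq (by omega), hW.small (by omega), _, ?_, ?_, ?_, ?_, rfl, ?_⟩
    · omega
    · simp (maxDischargeDepth := 20) [Frame.setVar, Frame.setArr, hf]
    · omega
    · intro b
      rw [Function.update_apply, hmk b]
      have : (∃ i < t.var rJ + 1, a i = b) ↔ (∃ i < t.var rJ, a i = b) ∨ a (t.var rJ) = b := by
        constructor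
        · rintro ⟨i, hi, rfl⟩
          rcases Nat.lt_succ_iff_lt_or_eq.1 hi with h | rfl
          · exact Or.inl ⟨i, h, rfl⟩
          · exact Or.inr rfl
        · rintro (⟨i, hi, rfl⟩ | rfl)
          · exact ⟨i, by omega, rfl⟩
          · exact ⟨_, by omega, rfl⟩
      simp only [this]
      grind
    · omega
  · rintro k t σ ⟨hf, hJ, hmk, rfl, hσ⟩ hlt
    have hG' : t.var rG = (g.N u).card := by rw [hf.1 _ (by simp), hG]
    have hJe : t.var rJ = (g.N u).card := by omega
    refine post t _ hf ?_ (by omega)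
    intro b
    simp only [hmk b, hJe, NatGraph.ball, Finset.mem_insert, hg.mem_iff u hu b, hadef]
  · refine ⟨by simp [Frame.setVar, Frame.setArr, Frame.refl], by simp, ?_, by simp, by simp⟩
    intro b
    simp [Function.update_apply, hb.one, ← hudef]

end Subprograms

/-! ### Building a fan -/

/-- A fan under construction: the claimed colors are those of the edges to the tree, and
the root has claimed only colors less than `b`. -/
structure FanCore (g : NatGraph n D) (m : ℕ → ℕ → ℕ) (pc K : ℕ → ℕ) (u v : ℕ) (T : Finset ℕ)
    (r : ℕ → ℕ) (b : ℕ) : Prop where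
  tree : FanTree g pc K u v T r
  live : Live m pc K u T r D
  claimed : ∀ c < D, pc c ≠ 0 → ∃ w ∈ T, K w = c
  rank : ∀ w ∈ T, r w ≤ T.card
  root_lt : ∀ c < D, pc c = v + 1 → c < b

/-- The vertex `w` is new because every key of the tree has been claimed while `c` has not; a tree
vertex reached from `u` by color `c` would have key `c`. -/
theorem FanCore.grow {pc K pc' K' : ℕ → ℕ} {u v x c b w : ℕ} {T : Finset ℕ} {r : ℕ → ℕ}
    (h : FanCore g m pc K u v T r b) (hm : g.Col m) (hunc : ∀ c < D, m u c ≠ v + 1)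
    (hx : x = v ∨ x ∈ T) (hc : c < D) (hfree : m x c = 0) (hxb : x = v → c < b) (hpc : pc c = 0)
    (hw : m u c = w + 1) (hpc' : ∀ e < D, pc' e = if e = c then x + 1 else pc e)
    (hK' : ∀ a, K' a = if a = w then c else K a) :
    w ∉ T ∧ w ≠ v ∧ w ∈ g.N u ∧ (∃ r', FanCore g m pc' K' u v (insert w T) r' b) ∧
      ∀ e < D, pc' e ≠ w + 1 := by
  have hun : u < n := g.lt' h.tree.root
  have hwN := hm.adj u hun c hc w hw
  have hwv : w ≠ v := fun e => hunc c hc (by rw [hw, e])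
  have hKc : ∀ a ∈ T, K a ≠ c := by
    intro a ha e
    obtain ⟨p, hp, -⟩ := h.tree.parent a ha
    rw [e, hpc] at hp; omega
  have hwT : w ∉ T := fun hwT => hKc w hwT <| by
    have h1 := (h.live w hwT (h.tree.rank_le w hwT)).1
    exact hm.inj u hun _ (h.tree.key_lt w hwT) c hc w h1 hw
  have hsub : insert w T ⊆ g.N u := Finset.insert_subset hwN h.tree.sub
  have hcard : (insert w T).card = T.card + 1 := Finset.card_insert_of_notMem hwT
  have hcardD : (insert w T).card ≤ D := (Finset.card_le_card hsub).trans (g.deg_le u)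
  have hrx : r x ≤ T.card := by
    rcases hx with rfl | hx
    · rw [h.tree.root_rank]; omega
    · exact h.rank x hx
  have hne : ∀ {p}, p = v ∨ p ∈ T → p ≠ w := by
    rintro p (rfl | hp) rfl
    · exact hwv rfl
    · exact hwT hp
  have hold : ∀ a ∈ T, K' a = K a ∧ pc' (K a) = pc (K a) := by
    intro a ha
    rw [hK', if_neg (hne (Or.inr ha)), hpc' _ (h.tree.key_lt a ha), if_neg (hKc a ha)]
    exact ⟨rfl, rfl⟩
  have hKw : K' w = c := by rw [hK', if_pos rfl]
  have hpcc : pc' c = x + 1 := by rw [hpc' c hc, if_pos rfl]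
  -- The new vertex gets the size of the enlarged tree as its rank. This exceeds all earlier ranks,
  -- and it is at most `D` because the tree consists of neighbors of `u`.
  refine ⟨hwT, hwv, hwN, ⟨fun a => if a = w then T.card + 1 else r a, ⟨?_, ?_, ?_, ?_, ?_⟩⟩, ?_⟩
  · refine ⟨h.tree.root, ?_, ?_, hsub, ?_, ?_, ?_⟩
    · rw [Finset.mem_insert, not_or]; exact ⟨hwv.symm, h.tree.root_notMem⟩
    · rw [if_neg hwv.symm, h.tree.root_rank]
    · intro a ha
      rcases Finset.mem_insert.1 ha with rfl | ha
      · rwa [hKw]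
      · rw [(hold a ha).1]; exact h.tree.key_lt a ha
    · intro a ha
      rcases Finset.mem_insert.1 ha with rfl | ha
      · rw [if_pos rfl]; omega
      · rw [if_neg (hne (Or.inr ha))]; exact h.tree.rank_le a ha
    · intro a ha
      rcases Finset.mem_insert.1 ha with rfl | ha
      · refine ⟨x, by rw [hKw, hpcc], hx.imp_right (Finset.mem_insert_of_mem), ?_⟩
        rw [if_neg (hne hx), if_pos rfl]; omega
      · obtain ⟨p, hp, hpT, hr⟩ := h.tree.parent a ha
        refine ⟨p, by rw [(hold a ha).1, (hold a ha).2, hp],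
          hpT.imp_right (Finset.mem_insert_of_mem), ?_⟩
        rwa [if_neg (hne hpT), if_neg (hne (Or.inr ha))]
  · intro a ha _
    rcases Finset.mem_insert.1 ha with rfl | ha
    · rw [hKw, hpcc]
      refine ⟨hw, fun p hp => ?_⟩
      obtain rfl : x = p := by omega
      exact hfree
    · rw [(hold a ha).1, (hold a ha).2]
      exact h.live a ha (h.tree.rank_le a ha)
  · intro e he hpe
    by_cases hec : e = c
    · exact ⟨w, Finset.mem_insert_self _ _, by rw [hKw, hec]⟩
    · rw [hpc' e he, if_neg hec] at hpe
      obtain ⟨a, ha, hKa⟩ := h.claimed e he hpe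
      exact ⟨a, Finset.mem_insert_of_mem ha, by rw [(hold a ha).1, hKa]⟩
  · intro a ha
    rcases Finset.mem_insert.1 ha with rfl | ha
    · rw [if_pos rfl, hcard]
    · rw [if_neg (hne (Or.inr ha)), hcard]
      exact (h.rank a ha).trans (by omega)
  · intro e he hpe
    by_cases hec : e = c
    · rw [hec, hpcc] at hpe
      rw [hec]; exact hxb (by omega)
    · rw [hpc' e he, if_neg hec] at hpe
      exact h.root_lt e he hpe
  · intro e he hpe
    by_cases hec : e = c
    · rw [hec, hpcc] at hpe
      exact hne hx (by omega)
    · rw [hpc' e he, if_neg hec] at hpe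
      obtain ⟨a, ha, hKa⟩ := h.claimed e he (by omega)
      obtain ⟨p, hp, hpT, -⟩ := h.tree.parent a ha
      rw [hKa] at hp
      exact hne hpT (by omega)

/-- The number of neighbors of `u` of degree `D`, compared with the degree of `v`. -/
def NatGraph.WeakAt (g : NatGraph n D) (u v : ℕ) : Prop :=
  ((g.N u).filter fun w => ¬ (g.N w).card < D).card + (g.N v).card ≤
    D + if (g.N v).card < D then 0 else 1

/-- Weakness leaves the root of a fan more free colors than the fan can have dead ends. -/
theorem NatGraph.Col.exists_free (hm : g.Col m) {u v b : ℕ} (hv : v ∈ g.N u)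
    (hweak : g.WeakAt u v) (hunc : ∀ c < D, m u c ≠ v + 1) {B : Finset ℕ} (hB : B ⊆ g.N u)
    (hvB : v ∉ B) (hdeg : ∀ w ∈ B, ¬ (g.N w).card < D)
    (hcard : B.card = ((Finset.range b).filter fun c => m v c = 0).card) (hb : b ≤ D) :
    ∃ c, b ≤ c ∧ c < D ∧ m v c = 0 := by
  by_contra! hcon
  have hvn : v < n := g.lt hv
  have hun : u < n := g.lt' hv
  have hunc' : ∀ c < D, m v c ≠ u + 1 := fun c hc h => hunc c hc (hm.symm v hvn c hc u h)
  have hfil : (Finset.range D).filter (fun c => m v c = 0) =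
      (Finset.range b).filter (fun c => m v c = 0) := by
    ext c
    simp only [Finset.mem_filter, Finset.mem_range]
    constructor
    · rintro ⟨h1, h2⟩
      refine ⟨?_, h2⟩
      by_contra h3
      exact hcon c (by omega) h1 h2
    · rintro ⟨h1, h2⟩; exact ⟨by omega, h2⟩
  -- As $uv$ is uncolored, fewer than $d(v)$ colors are used at $v$, so at least $D - d(v) + 1$ are
  -- free there.
  have h1 := hm.card_lt (g.symm hv) (C := (Finset.range D).filter fun c => ¬ m v c = 0)
    (fun c hc => by simpa using hc) hunc'
  have h2 := Finset.card_filter_add_card_filter_not (s := Finset.range D) (fun c => m v c = 0)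
  rw [hfil, Finset.card_range, ← hcard] at h2
  -- When $d(v) = D$, the root is itself a neighbor of $u$ of degree $D$ and not a dead end; this
  -- compensates for the bracket in the definition of weakness.
  have h3 : B.card + (if (g.N v).card < D then 0 else 1) ≤
      ((g.N u).filter fun w => ¬ (g.N w).card < D).card := by
    split_ifs with h
    · exact Finset.card_le_card fun w hw => Finset.mem_filter.2 ⟨hB hw, hdeg w hw⟩
    · rw [← Finset.card_insert_of_notMem hvB]
      refine Finset.card_le_card fun w hw => ?_
      rcases Finset.mem_insert.1 hw with rfl | hw
      · exact Finset.mem_filter.2 ⟨hv, h⟩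
      · exact Finset.mem_filter.2 ⟨hB hw, hdeg w hw⟩
  unfold NatGraph.WeakAt at hweak
  omega

theorem card_filter_range_succ {f : ℕ → ℕ} {b c : ℕ} (hbc : b ≤ c)
    (h : ∀ e, b ≤ e → e < c → f e ≠ 0) (hc : f c = 0) :
    ((Finset.range (c + 1)).filter fun e => f e = 0).card =
      ((Finset.range b).filter fun e => f e = 0).card + 1 := by
  have : (Finset.range (c + 1)).filter (fun e => f e = 0) =
      insert c ((Finset.range b).filter fun e => f e = 0) := by
    ext e
    simp only [Finset.mem_filter, Finset.mem_range, Finset.mem_insert]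
    constructor
    · rintro ⟨h1, h2⟩
      by_cases he : e < b
      · exact Or.inr ⟨he, h2⟩
      · by_cases hec : e < c
        · exact absurd h2 (h e (by omega) hec)
        · left; omega
    · rintro (rfl | ⟨h1, h2⟩)
      · exact ⟨by omega, hc⟩
      · exact ⟨by omega, h2⟩
  rw [this, Finset.card_insert_of_notMem]
  simp; omega

section Subprograms

variable {W : ℕ} {Q : State → ℕ → Prop} {s : State} {τ : ℕ}

/-- The sum that bounds the cost of work at the vertices in `S`. -/
def NatGraph.cost (g : NatGraph n D) (S : Finset ℕ) : ℕ := ∑ w ∈ S, ((g.N w).card + 1)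

/-- The state of the construction of a fan, relative to the state `s` before it. -/
structure FanState (g : NatGraph n D) (u v : ℕ) (s t : State) (T : Finset ℕ) (r : ℕ → ℕ)
    (B : Finset ℕ) : Prop where
  frame : Frame [rW, rC, rLim, rQ, rT, rP, rX, rY, rGo, rH] [aPred, aKey] s t
  pred : ∀ a, a ≠ u → ∀ c < D, mat D (t.arr aPred) a c = mat D (s.arr aPred) a c
  key : ∀ a, a ∉ g.N u → t.arr aKey a = s.arr aKey a
  core : FanCore g (mat D (s.arr aM)) (mat D (t.arr aPred) u) (t.arr aKey) u v T r (t.var rP)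
  cur : t.var rX = v ∨ t.var rX ∈ T
  lt : t.var rC < D
  free : mat D (s.arr aM) (t.var rX) (t.var rC) = 0
  root : t.var rX = v → t.var rC < t.var rP
  unclaimed : mat D (t.arr aPred) u (t.var rC) ≠ t.var rX + 1
  bound : t.var rP ≤ D
  dead_sub : B ⊆ T
  dead_deg : ∀ w ∈ B, ¬ (g.N w).card < D
  -- The root tries its first free color unprompted and one more after each dead end.
  dead_card : B.card + 1 =
    ((Finset.range (t.var rP)).filter fun c => mat D (s.arr aM) v c = 0).card

/-- The outcome of the construction of a fan: its edge can be colored by a shift, or the fan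
has two vertices with a common free color. -/
structure FanDone (g : NatGraph n D) (u v : ℕ) (s t : State) : Prop where
  frame : Frame [rW, rC, rLim, rQ, rT, rP, rX, rY, rGo, rH] [aPred, aKey] s t
  pred : ∀ a, a ≠ u → ∀ c < D, mat D (t.arr aPred) a c = mat D (s.arr aPred) a c
  key : ∀ a, a ∉ g.N u → t.arr aKey a = s.arr aKey a
  result : (t.var rGo = 1 ∧ ∃ T r, ShiftInv g (mat D (s.arr aM)) (mat D (s.arr aM))
      (mat D (t.arr aPred) u) (t.arr aKey) u v T r (t.var rX) (t.var rC) Set.univ 0 0) ∨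
    (t.var rGo = 2 ∧ ∃ T r, ValidFan g (mat D (s.arr aM)) (mat D (t.arr aPred) u) (t.arr aKey)
      u v (t.var rX) (t.var rY) (s.var rAl) (t.var rC) T r)

/-- The claimant of the color is the parent of the tree vertex with that key, so it lies in the tree
and the color is still free there. It differs from the current vertex, which has not claimed this
color. The color is in use at `u`, hence is not the color in `rAl`. -/
theorem FanState.collision {u v : ℕ} {t t' : State} {T : Finset ℕ} {r : ℕ → ℕ} {B : Finset ℕ}
    (h : FanState g u v s t T r B) (hunc : ∀ c < D, mat D (s.arr aM) u c ≠ v + 1)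
    (hα : s.var rAl < D) (hαu : mat D (s.arr aM) u (s.var rAl) = 0)
    (hf : Frame [rW, rC, rLim, rQ, rT, rP, rX, rY, rGo, rH] [aPred, aKey] s t')
    (hX : t'.var rX = t.var rX) (hC : t'.var rC = t.var rC) (hP : t'.arr aPred = t.arr aPred)
    (hK : t'.arr aKey = t.arr aKey) (hgo : t'.var rGo = 2)
    (hY : mat D (t.arr aPred) u (t.var rC) = t'.var rY + 1) : FanDone g u v s t' := by
  obtain ⟨w, hw, hKw⟩ := h.core.claimed _ h.lt (by omega)
  obtain ⟨p, hp, hpT, -⟩ := h.core.tree.parent w hw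
  obtain ⟨h1, h2⟩ := h.core.live w hw (h.core.tree.rank_le w hw)
  have h2 := h2 p hp
  rw [hKw] at hp h1 h2
  obtain rfl : p = t'.var rY := by omega
  refine ⟨hf, ?_, ?_, Or.inr ⟨hgo, T, r, ?_⟩⟩
  · rw [hP]; exact h.pred
  · rw [hK]; exact h.key
  rw [hP, hK, hX, hC]
  refine ⟨h.core.tree, h.core.live, hunc, h.cur, hpT, ?_, hα, h.lt, ?_, hαu, h.free, h2, hY⟩
  · intro e
    exact h.unclaimed (by rw [hY, e])
  · intro e
    rw [e] at hαu; omega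

/-- Recording the last claim does not disturb the tree, whose keys are in use at `u` while the new
color is free there. With `Set.univ` for `X` the clauses on alternating paths are void, so the pair
of colors may be `0 0`. -/
theorem FanState.direct {u v : ℕ} {t t' : State} {T : Finset ℕ} {r : ℕ → ℕ} {B : Finset ℕ}
    (h : FanState g u v s t T r B) (hm : g.Col (mat D (s.arr aM)))
    (hunc : ∀ c < D, mat D (s.arr aM) u c ≠ v + 1)
    (hf : Frame [rW, rC, rLim, rQ, rT, rP, rX, rY, rGo, rH] [aPred, aKey] s t')
    (hX : t'.var rX = t.var rX) (hC : t'.var rC = t.var rC)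
    (hP : ∀ a, ∀ c < D, mat D (t'.arr aPred) a c =
      if a = u ∧ c = t.var rC then t.var rX + 1 else mat D (t.arr aPred) a c)
    (hK : t'.arr aKey = t.arr aKey) (hgo : t'.var rGo = 1)
    (hu : mat D (s.arr aM) u (t.var rC) = 0) : FanDone g u v s t' := by
  have hpc : ∀ w ∈ T, mat D (t'.arr aPred) u (t.arr aKey w) =
      mat D (t.arr aPred) u (t.arr aKey w) := by
    intro w hw
    have h1 := (h.core.live w hw (h.core.tree.rank_le w hw)).1
    rw [hP u _ (h.core.tree.key_lt w hw), if_neg]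
    rintro ⟨-, e⟩
    rw [e] at h1; omega
  refine ⟨hf, ?_, ?_, Or.inl ⟨hgo, T, r, ?_⟩⟩
  · intro a ha c hc
    rw [hP a c hc, if_neg (by tauto), h.pred a ha c hc]
  · rw [hK]; exact h.key
  rw [hK, hX, hC]
  have hrx : r (t.var rX) ≤ D := by
    rcases h.cur with e | e
    · rw [e, h.core.tree.root_rank]; omega
    · exact h.core.tree.rank_le _ e
  refine ⟨hm, ?_, ?_, h.cur, h.lt, hu, h.free, hunc, fun _ _ _ h => h, fun _ _ _ _ => rfl,
    fun _ _ _ _ _ _ _ => trivial, fun _ _ _ _ _ _ => rfl, trivial, fun _ => trivial,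
    fun _ _ _ _ _ _ => trivial⟩
  · refine ⟨h.core.tree.root, h.core.tree.root_notMem, h.core.tree.root_rank, h.core.tree.sub,
      h.core.tree.key_lt, h.core.tree.rank_le, fun w hw => ?_⟩
    rw [hpc w hw]; exact h.core.tree.parent w hw
  · intro w hw hr
    rw [hpc w hw]; exact h.core.live w hw (hr.trans hrx)

/-- The time is amortized: the search at the new vertex `w` is paid by its degree, and the searches
at the root by the growth of `rP`, which never exceeds `D`. -/
theorem wp_fanStep {u v : ℕ} {t : State} {T : Finset ℕ} {r : ℕ → ℕ} {B : Finset ℕ}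
    (hW : WordSize n D W) (hb : Base D s) (hu : s.var rU = u) (hv : s.var rV = v)
    (hm : g.Col (mat D (s.arr aM))) (hunc : ∀ c < D, mat D (s.arr aM) u c ≠ v + 1)
    (hα : s.var rAl < D) (hαu : mat D (s.arr aM) u (s.var rAl) = 0) (hweak : g.WeakAt u v)
    (h : FanState g u v s t T r B) (hgo : t.var rGo = 0)
    (done : ∀ t' τ', FanDone g u v s t' → τ' ≤ τ + 50 → Q t' τ')
    (next : ∀ t' τ' w T' r' B', FanState g u v s t' T' r' B' → t'.var rGo = 0 → w ∉ T →
      T' = insert w T → w ∈ g.N u → t.var rP ≤ t'.var rP →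
      τ' + 10 * t.var rP ≤ τ + 10 * (g.N w).card + 10 * t'.var rP + 100 → Q t' τ') :
    WP W Prog.fanStep Q t τ := by
  have hDn := hW.deg_le
  have hun : u < n := g.lt' h.core.tree.root
  have hvn : v < n := g.lt h.core.tree.root
  have h2W : 2 < W := hW.small (by omega)
  have hbt := hb.frame h.frame (by simp)
  have htu : t.var rU = u := by rw [h.frame.1 _ (by simp), hu]
  have htv : t.var rV = v := by rw [h.frame.1 _ (by simp), hv]
  have htM : t.arr aM = s.arr aM := h.frame.2 _ (by simp)
  have hlt := h.lt
  have hxn : t.var rX < n := g.lt (h.core.tree.mem_nbr h.cur)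
  have hrow := hW.row hun
  have haddr := hW.addr hun (show t.var rC ≤ n by omega)
  have hreadP : t.arr aPred (u * D + t.var rC) = mat D (t.arr aPred) u (t.var rC) := rfl
  have hreadM : s.arr aM (u * D + t.var rC) = mat D (s.arr aM) u (t.var rC) := rfl
  set c := t.var rC with hcdef
  set x := t.var rX with hxdef
  simp only [Prog.fanStep, wp_seq, wp_ld2, wp_st2, wp_arith, wp_load, wp_store, wp_ifLt, wp_const,
    wp_mov, eval_mul, eval_add, eval_sub, var_setVar, arr_setVar, var_setArr, arr_setArr, hbt.D,
    hbt.one, hbt.zero, htu, htM, hreadP, hreadM, ← hcdef, ← hxdef, Nat.reduceEqDiff,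
    reduceIte, Nat.lt_one_iff, add_zero]
  refine ⟨hrow, haddr, fun hpos => ⟨?_, h2W, done _ _ ?_ (by omega)⟩,
    fun hpos => ⟨hW.small (by omega), hrow, haddr, hrow, haddr, fun hz => ⟨by omega,
      done _ _ ?_ (by omega)⟩, fun hnz => ?_⟩⟩
  · obtain ⟨w, hw, hKw⟩ := h.core.claimed c h.lt (by omega)
    obtain ⟨p, hp, hpT, -⟩ := h.core.tree.parent w hw
    rw [hKw] at hp
    have := g.lt (h.core.tree.mem_nbr hpT)
    exact hW.small (by omega)
  · refine h.collision hunc hα hαu ?_ (by simp [← hxdef]) (by simp) (by simp) (by simp) (by simp) ?_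
    · simp (maxDischargeDepth := 20) [Frame.setVar, h.frame]
    · simp [← hcdef]; omega
  · refine h.direct hm hunc ?_ (by simp [← hxdef]) (by simp) ?_ (by simp) (by simp) hz
    · simp (maxDischargeDepth := 20) [Frame.setVar, Frame.setArr, h.frame]
    · intro a e he
      simp [mat_update hlt _ he, ← hcdef, ← hxdef]
  · obtain ⟨w, hw⟩ := Nat.exists_eq_succ_of_ne_zero hnz
    rw [Nat.succ_eq_add_one] at hw
    have hwN := hm.adj u hun c h.lt w hw
    have hwn : w < n := g.lt hwN
    simp only [hw, Nat.add_sub_cancel]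
    have hP0 : mat D (t.arr aPred) u c = 0 := by omega
    refine ⟨hW.small (by omega), hW.small (by omega), by omega, ?_⟩
    set t1 : State := ((((((((((((t.setVar 4 (u * D)).setVar 4 (u * D + c)).setVar 16
      (mat D (t.arr 7) u c)).setVar 32 (x + 1)).setVar 4 (u * D)).setVar 4 (u * D + c)).setArr 7
      (u * D + c) (x + 1)).setVar 4 (u * D)).setVar 4 (u * D + c)).setVar 16 (w + 1)).setVar 23
      w).setArr 8 w c) with ht1
    have hP1 : ∀ a, ∀ e < D, mat D (t1.arr aPred) a e =
        if a = u ∧ e = c then x + 1 else mat D (t.arr aPred) a e := by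
      intro a e he
      simp [ht1, mat_update hlt _ he]
    have hK1 : ∀ a, t1.arr aKey a = if a = w then c else t.arr aKey a := by
      intro a
      simp [ht1, Function.update_apply]
    obtain ⟨hwT, hwv, -, ⟨r', hcore⟩, hfresh⟩ := h.core.grow (x := x) (c := c) hm hunc h.cur h.lt h.free h.root hP0
      hw (pc' := mat D (t1.arr aPred) u) (K' := t1.arr aKey)
      (fun e he => by rw [hP1 u e he]; simp) hK1
    have hf1 : Frame [rW, rC, rLim, rQ, rT, rP, rX, rY, rGo, rH] [aPred, aKey] s t1 := by
      simp (maxDischargeDepth := 20) [ht1, Frame.setVar, Frame.setArr, h.frame]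
    have hX1 : t1.var rX = w := by simp [ht1]
    have hgo1 : t1.var rGo = 0 := by simp [ht1, hgo]
    have hrP1 : t1.var rP = t.var rP := by simp [ht1]
    have hpred1 : ∀ a, a ≠ u → ∀ e < D, mat D (t1.arr aPred) a e = mat D (s.arr aPred) a e := by
      intro a ha e he
      rw [hP1 a e he, if_neg (by tauto), h.pred a ha e he]
    have hkey1 : ∀ a, a ∉ g.N u → t1.arr aKey a = s.arr aKey a := by
      intro a ha
      rw [hK1, if_neg (by rintro rfl; exact ha hwN), h.key a ha]
    clear_value t1
    set t2 : State := (t1.setVar 15 w).setVar 20 0 with ht2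
    have hf2 : Frame [rW, rC, rLim, rQ, rT, rP, rX, rY, rGo, rH] [aPred, aKey] s t2 := by
      simp (maxDischargeDepth := 20) [ht2, Frame.setVar, hf1]
    have hM2 : t2.arr aM = s.arr aM := hf2.2 _ (by simp)
    refine wp_nextFree (n := n) (D := D) hW (hb.frame hf2 (by simp)) (by simpa [ht2] using hwn)
      (by simp [ht2]) ?_
    intro t3 σ3 hf3 hlo3 hhi3 hne3 hz3 hσ3
    have hf3s : Frame [rW, rC, rLim, rQ, rT, rP, rX, rY, rGo, rH] [aPred, aKey] s t3 :=
      hf2.trans hf3 (by simp) (by simp)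
    have hb3 := hb.frame hf3s (by simp)
    have e1 : t2.var rW = w := by simp [ht2]
    have e2 : t2.var rC = 0 := by simp [ht2]
    rw [hM2, e1, e2] at hne3
    rw [hM2, e1] at hz3
    rw [e2] at hσ3
    have hP3 : t3.arr aPred = t1.arr aPred := by rw [hf3.2 _ (by simp), ht2]; simp
    have hK3 : t3.arr aKey = t1.arr aKey := by rw [hf3.2 _ (by simp), ht2]; simp
    have hX3 : t3.var rX = w := by rw [hf3.1 _ (by simp), ht2]; simp [hX1]
    have hgo3 : t3.var rGo = 0 := by rw [hf3.1 _ (by simp), ht2]; simp [hgo1]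
    have hrP3 : t3.var rP = t.var rP := by rw [hf3.1 _ (by simp), ht2]; simp [hrP1]
    have htv3 : t3.var rV = v := by rw [hf3s.1 _ (by simp), hv]
    -- All colors passed over are in use at `w`, so the search is no longer than its degree. It
    -- follows that a dead end has degree at least `D`.
    have hcdeg : t3.var rC ≤ (g.N w).card := by
      rw [← Finset.card_range (t3.var rC)]
      refine hm.card_le hwn fun e he => ?_
      have he := Finset.mem_range.1 he
      exact ⟨by omega, hne3 e (by omega) he⟩
    simp only [wp_ifLt, wp_seq, wp_mov, hb3.D]
    refine ⟨fun hfound => ?_, fun hdead => ?_⟩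
    · rw [wp_skip]
      refine next _ _ w _ r' B ⟨hf3s, ?_, ?_, ?_, ?_, hfound, ?_, ?_, ?_, ?_, ?_, h.dead_deg, ?_⟩
        hgo3 hwT rfl hwN (by omega) (by omega)
      · rw [hP3]; exact hpred1
      · rw [hK3]; exact hkey1
      · rw [hP3, hK3, hrP3]; exact hcore
      · rw [hX3]; exact Or.inr (Finset.mem_insert_self _ _)
      · rw [hX3]; exact hz3 hfound
      · rw [hX3]; exact fun e => absurd e hwv
      · rw [hX3, hP3]; exact hfresh _ hfound
      · rw [hrP3]; exact h.bound
      · exact h.dead_sub.trans (Finset.subset_insert _ _)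
      · rw [hrP3]; exact h.dead_card
    · have hC3 : t3.var rC = D := by omega
      have hwdeg : ¬ (g.N w).card < D := by omega
      have hbound := h.bound
      simp only [var_setVar, Nat.reduceEqDiff, reduceIte, htv3, hb3.zero, hrP3, add_zero]
      refine ⟨hW.small (by omega), hW.small (by omega), hW.small (by omega), ?_⟩
      set t4 : State := ((t3.setVar 23 v).setVar 15 v).setVar 20 (t.var 21) with ht4
      have hf4 : Frame [rW, rC, rLim, rQ, rT, rP, rX, rY, rGo, rH] [aPred, aKey] s t4 := by
        simp (maxDischargeDepth := 20) [ht4, Frame.setVar, hf3s]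
      have hM4 : t4.arr aM = s.arr aM := hf4.2 _ (by simp)
      refine wp_nextFree (n := n) (D := D) hW (hb.frame hf4 (by simp)) (by simpa [ht4] using hvn)
        (by simpa [ht4] using h.bound) ?_
      intro t5 σ5 hf5 hlo5 hhi5 hne5 hz5 hσ5
      have hf5s : Frame [rW, rC, rLim, rQ, rT, rP, rX, rY, rGo, rH] [aPred, aKey] s t5 :=
        hf4.trans hf5 (by simp) (by simp)
      have hb5 := hb.frame hf5s (by simp)
      have e3 : t4.var rW = v := by simp [ht4]
      have e4 : t4.var rC = t.var rP := by simp [ht4]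
      rw [hM4, e3, e4] at hne5
      rw [hM4, e3] at hz5
      rw [e4] at hσ5 hlo5
      have hP5 : t5.arr aPred = t1.arr aPred := by rw [hf5.2 _ (by simp), ht4]; simp [hP3]
      have hK5 : t5.arr aKey = t1.arr aKey := by rw [hf5.2 _ (by simp), ht4]; simp [hK3]
      have hX5 : t5.var rX = v := by rw [hf5.1 _ (by simp), ht4]; simp
      have hgo5 : t5.var rGo = 0 := by rw [hf5.1 _ (by simp), ht4]; simp [hgo3]
      have hwB : w ∉ B := fun e => hwT (h.dead_sub e)
      have hBcard : (insert w B).card = B.card + 1 := Finset.card_insert_of_notMem hwB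
      have hBsub : insert w B ⊆ insert w T := Finset.insert_subset_insert _ h.dead_sub
      have hBdeg : ∀ a ∈ insert w B, ¬ (g.N a).card < D := by
        intro a ha
        rcases Finset.mem_insert.1 ha with rfl | ha
        · exact hwdeg
        · exact h.dead_deg a ha
      -- The dead ends, now including `w`, are as many as the colors the root has tried, so weakness
      -- provides another color.
      have hC5 : t5.var rC < D := by
        obtain ⟨e, he1, he2, he3⟩ := hm.exists_free hcore.tree.root hweak hunc
          (hBsub.trans hcore.tree.sub) (fun e => hcore.tree.root_notMem (hBsub e)) hBdeg
          (hBcard.trans h.dead_card) h.bound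
        by_contra hcon
        exact hne5 e he1 (by omega) he3
      simp only [wp_arith, eval_add, hb5.one]
      refine ⟨hW.small (by omega), ?_⟩
      set t6 : State := t5.setVar 21 (t5.var 20 + 1) with ht6
      have hf6 : Frame [rW, rC, rLim, rQ, rT, rP, rX, rY, rGo, rH] [aPred, aKey] s t6 := by
        simp (maxDischargeDepth := 20) [ht6, Frame.setVar, hf5s]
      have hP6 : t6.arr aPred = t1.arr aPred := by simp [ht6, hP5]
      have hK6 : t6.arr aKey = t1.arr aKey := by simp [ht6, hK5]
      have hX6 : t6.var rX = v := by simp [ht6, hX5]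
      have hC6 : t6.var rC = t5.var rC := by simp [ht6]
      have hrP6 : t6.var rP = t5.var rC + 1 := by simp [ht6]
      have hgo6 : t6.var rGo = 0 := by simp [ht6, hgo5]
      clear_value t6
      refine next _ _ w _ r' (insert w B) ⟨hf6, ?_, ?_, ?_, ?_, ?_, ?_, ?_, ?_, ?_, hBsub, hBdeg, ?_⟩
        hgo6 hwT rfl hwN (by omega) (by omega)
      · rw [hP6]; exact hpred1
      · rw [hK6]; exact hkey1
      · rw [hP6, hK6, hrP6]
        exact ⟨hcore.tree, hcore.live, hcore.claimed, hcore.rank, fun e he hp =>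
          (hcore.root_lt e he hp).trans (by omega)⟩
      · rw [hX6]; exact Or.inl rfl
      · rw [hC6]; exact hC5
      · rw [hX6, hC6]; exact hz5 hC5
      · rw [hC6, hrP6]; intro; omega
      · rw [hX6, hP6, hC6]
        intro e
        have := hcore.root_lt _ hC5 e
        omega
      · rw [hrP6]; omega
      · rw [hrP6, card_filter_range_succ hlo5 hne5 (hz5 hC5), hBcard, h.dead_card]

end Subprograms

theorem ValidFan.congr_all {pc K pc' K' : ℕ → ℕ} {u v x y α β : ℕ} {T : Finset ℕ} {r : ℕ → ℕ}
    (h : ValidFan g m pc K u v x y α β T r)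
    (he : ∀ a ∈ g.ball u, ∀ c < D, m' a c = m a c) (hpc : ∀ c < D, pc' c = pc c)
    (hK : ∀ a ∈ g.N u, K' a = K a) : ValidFan g m' pc' K' u v x y α β T r := by
  have h := h.congr he
  have hk : ∀ w ∈ T, K' w = K w ∧ pc' (K w) = pc (K w) := fun w hw =>
    ⟨hK w (h.tree.sub hw), hpc _ (h.tree.key_lt w hw)⟩
  refine ⟨⟨h.tree.root, h.tree.root_notMem, h.tree.root_rank, h.tree.sub, ?_, h.tree.rank_le, ?_⟩,
    ?_, h.uncolored, h.left, h.right, h.ne, h.ltα, h.ltβ, h.color_ne, h.freeα, h.free_left,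
    h.free_right, by rw [hpc _ h.ltβ, h.claim]⟩
  · intro w hw; rw [(hk w hw).1]; exact h.tree.key_lt w hw
  · intro w hw; rw [(hk w hw).1, (hk w hw).2]; exact h.tree.parent w hw
  · intro w hw hr; rw [(hk w hw).1, (hk w hw).2]; exact h.live w hw hr

section Subprograms

variable {W : ℕ} {Q : State → ℕ → Prop} {s : State} {τ : ℕ}

theorem wp_buildFan {u v : ℕ} (hW : WordSize n D W) (hb : Base D s) (hu : s.var rU = u)
    (hv : s.var rV = v) (hm : g.Col (mat D (s.arr aM))) (huv : v ∈ g.N u)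
    (hunc : ∀ c < D, mat D (s.arr aM) u c ≠ v + 1) (hweak : g.WeakAt u v)
    (hfresh : ∀ c < D, mat D (s.arr aPred) u c = 0)
    (post : ∀ s₁ s' τ', Frame [rW, rC, rLim, rQ, rT, rAl, rP, rX, rGo] [] s s₁ →
      s₁.var rAl < D → FanDone g u v s₁ s' →
      τ' ≤ τ + 110 * g.cost (g.N u) + 40 * D + 200 → Q s' τ') :
    WP W Prog.buildFan Q s τ := by
  have hDn := hW.deg_le
  have hun : u < n := g.lt' huv
  have hvn : v < n := g.lt huv
  have h0W : 0 < W := hW.small (by omega)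
  have h1W : 1 < W := hW.small (by omega)
  simp only [Prog.buildFan, wp_seq, wp_mov, wp_const, hu, hb.zero, add_zero]
  refine ⟨hW.small (by omega), h0W, ?_⟩
  set a1 : State := (s.setVar 15 u).setVar 20 0 with ha1
  have hfa1 : Frame [rW, rC, rLim, rQ, rT] [] s a1 := by
    simp (maxDischargeDepth := 20) [ha1, Frame.setVar, Frame.refl]
  have hMa1 : a1.arr aM = s.arr aM := hfa1.2 _ (by simp)
  refine wp_nextFree (n := n) (D := D) hW (hb.frame hfa1 (by simp)) (by simpa [ha1] using hun)
    (by simp [ha1]) ?_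
  intro a2 σ2 hf2 _ hhi2 hne2 hz2 hσ2
  have hfa2 : Frame [rW, rC, rLim, rQ, rT] [] s a2 := hfa1.trans hf2 (by simp) (by simp)
  have hb2 := hb.frame hfa2 (by simp)
  have e1 : a1.var rW = u := by simp [ha1]
  have e2 : a1.var rC = 0 := by simp [ha1]
  rw [hMa1, e1, e2] at hne2
  rw [hMa1, e1] at hz2
  rw [e2] at hσ2
  -- The uncolored edge $uv$ leaves fewer than $d(u) \le D$ colors in use at `u`.
  have hα : a2.var rC < D := by
    by_contra hcon
    have := hm.card_lt huv (C := Finset.range D) (fun c hc => ?_) hunc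
    · rw [Finset.card_range] at this
      have := g.deg_le u
      omega
    · have hc := Finset.mem_range.1 hc
      exact ⟨hc, hne2 c (by omega) (by omega)⟩
  have hαu := hz2 hα
  have hva2 : a2.var rV = v := by rw [hfa2.1 _ (by simp), hv]
  simp only [wp_mov, wp_const, var_setVar, Nat.reduceEqDiff, reduceIte, hb2.zero, hva2, add_zero]
  refine ⟨hW.small (by omega), hW.small (by omega), h0W, ?_⟩
  set a3 : State := ((a2.setVar 19 (a2.var 20)).setVar 15 v).setVar 20 0 with ha3
  have hfa3 : Frame [rW, rC, rLim, rQ, rT, rAl] [] s a3 := by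
    have := hfa2.trans (Frame.refl (X := []) (A := []) a2) (X := [rW, rC, rLim, rQ, rT])
      (by simp) (by simp)
    have h' : Frame [rW, rC, rLim, rQ, rT, rAl] [] s a2 :=
      (Frame.refl (X := [rW, rC, rLim, rQ, rT, rAl]) (A := []) s).trans this (by simp) (by simp)
    simp (maxDischargeDepth := 20) [ha3, Frame.setVar, h']
  have hMa3 : a3.arr aM = s.arr aM := hfa3.2 _ (by simp)
  refine wp_nextFree (n := n) (D := D) hW (hb.frame hfa3 (by simp)) (by simpa [ha3] using hvn)
    (by simp [ha3]) ?_
  intro a4 σ4 hf4 _ hhi4 hne4 hz4 hσ4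
  have hfa4 : Frame [rW, rC, rLim, rQ, rT, rAl] [] s a4 := hfa3.trans hf4 (by simp) (by simp)
  have hb4 := hb.frame hfa4 (by simp)
  have e3 : a3.var rW = v := by simp [ha3]
  have e4 : a3.var rC = 0 := by simp [ha3]
  rw [hMa3, e3, e4] at hne4
  rw [hMa3, e3] at hz4
  rw [e4] at hσ4
  -- The instance of `exists_free` without dead ends: the root has at least one free color.
  have hc : a4.var rC < D := by
    obtain ⟨e, -, he2, he3⟩ := hm.exists_free (B := ∅) (b := 0) huv hweak hunc (by simp) (by simp)
      (by simp) (by simp) (by omega)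
    by_contra hcon
    exact hne4 e (by omega) (by omega) he3
  have hAl4 : a4.var rAl = a2.var rC := by rw [hf4.1 _ (by simp), ha3]; simp
  have hva4 : a4.var rV = v := by rw [hfa4.1 _ (by simp), hv]
  simp only [wp_arith, wp_mov, wp_const, eval_add, var_setVar, Nat.reduceEqDiff, reduceIte,
    hb4.zero, hb4.one, hva4, add_zero]
  refine ⟨hW.small (by omega), hW.small (by omega), h0W, ?_⟩
  set a5 : State := ((a4.setVar 21 (a4.var 20 + 1)).setVar 23 v).setVar 22 0 with ha5
  have hfa5 : Frame [rW, rC, rLim, rQ, rT, rAl, rP, rX, rGo] [] s a5 := by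
    have h' : Frame [rW, rC, rLim, rQ, rT, rAl, rP, rX, rGo] [] s a4 :=
      (Frame.refl (X := [rW, rC, rLim, rQ, rT, rAl, rP, rX, rGo]) (A := []) s).trans hfa4
        (by simp) (by simp)
    simp (maxDischargeDepth := 20) [ha5, Frame.setVar, h']
  have hb5 := hb.frame hfa5 (by simp)
  have hu5 : a5.var rU = u := by rw [hfa5.1 _ (by simp), hu]
  have hv5 : a5.var rV = v := by rw [hfa5.1 _ (by simp), hv]
  have hM5 : a5.arr aM = s.arr aM := hfa5.2 _ (by simp)
  have hP5 : a5.arr aPred = s.arr aPred := hfa5.2 _ (by simp)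
  have hAl5 : a5.var rAl = a2.var rC := by simp [ha5, hAl4]
  have hX5 : a5.var rX = v := by simp [ha5]
  have hC5 : a5.var rC = a4.var rC := by simp [ha5]
  have hp5 : a5.var rP = a4.var rC + 1 := by simp [ha5]
  have hgo5 : a5.var rGo = 0 := by simp [ha5]
  clear_value a5
  have hcostT : ∀ {T : Finset ℕ}, T ⊆ g.N u → g.cost T ≤ g.cost (g.N u) := fun h =>
    Finset.sum_le_sum_of_subset h
  -- Every step that does not finish the fan adds a vertex to the tree, which has at most `D`
  -- vertices.
  refine wp_while (fun k t σ =>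
    (t.var rGo = 0 ∧ ∃ T r B, FanState g u v a5 t T r B ∧ k = D + 1 - T.card ∧
      σ ≤ τ + 110 * g.cost T + 30 * D + 10 * t.var rP + 70) ∨
    (FanDone g u v a5 t ∧ k = 0 ∧ σ ≤ τ + 110 * g.cost (g.N u) + 40 * D + 150)) ?_ ?_ (D + 1) ?_
  · rintro k t σ (⟨hgo, T, r, B, hS, rfl, hσ⟩ | ⟨hdone, -⟩) hlt
    · have hTD := (Finset.card_le_card hS.core.tree.sub).trans (g.deg_le u)
      have hcT := hcostT hS.core.tree.sub
      have hbd := hS.bound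
      refine wp_fanStep hW hb5 hu5 hv5 (by rwa [hM5]) (by rwa [hM5]) (by rwa [hAl5])
        (by rwa [hM5, hAl5]) hweak hS hgo ?_ ?_
      · intro t' τ' hdone hτ'
        exact ⟨0, by omega, Or.inr ⟨hdone, rfl, by omega⟩⟩
      · rintro t' τ' w T' r' B' hS' hgo' hwT rfl hwN hpp hτ'
        have hcard : (insert w T).card = T.card + 1 := Finset.card_insert_of_notMem hwT
        have hcost : g.cost (insert w T) = g.cost T + ((g.N w).card + 1) := by
          rw [NatGraph.cost, Finset.sum_insert hwT, NatGraph.cost]; ring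
        have := (Finset.card_le_card hS'.core.tree.sub).trans (g.deg_le u)
        exact ⟨D + 1 - (insert w T).card, by omega, Or.inl ⟨hgo', _, r', B', hS', rfl, by omega⟩⟩
    · have hbt := hb5.frame hdone.frame (by simp)
      rw [hbt.one] at hlt
      rcases hdone.result with ⟨h, -⟩ | ⟨h, -⟩ <;> omega
  · rintro k t σ (⟨hgo, T, r, B, hS, -⟩ | ⟨hdone, -, hσ⟩) hlt
    · have hbt := hb5.frame hS.frame (by simp)
      rw [hbt.one] at hlt; omega
    · exact post a5 t _ hfa5 (by rwa [hAl5]) hdone (by omega)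
  · left
    refine ⟨hgo5, ∅, fun _ => 0, ∅, ⟨Frame.refl _, fun _ _ _ _ => rfl, fun _ _ => rfl, ?_, ?_, ?_,
      ?_, ?_, ?_, ?_, ?_, ?_, ?_⟩, by simp, by omega⟩
    · rw [hP5]
      refine ⟨⟨huv, by simp, rfl, by simp, by simp, by simp, by simp⟩, by simp [Live], ?_, by simp,
        ?_⟩
      · intro c hc h; exact absurd (hfresh c hc) h
      · intro c hc h; rw [hfresh c hc] at h; omega
    · exact Or.inl hX5
    · rwa [hC5]
    · rw [hM5, hX5, hC5]; exact hz4 hc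
    · rw [hC5, hp5]; intro; omega
    · rw [hP5, hC5, hfresh _ hc]; omega
    · omega
    · simp
    · simp
    · rw [hM5, hp5, card_filter_range_succ (b := 0) (by omega)
        (fun e h1 h2 => hne4 e (by omega) h2) (hz4 hc)]
      simp

theorem wp_recordFan {cl : ℕ} (hW : WordSize n D W) (hb : Base D s) (hα : s.var rAl < D)
    (hβ : s.var rC < D) (hF : s.var rF < n) (hcl : cl = s.var rAl * D + s.var rC)
    (hcount : s.arr aCount cl ≤ n)
    (post : ∀ s' τ', Frame [rCl, rQ, rBn, rBc, rBa, rBb, rF]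
        [aFu, aFv, aFx, aFy, aFc, aCount] s s' →
      s'.var rF = s.var rF + 1 →
      s'.arr aFu = Function.update (s.arr aFu) (s.var rF) (s.var rU) →
      s'.arr aFv = Function.update (s.arr aFv) (s.var rF) (s.var rV) →
      s'.arr aFx = Function.update (s.arr aFx) (s.var rF) (s.var rX) →
      s'.arr aFy = Function.update (s.arr aFy) (s.var rF) (s.var rY) →
      s'.arr aFc = Function.update (s.arr aFc) (s.var rF) cl →
      s'.arr aCount = Function.update (s.arr aCount) cl (s.arr aCount cl + 1) →
      ((s.var rBn < s.arr aCount cl + 1 ∧ s'.var rBn = s.arr aCount cl + 1 ∧ s'.var rBc = cl ∧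
          s'.var rBa = s.var rAl ∧ s'.var rBb = s.var rC) ∨
        (s.arr aCount cl + 1 ≤ s.var rBn ∧ s'.var rBn = s.var rBn ∧ s'.var rBc = s.var rBc ∧
          s'.var rBa = s.var rBa ∧ s'.var rBb = s.var rBb)) →
      τ' ≤ τ + 30 → Q s' τ') :
    WP W Prog.recordFan Q s τ := by
  have hDn := hW.deg_le
  have hr := hW.row (v := s.var rAl) (by omega)
  have ha := hW.addr (v := s.var rAl) (c := s.var rC) (by omega) (by omega)
  simp only [Prog.recordFan, wp_seq, wp_arith, wp_load, wp_store, wp_ifLt, wp_skip, wp_mov,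
    eval_mul, eval_add, var_setVar, arr_setVar, var_setArr, arr_setArr, hb.D, hb.one, hb.zero,
    Nat.reduceEqDiff, reduceIte, add_zero, ← hcl] at ha ⊢
  refine ⟨hr, ha, hW.small (by omega), fun hlt => ⟨hW.small (by omega), ha, hW.small (by omega),
    hW.small (by omega), hW.small (by omega), post _ _ ?_ ?_ ?_ ?_ ?_ ?_ ?_ ?_ ?_ (by omega)⟩,
    fun hlt => ⟨hW.small (by omega), post _ _ ?_ ?_ ?_ ?_ ?_ ?_ ?_ ?_ ?_ (by omega)⟩⟩
  · simp (maxDischargeDepth := 30) [Frame.setVar, Frame.setArr, Frame.refl]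
  any_goals simp
  · omega
  · simp (maxDischargeDepth := 30) [Frame.setVar, Frame.setArr, Frame.refl]
  · omega

end Subprograms

/-! ### The first pass -/

/-- The vertices of the fans with centers in `S`. -/
def NatGraph.cover (g : NatGraph n D) (S : Finset ℕ) : Finset ℕ := S.biUnion g.ball

theorem NatGraph.cover_insert (u : ℕ) (S : Finset ℕ) :
    g.cover (insert u S) = g.ball u ∪ g.cover S := by
  simp [NatGraph.cover, Finset.biUnion_insert]

theorem NatGraph.subset_cover {u : ℕ} {S : Finset ℕ} (h : u ∈ S) : g.ball u ⊆ g.cover S :=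
  Finset.subset_biUnion_of_mem g.ball h

theorem NatGraph.self_mem_ball (u : ℕ) : u ∈ g.ball u := Finset.mem_insert_self _ _

/-- The state `s` after some fans have been built, with centers in `S`; those in `R` have
been shifted, the others are stored. -/
structure Collected (g : NatGraph n D) (m₀ : ℕ → ℕ → ℕ) (s : State) (S R : Finset ℕ) : Prop where
  base : Base D s
  graph : HasGraph g s
  col : g.Col (mat D (s.arr aM))
  colored : ∀ a < n, ∀ b, Colored D m₀ a b → Colored D (mat D (s.arr aM)) a b
  mark : ∀ a, s.arr aMark a = if a ∈ g.cover S then 1 else 0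
  disjoint : ∀ u ∈ S, ∀ u' ∈ S, u ≠ u' → Disjoint (g.ball u) (g.ball u')
  active : S ⊆ g.active
  rows : ∀ a, a ∉ g.cover S → ∀ c < D, mat D (s.arr aM) a c = m₀ a c
  fresh : ∀ u, u ∉ S → ∀ c < D, mat D (s.arr aPred) u c = 0
  shifted_sub : R ⊆ S
  shifted : ∀ u ∈ R, ∃ v ∈ g.N u, ¬ Colored D m₀ u v ∧ Colored D (mat D (s.arr aM)) u v
  card : S.card = R.card + s.var rF
  center : ∀ f < s.var rF, s.arr aFu f ∈ S ∧ s.arr aFu f ∉ R ∧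
    ¬ Colored D m₀ (s.arr aFu f) (s.arr aFv f)
  fan : ∀ f < s.var rF, ∃ α β T r, s.arr aFc f = α * D + β ∧
    ValidFan g (mat D (s.arr aM)) (mat D (s.arr aPred) (s.arr aFu f)) (s.arr aKey)
      (s.arr aFu f) (s.arr aFv f) (s.arr aFx f) (s.arr aFy f) α β T r
  inj : ∀ f < s.var rF, ∀ f' < s.var rF, s.arr aFu f = s.arr aFu f' → f = f'
  count : ∀ c, s.arr aCount c = ((Finset.range (s.var rF)).filter fun f => s.arr aFc f = c).card
  count_le : ∀ c, s.arr aCount c ≤ s.var rBn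
  best : s.var rBn ≤ s.arr aCount (s.var rBc)
  best_eq : s.var rBc = s.var rBa * D + s.var rBb
  best_lt : 0 < D → s.var rBa < D ∧ s.var rBb < D

theorem Collected.frame {m₀ : ℕ → ℕ → ℕ} {s s' : State} {S R : Finset ℕ} {X A : List ℕ}
    (h : Collected g m₀ s S R) (hf : Frame X A s s')
    (hX : ∀ x ∈ [rD, r1, r0, rF, rBn, rBc, rBa, rBb], x ∉ X)
    (hA : ∀ a ∈ [aDeg, aStart, aAdj, aM, aMark, aPred, aKey, aFu, aFv, aFx, aFy, aFc, aCount],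
      a ∉ A) : Collected g m₀ s' S R := by
  obtain ⟨h1, h2, h3, h4, h5, h6, h7, h8, h9, h10, h11, h12, h13, h14, h15, h16, h17, h18, h19,
    h20⟩ := h
  simp only [List.forall_mem_cons, List.not_mem_nil, false_imp_iff, implies_true,
    and_true] at hX hA
  have eF := hf.1 _ hX.2.2.2.1
  have eBn := hf.1 _ hX.2.2.2.2.1
  have eBc := hf.1 _ hX.2.2.2.2.2.1
  have eBa := hf.1 _ hX.2.2.2.2.2.2.1
  have eBb := hf.1 _ hX.2.2.2.2.2.2.2
  obtain ⟨k0, k1, k2, k3, k6, k7, k8, k9, k10, k11, k12, k13, k14⟩ := hA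
  have e3 := hf.2 _ k3
  have e6 := hf.2 _ k6
  have e7 := hf.2 _ k7
  have e8 := hf.2 _ k8
  have e9 := hf.2 _ k9
  have e10 := hf.2 _ k10
  have e11 := hf.2 _ k11
  have e12 := hf.2 _ k12
  have e13 := hf.2 _ k13
  have e14 := hf.2 _ k14
  refine ⟨h1.frame hf ⟨hX.1, hX.2.1, hX.2.2.1⟩, h2.frame hf ⟨k0, k1, k2⟩, ?_, ?_, ?_, h6, h7, ?_,
    ?_, h10, ?_, ?_, ?_, ?_, ?_, ?_, ?_, ?_, ?_, ?_⟩
  all_goals simpa only [eF, eBn, eBc, eBa, eBb, e3, e6, e7, e8, e9, e10, e11, e12, e13, e14]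

/-- What building a fan at `u` does to the memory, apart from the fan itself. -/
structure FanBuilt (g : NatGraph n D) (u : ℕ) (s t : State) : Prop where
  base : Base D t
  graph : HasGraph g t
  mark : ∀ a, t.arr aMark a = if a ∈ g.ball u then 1 else s.arr aMark a
  pred : ∀ a, a ≠ u → ∀ c < D, mat D (t.arr aPred) a c = mat D (s.arr aPred) a c
  key : ∀ a, a ∉ g.N u → t.arr aKey a = s.arr aKey a

/-- Work at `u` writes predecessors only in row `u` and keys only at neighbors of `u`; a fan with
disjoint closed neighborhood reads neither. The arrays therefore never have to be cleared between
fans. -/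
theorem ValidFan.of_built {s t : State} {u u' v x y α β : ℕ} {T : Finset ℕ} {r : ℕ → ℕ} (hb : FanBuilt g u s t)
    (hdis : Disjoint (g.ball u') (g.ball u))
    (hrow : ∀ a, a ∉ g.ball u → ∀ c < D, mat D (t.arr aM) a c = mat D (s.arr aM) a c)
    (h : ValidFan g (mat D (s.arr aM)) (mat D (s.arr aPred) u') (s.arr aKey) u' v x y α β T r) :
    ValidFan g (mat D (t.arr aM)) (mat D (t.arr aPred) u') (t.arr aKey) u' v x y α β T r := by
  have hnot : ∀ {a}, a ∈ g.ball u' → a ∉ g.ball u := fun ha => Finset.disjoint_left.1 hdis ha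
  refine h.congr_all (fun a ha c hc => hrow a (hnot ha) c hc) (fun c hc => hb.pred u' ?_ c hc) ?_
  · rintro rfl
    exact hnot (NatGraph.self_mem_ball _) (NatGraph.self_mem_ball _)
  · intro a ha
    exact hb.key a fun h' =>
      hnot (Finset.mem_insert_of_mem ha) (Finset.mem_insert_of_mem h')

section Insert

variable {m₀ : ℕ → ℕ → ℕ} {s t : State} {S R : Finset ℕ} {u v : ℕ}

theorem disjoint_insert_ball (h : ∀ u ∈ S, ∀ u' ∈ S, u ≠ u' → Disjoint (g.ball u) (g.ball u'))
    (hd : ∀ a ∈ g.ball u, a ∉ g.cover S) :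
    ∀ a ∈ insert u S, ∀ b ∈ insert u S, a ≠ b → Disjoint (g.ball a) (g.ball b) := by
  have key : ∀ b ∈ S, Disjoint (g.ball u) (g.ball b) := fun b hb =>
    Finset.disjoint_left.2 fun x hx hx' => hd x hx (NatGraph.subset_cover hb hx')
  intro a ha b hb hab
  rcases Finset.mem_insert.1 ha with ha | ha <;> rcases Finset.mem_insert.1 hb with hb | hb
  · exact absurd (ha.trans hb.symm) hab
  · exact ha ▸ key b hb
  · exact hb ▸ (key a ha).symm
  · exact h a ha b hb hab

theorem Collected.insert_shifted (h : Collected g m₀ s S R) (hv : v ∈ g.N u)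
    (hd : ∀ a ∈ g.ball u, a ∉ g.cover S) (hunc : ¬ Colored D m₀ u v)
    (hb : FanBuilt g u s t) (hs : Shifted g (mat D (s.arr aM)) (mat D (t.arr aM)) u v Set.univ 0 0)
    (hX : ∀ x ∈ [rF, rBn, rBc, rBa, rBb], t.var x = s.var x)
    (hA : ∀ a ∈ [aFu, aFv, aFx, aFy, aFc, aCount], t.arr a = s.arr a) :
    Collected g m₀ t (insert u S) (insert u R) := by
  simp only [List.forall_mem_cons, List.not_mem_nil, false_imp_iff, implies_true,
    and_true] at hX hA
  obtain ⟨eF, eBn, eBc, eBa, eBb⟩ := hX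
  obtain ⟨e9, e10, e11, e12, e13, e14⟩ := hA
  have huS : u ∉ S := fun hu => hd u (NatGraph.self_mem_ball u)
    (NatGraph.subset_cover hu (NatGraph.self_mem_ball u))
  have huR : u ∉ R := fun hu => huS (h.shifted_sub hu)
  have hne : ∀ {a}, a ∈ S → a ≠ u := fun ha e => huS (e ▸ ha)
  refine ⟨hb.base, hb.graph, hs.col, ?_, ?_, disjoint_insert_ball h.disjoint hd, ?_, ?_, ?_,
    Finset.insert_subset_insert _ h.shifted_sub, ?_, ?_, ?_, ?_, ?_, ?_, ?_, ?_, ?_, ?_⟩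
  · exact fun a ha b hab => hs.colored a ha b (h.colored a ha b hab)
  · intro a
    simp only [hb.mark, h.mark, NatGraph.cover_insert, Finset.mem_union]
    by_cases h1 : a ∈ g.ball u <;> simp [h1]
  · exact Finset.insert_subset (NatGraph.mem_active hv).2 h.active
  · intro a ha c hc
    rw [NatGraph.cover_insert, Finset.mem_union, not_or] at ha
    rw [hs.rows a ha.1 c hc, h.rows a ha.2 c hc]
  · intro a ha c hc
    rw [Finset.mem_insert, not_or] at ha
    rw [hb.pred a ha.1 c hc, h.fresh a ha.2 c hc]
  · intro a ha
    rcases Finset.mem_insert.1 ha with rfl | ha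
    · exact ⟨v, hv, hunc, hs.new⟩
    · obtain ⟨w, hw, h1, h2⟩ := h.shifted a ha
      exact ⟨w, hw, h1, hs.colored a (g.lt' hw) w h2⟩
  · rw [Finset.card_insert_of_notMem huS, Finset.card_insert_of_notMem huR, eF, h.card]; ring
  · rw [eF, e9, e10]
    intro f hf
    obtain ⟨h1, h2, h3⟩ := h.center f hf
    refine ⟨Finset.mem_insert_of_mem h1, ?_, h3⟩
    rw [Finset.mem_insert, not_or]
    exact ⟨hne h1, h2⟩
  · rw [eF, e9, e10, e11, e12, e13]
    intro f hf
    obtain ⟨α, β, T, r, h1, h2⟩ := h.fan f hf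
    refine ⟨α, β, T, r, h1, ValidFan.of_built hb ?_ hs.rows h2⟩
    exact Finset.disjoint_left.2 fun x hx hx' =>
      hd x hx' (NatGraph.subset_cover (h.center f hf).1 hx)
  · rw [eF, e9]; exact h.inj
  · rw [eF, e13, e14]; exact h.count
  · rw [e14, eBn]; exact h.count_le
  · rw [e14, eBn, eBc]; exact h.best
  · rw [eBc, eBa, eBb]; exact h.best_eq
  · rw [eBa, eBb]; exact h.best_lt

theorem Collected.insert_stored {x y α β : ℕ} {T : Finset ℕ} {r : ℕ → ℕ}
    (h : Collected g m₀ s S R) (hv : v ∈ g.N u)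
    (hd : ∀ a ∈ g.ball u, a ∉ g.cover S) (hunc : ¬ Colored D m₀ u v)
    (hb : FanBuilt g u s t) (hM : t.arr aM = s.arr aM)
    (hfan : ValidFan g (mat D (s.arr aM)) (mat D (t.arr aPred) u) (t.arr aKey) u v x y α β T r)
    (eF : t.var rF = s.var rF + 1)
    (e9 : t.arr aFu = Function.update (s.arr aFu) (s.var rF) u)
    (e10 : t.arr aFv = Function.update (s.arr aFv) (s.var rF) v)
    (e11 : t.arr aFx = Function.update (s.arr aFx) (s.var rF) x)
    (e12 : t.arr aFy = Function.update (s.arr aFy) (s.var rF) y)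
    (e13 : t.arr aFc = Function.update (s.arr aFc) (s.var rF) (α * D + β))
    (e14 : t.arr aCount = Function.update (s.arr aCount) (α * D + β)
      (s.arr aCount (α * D + β) + 1))
    (hbest : (s.var rBn < s.arr aCount (α * D + β) + 1 ∧
          t.var rBn = s.arr aCount (α * D + β) + 1 ∧ t.var rBc = α * D + β ∧
          t.var rBa = α ∧ t.var rBb = β) ∨
        (s.arr aCount (α * D + β) + 1 ≤ s.var rBn ∧ t.var rBn = s.var rBn ∧
          t.var rBc = s.var rBc ∧ t.var rBa = s.var rBa ∧ t.var rBb = s.var rBb)) :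
    Collected g m₀ t (insert u S) R := by
  have huS : u ∉ S := fun hu => hd u (NatGraph.self_mem_ball u)
    (NatGraph.subset_cover hu (NatGraph.self_mem_ball u))
  have huR : u ∉ R := fun hu => huS (h.shifted_sub hu)
  have hne : ∀ {a}, a ∈ S → a ≠ u := fun ha e => huS (e ▸ ha)
  have hfne : ∀ {f}, f < s.var rF → f ≠ s.var rF := fun hf => hf.ne
  have hcount := h.count
  have hcle := h.count_le
  refine ⟨hb.base, hb.graph, hM ▸ h.col, ?_, ?_, disjoint_insert_ball h.disjoint hd, ?_, ?_, ?_,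
    h.shifted_sub.trans (Finset.subset_insert _ _), ?_, ?_, ?_, ?_, ?_, ?_, ?_, ?_, ?_, ?_⟩
  · rw [hM]; exact h.colored
  · intro a
    simp only [hb.mark, h.mark, NatGraph.cover_insert, Finset.mem_union]
    by_cases h1 : a ∈ g.ball u <;> simp [h1]
  · exact Finset.insert_subset (NatGraph.mem_active hv).2 h.active
  · intro a ha c hc
    rw [NatGraph.cover_insert, Finset.mem_union, not_or] at ha
    rw [hM, h.rows a ha.2 c hc]
  · intro a ha c hc
    rw [Finset.mem_insert, not_or] at ha
    rw [hb.pred a ha.1 c hc, h.fresh a ha.2 c hc]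
  · rw [hM]; exact h.shifted
  · rw [Finset.card_insert_of_notMem huS, eF, h.card]; ring
  · rw [eF, e9, e10]
    intro f hf
    rcases Nat.lt_succ_iff_lt_or_eq.1 hf with hf | rfl
    · rw [Function.update_of_ne (hfne hf), Function.update_of_ne (hfne hf)]
      obtain ⟨h1, h2, h3⟩ := h.center f hf
      exact ⟨Finset.mem_insert_of_mem h1, h2, h3⟩
    · simp only [Function.update_self]
      exact ⟨Finset.mem_insert_self _ _, huR, hunc⟩
  · rw [eF, e9, e10, e11, e12, e13]
    intro f hf
    rcases Nat.lt_succ_iff_lt_or_eq.1 hf with hf | rfl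
    · simp only [Function.update_of_ne (hfne hf)]
      obtain ⟨α, β, T, r, h1, h2⟩ := h.fan f hf
      refine ⟨α, β, T, r, h1, ValidFan.of_built hb ?_ (fun _ _ _ _ => by rw [hM]) h2⟩
      exact Finset.disjoint_left.2 fun x hx hx' =>
        hd x hx' (NatGraph.subset_cover (h.center f hf).1 hx)
    · simp only [Function.update_self, hM]
      exact ⟨α, β, T, r, rfl, hfan⟩
  · rw [eF, e9]
    intro f hf f' hf'
    rcases Nat.lt_succ_iff_lt_or_eq.1 hf with hf | rfl <;>
      rcases Nat.lt_succ_iff_lt_or_eq.1 hf' with hf' | rfl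
    · rw [Function.update_of_ne (hfne hf), Function.update_of_ne (hfne hf')]
      exact h.inj f hf f' hf'
    · rw [Function.update_of_ne (hfne hf), Function.update_self]
      exact fun e => absurd e (hne (h.center f hf).1)
    · rw [Function.update_of_ne (hfne hf'), Function.update_self]
      exact fun e => absurd e.symm (hne (h.center f' hf').1)
    · exact fun _ => rfl
  · intro c
    rw [eF, e13, e14, Finset.range_add_one, Finset.filter_insert, Function.update_self]
    have : (Finset.range (s.var rF)).filter
        (fun f => Function.update (s.arr aFc) (s.var rF) (α * D + β) f = c) =
        (Finset.range (s.var rF)).filter fun f => s.arr aFc f = c :=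
      Finset.filter_congr fun f hf => by
        rw [Function.update_of_ne (hfne (Finset.mem_range.1 hf))]
    rw [this]
    by_cases hc : c = α * D + β
    · subst hc
      rw [if_pos rfl, Function.update_self, Finset.card_insert_of_notMem (by simp), hcount]
    · rw [if_neg (Ne.symm hc), Function.update_of_ne hc, hcount]
  · intro c
    rw [e14, Function.update_apply]
    have := hcle c
    split_ifs with hc
    · omega
    · omega
  · rw [e14, Function.update_apply]
    have := h.best
    split_ifs with hc
    · rcases hbest with hbest | hbest
      · omega
      · rw [hbest.2.2.1] at hc
        rw [← hc]
        rw [← hc] at hbest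
        omega
    · rcases hbest with hbest | hbest
      · exact absurd hbest.2.2.1 hc
      · rw [hbest.2.2.1, hbest.2.1]; exact this
  · rcases hbest with hbest | hbest
    · rw [hbest.2.2.1, hbest.2.2.2.1, hbest.2.2.2.2]
    · rw [hbest.2.2.1, hbest.2.2.2.1, hbest.2.2.2.2]; exact h.best_eq
  · rcases hbest with hbest | hbest
    · rw [hbest.2.2.2.1, hbest.2.2.2.2]; exact fun _ => ⟨hfan.ltα, hfan.ltβ⟩
    · rw [hbest.2.2.2.1, hbest.2.2.2.2]; exact h.best_lt

end Insert

section Subprograms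

variable {W : ℕ} {Q : State → ℕ → Prop} {s : State} {τ : ℕ}

-- A weak orientation is always hit afterwards: either the closed neighborhood of `u` met an earlier
-- one, or `u` has become a center. The $O(D)$ part pays for scanning and shifting, and the
-- construction of a fan is charged to the vertices by which the cover grows.
set_option maxHeartbeats 800000 in
theorem wp_tryEdge {m₀ : ℕ → ℕ → ℕ} {S R : Finset ℕ} {u v : ℕ} (hW : WordSize n D W)
    (h : Collected g m₀ s S R) (hu : s.var rU = u) (hv : s.var rV = v) (huv : v ∈ g.N u)
    (hunc : ¬ Colored D m₀ u v)
    (post : ∀ s' τ' S' R', Frame [rT, rJ, rS, rG, rW, rQ, rAcc, rCnt, rAl, rC, rP, rGo, rX, rY, rF,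
        rBn, rBc, rBa, rBb, rCl, rLim, rH]
        [aM, aMark, aPred, aKey, aFu, aFv, aFx, aFy, aFc, aCount] s s' →
      Collected g m₀ s' S' R' → S ⊆ S' → (g.WeakAt u v → ∃ p ∈ g.ball u, p ∈ g.cover S') →
      τ' + 200 * g.cost (g.cover S) ≤ τ + 200 * D + 1000 + 200 * g.cost (g.cover S') → Q s' τ') :
    WP W Prog.tryEdge Q s τ := by
  have hDn := hW.deg_le
  have hun : u < n := g.lt' huv
  have hvn : v < n := g.lt huv
  have hdu := g.deg_le u
  have hdv := g.deg_le v
  simp only [Prog.tryEdge, wp_seq]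
  refine wp_scanNbrs hW h.base h.graph (by rwa [hu]) (fun a => ?_) ?_
  · rw [h.mark]; split_ifs <;> omega
  rw [hu]
  intro s1 σ1 hf1 hS1 hG1 hacc hcnt hσ1
  have hb1 := h.base.frame hf1 (by simp)
  have hg1 := h.graph.frame hf1 (by simp)
  have hv1 : s1.var rV = v := by rw [hf1.1 _ (by simp), hv]
  have hu1 : s1.var rU = u := by rw [hf1.1 _ (by simp), hu]
  have hfree : s1.var rAcc = 0 ↔ ∀ a ∈ g.ball u, a ∉ g.cover S := by
    rw [hacc]
    refine forall₂_congr fun a _ => ?_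
    rw [h.mark]; split_ifs with ha <;> simp [ha]
  have hcntle : s1.var rCnt ≤ D := by
    rw [hcnt]; exact (Finset.card_filter_le _ _).trans hdu
  have hweak : g.WeakAt u v ↔
      s1.var rCnt + (g.N v).card ≤ D + if (g.N v).card < D then 0 else 1 := by
    rw [hcnt]; rfl
  have hskip : ∀ t σ, Frame [rT, rJ, rS, rG, rW, rQ, rAcc, rCnt, rAl, rC, rP, rGo, rX, rY, rF,
        rBn, rBc, rBa, rBb, rCl, rLim, rH] [] s t →
      Collected g m₀ t S R → (g.WeakAt u v → ∃ p ∈ g.ball u, p ∈ g.cover S) →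
      σ ≤ σ1 + 20 → Q t σ := by
    intro t σ hf hc hw hσ
    refine post t σ S R ⟨hf.1, fun a _ => hf.2 a (by simp)⟩ hc subset_rfl hw (by omega)
  have hf1s : Frame [rT, rJ, rS, rG, rW, rQ, rAcc, rCnt, rAl, rC, rP, rGo, rX, rY, rF,
        rBn, rBc, rBa, rBb, rCl, rLim, rH] [] s s1 :=
      (Frame.refl s).trans hf1 (by simp) (by simp)
  have hc1 : Collected g m₀ s1 S R := h.frame hf1 (by simp) (by simp)
  have hgen : ∀ t σ, Frame [rQ, rCnt, rLim] [] s1 t → σ ≤ σ1 + 10 →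
      (g.WeakAt u v ↔ ¬ t.var rLim < t.var rCnt) →
      WP W (.ifLt rAcc r1 (.ifLt rLim rCnt .skip (Prog.markNbrs ;; Prog.buildFan ;;
        .ifLt r1 rGo Prog.recordFan Prog.shiftFan)) .skip) Q t σ := by
    intro t σ hf hσ hwk
    have hbt := hb1.frame hf (by simp)
    have hgt := hg1.frame hf (by simp)
    have hft : Frame [rT, rJ, rS, rG, rW, rQ, rAcc, rCnt, rAl, rC, rP, rGo, rX, rY, rF,
        rBn, rBc, rBa, rBb, rCl, rLim, rH] [] s t := hf1s.trans hf (by simp) (by simp)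
    have hct : Collected g m₀ t S R := hc1.frame hf (by simp) (by simp)
    have hAt : t.var rAcc = s1.var rAcc := hf.1 _ (by simp)
    simp only [wp_ifLt, wp_skip, hbt.one, hAt]
    refine ⟨fun h0 => ⟨fun hlt => ?_, fun hlt => ?_⟩, fun h0 => ?_⟩
    · exact hskip _ _ hft hct (fun hw => absurd hlt (hwk.1 hw)) (by omega)
    · have hd := hfree.1 (by omega)
      have hwk := hwk.2 hlt
      have hut : t.var rU = u := by rw [hf.1 _ (by simp), hu1]
      have hvt : t.var rV = v := by rw [hf.1 _ (by simp), hv1]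
      have huS : u ∉ S := fun hu => hd u (NatGraph.self_mem_ball u)
        (NatGraph.subset_cover hu (NatGraph.self_mem_ball u))
      have hunct : ∀ c < D, mat D (t.arr aM) u c ≠ v + 1 := by
        intro c hc e
        rw [hct.rows u (hd u (NatGraph.self_mem_ball u)) c hc] at e
        exact hunc ⟨c, hc, e⟩
      -- The new closed neighborhood is disjoint from the cover, so costs are additive and no vertex
      -- is charged twice.
      have hcost : g.cost (g.cover (insert u S)) = g.cost (g.ball u) + g.cost (g.cover S) := by
        rw [NatGraph.cover_insert, NatGraph.cost, Finset.sum_union]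
        · rfl
        · exact Finset.disjoint_left.2 hd
      have hcostb : g.cost (g.ball u) = (g.N u).card + 1 + g.cost (g.N u) := by
        rw [NatGraph.ball, NatGraph.cost, Finset.sum_insert (g.irrefl u)]; rfl
      have hhit : g.WeakAt u v → ∃ p ∈ g.ball u, p ∈ g.cover (insert u S) := fun _ =>
        ⟨u, NatGraph.self_mem_ball u,
          NatGraph.subset_cover (Finset.mem_insert_self _ _) (NatGraph.self_mem_ball u)⟩
      simp only [wp_seq]
      refine wp_markNbrs hW hbt hgt (by rwa [hut]) ?_ ?_ ?_
      · rw [hf.1 _ (by simp), hS1, hut, hf.2 _ (by simp), hf1.2 _ (by simp)]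
      · rw [hf.1 _ (by simp), hG1, hut]
      rw [hut]
      intro s2 σ2 hf2 hmk2 hσ2
      have hb2 := hbt.frame hf2 (by simp)
      have hM2 : s2.arr aM = t.arr aM := hf2.2 _ (by simp)
      have hP2 : s2.arr aPred = t.arr aPred := hf2.2 _ (by simp)
      refine wp_buildFan (g := g) (u := u) (v := v) hW hb2 (by rw [hf2.1 _ (by simp), hut])
        (by rw [hf2.1 _ (by simp), hvt]) (by rw [hM2]; exact hct.col) huv (by rwa [hM2]) hwk
        (by rw [hP2]; exact hct.fresh u huS) ?_
      intro s3 s4 σ4 hf3 hα3 hdone hσ4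
      have hf23 : Frame [rJ, rW, rC, rLim, rQ, rT, rAl, rP, rX, rGo] [aMark] t s3 :=
        ((Frame.refl t).trans hf2 (by simp) (by simp)).trans hf3 (by simp) (by simp)
      have hf24 : Frame [rJ, rW, rC, rLim, rQ, rT, rAl, rP, rX, rGo, rY, rH]
          [aMark, aPred, aKey] t s4 :=
        ((Frame.refl t).trans hf23 (by simp) (by simp)).trans hdone.frame (by simp) (by simp)
      have hfs4 : Frame [rT, rJ, rS, rG, rW, rQ, rAcc, rCnt, rAl, rC, rP, rGo, rX, rY, rF,
          rBn, rBc, rBa, rBb, rCl, rLim, rH]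
          [aM, aMark, aPred, aKey, aFu, aFv, aFx, aFy, aFc, aCount] s s4 :=
        ((Frame.refl s).trans hft (by simp) (by simp)).trans hf24 (by simp) (by simp)
      have hb4 := hbt.frame hf24 (by simp)
      have hg4 := hgt.frame hf24 (by simp)
      have hu4 : s4.var rU = u := by rw [hf24.1 _ (by simp), hut]
      have hv4 : s4.var rV = v := by rw [hf24.1 _ (by simp), hvt]
      have hM3 : s3.arr aM = t.arr aM := hf23.2 _ (by simp)
      have hM4 : s4.arr aM = t.arr aM := hf24.2 _ (by simp)
      have hbuilt : FanBuilt g u t s4 := by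
        refine ⟨hb4, hg4, ?_, ?_, ?_⟩
        · intro a
          rw [hdone.frame.2 _ (by simp), hf3.2 _ (by simp), hmk2]
        · intro a ha c hc
          rw [hdone.pred a ha c hc, hf3.2 _ (by simp), hP2]
        · intro a ha
          rw [hdone.key a ha, hf3.2 _ (by simp), hf2.2 _ (by simp)]
      simp only [wp_ifLt, hb4.one]
      have hres := hdone.result
      rw [hM3] at hres
      have hSn : (insert u S).card ≤ n := by
        calc _ ≤ (Finset.range n).card := Finset.card_le_card <|
              (Finset.insert_subset (NatGraph.mem_active huv).2 hct.active).trans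
                (Finset.filter_subset _ _)
          _ = n := Finset.card_range n
      rw [Finset.card_insert_of_notMem huS] at hSn
      have hcardS := hct.card
      refine ⟨fun hgo => ?_, fun hgo => ?_⟩
      · rcases hres with ⟨h1, -⟩ | ⟨-, T, r, hfan⟩
        · omega
        have hAl : s4.var rAl = s3.var rAl := hdone.frame.1 _ (by simp)
        rw [← hAl] at hfan hα3
        have hF4 : s4.var rF = t.var rF := hf24.1 _ (by simp)
        have hC4 : s4.arr aCount = t.arr aCount := hf24.2 _ (by simp)
        refine wp_recordFan hW hb4 hα3 hfan.ltβ (by omega) rfl ?_ ?_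
        · rw [hC4]
          rw [hct.count]
          calc _ ≤ (Finset.range (t.var rF)).card := Finset.card_filter_le _ _
            _ ≤ n := by rw [Finset.card_range]; omega
        intro s5 σ5 hf5 eF e9 e10 e11 e12 e13 e14 hbest hσ5
        have hb5 := hb4.frame hf5 (by simp)
        refine post s5 σ5 (insert u S) R (hfs4.trans hf5 (by simp) (by simp)) ?_
          (Finset.subset_insert _ _) hhit (by omega)
        have k9 : s4.arr aFu = t.arr aFu := hf24.2 _ (by simp)
        have k10 : s4.arr aFv = t.arr aFv := hf24.2 _ (by simp)
        have k11 : s4.arr aFx = t.arr aFx := hf24.2 _ (by simp)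
        have k12 : s4.arr aFy = t.arr aFy := hf24.2 _ (by simp)
        have k13 : s4.arr aFc = t.arr aFc := hf24.2 _ (by simp)
        have kBn : s4.var rBn = t.var rBn := hf24.1 _ (by simp)
        have kBc : s4.var rBc = t.var rBc := hf24.1 _ (by simp)
        have kBa : s4.var rBa = t.var rBa := hf24.1 _ (by simp)
        have kBb : s4.var rBb = t.var rBb := hf24.1 _ (by simp)
        rw [hF4] at eF e9 e10 e11 e12 e13
        rw [k9, hu4] at e9
        rw [k10, hv4] at e10
        rw [k11] at e11
        rw [k12] at e12
        rw [k13] at e13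
        rw [hC4] at e14 hbest
        rw [kBn, kBc, kBa, kBb] at hbest
        refine hct.insert_stored huv hd hunc ⟨hb5, hg4.frame hf5 (by simp), ?_, ?_, ?_⟩ ?_ ?_ eF e9
          e10 e11 e12 e13 e14 hbest (T := T) (r := r)
        · intro a; rw [hf5.2 _ (by simp), hbuilt.mark]
        · rw [hf5.2 aPred (by simp)]; exact hbuilt.pred
        · rw [hf5.2 aKey (by simp)]; exact hbuilt.key
        · rw [hf5.2 _ (by simp), hM4]
        · rw [hf5.2 aPred (by simp), hf5.2 aKey (by simp)]; exact hfan
      · rcases hres with ⟨-, T, r, hsh⟩ | ⟨h1, -⟩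
        swap
        · omega
        rw [← hM4] at hsh
        refine wp_shiftFan hW hb4 hu4 hv4 hsh ?_
        intro s5 σ5 hf5 hsd hσ5
        have hb5 := hb4.frame hf5 (by simp)
        refine post s5 σ5 (insert u S) (insert u R) (hfs4.trans hf5 (by simp) (by simp)) ?_
          (Finset.subset_insert _ _) hhit (by omega)
        have hf25 : Frame [rJ, rW, rC, rLim, rQ, rT, rAl, rP, rX, rGo, rY, rH]
          [aMark, aPred, aKey, aM] t s5 :=
          ((Frame.refl t).trans hf24 (by simp) (by simp)).trans hf5 (by simp) (by simp)
        refine hct.insert_shifted huv hd hunc ⟨hb5, hg4.frame hf5 (by simp), ?_, ?_, ?_⟩ ?_ ?_ ?_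
        · intro a; rw [hf5.2 _ (by simp), hbuilt.mark]
        · rw [hf5.2 aPred (by simp)]; exact hbuilt.pred
        · rw [hf5.2 aKey (by simp)]; exact hbuilt.key
        · rw [hM4] at hsd; exact hsd
        · intro x hx
          refine hf25.1 x ?_
          simp at hx ⊢; omega
        · intro a ha
          refine hf25.2 a ?_
          simp at ha ⊢; omega
    · refine hskip _ _ hft hct (fun _ => ?_) (by omega)
      by_contra! hcon
      exact h0 (by rw [hfree.2 hcon]; omega)
  have hd1 : s1.arr aDeg v = (g.N v).card := hg1.deg v hvn
  simp only [wp_load, wp_arith, wp_mov, eval_add, var_setVar, Nat.reduceEqDiff,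
    reduceIte, hv1, hd1, hb1.D, hb1.zero, add_zero]
  refine ⟨hW.sq (by nlinarith), hW.small (by omega), ?_⟩
  rw [wp_ifLt]
  simp only [wp_skip, wp_arith, eval_add, var_setVar, Nat.reduceEqDiff, reduceIte, hb1.one, hb1.D]
  refine ⟨fun hlt => hgen _ _ ?_ (by omega) ?_,
    fun hlt => ⟨hW.small (by omega), hgen _ _ ?_ (by omega) ?_⟩⟩
  · simp (maxDischargeDepth := 20) [Frame.setVar, Frame.refl]
  · rw [hweak, if_pos hlt]; simp
  · simp (maxDischargeDepth := 20) [Frame.setVar, Frame.refl]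
  · rw [hweak, if_neg hlt]; simp

/-- The edges with the indices below `i` in the list are treated. -/
def Treated (g : NatGraph n D) (s : State) (i : ℕ) (S : Finset ℕ) : Prop :=
  ∀ j < i, (g.WeakAt (s.arr aEu j) (s.arr aEv j) → ∃ p ∈ g.ball (s.arr aEu j), p ∈ g.cover S) ∧
    (g.WeakAt (s.arr aEv j) (s.arr aEu j) → ∃ p ∈ g.ball (s.arr aEv j), p ∈ g.cover S)

theorem NatGraph.cover_mono {S S' : Finset ℕ} (h : S ⊆ S') : g.cover S ⊆ g.cover S' :=
  Finset.biUnion_subset_biUnion_of_subset_left _ h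

theorem Treated.mono {s : State} {i : ℕ} {S S' : Finset ℕ} (h : Treated g s i S) (hS : S ⊆ S') :
    Treated g s i S' := fun j hj =>
  ⟨fun hw => let ⟨p, hp, hp'⟩ := (h j hj).1 hw; ⟨p, hp, NatGraph.cover_mono hS hp'⟩,
    fun hw => let ⟨p, hp, hp'⟩ := (h j hj).2 hw; ⟨p, hp, NatGraph.cover_mono hS hp'⟩⟩

theorem wp_collectFans (hW : WordSize n D W) (hD : s.var rD = D) (hg : HasGraph g s)
    (hm : g.Col (mat D (s.arr aM))) (hx : ∀ x, 4 ≤ x → s.var x = 0)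
    (ha : ∀ a, 6 ≤ a → ∀ i, s.arr a i = 0) (hE : s.var rE ≤ n * n)
    (hedge : ∀ i < s.var rE, s.arr aEv i ∈ g.N (s.arr aEu i) ∧
      ¬ Colored D (mat D (s.arr aM)) (s.arr aEu i) (s.arr aEv i) ∧
      ¬ Colored D (mat D (s.arr aM)) (s.arr aEv i) (s.arr aEu i))
    (post : ∀ s' τ' S R, Collected g (mat D (s.arr aM)) s' S R → Treated g s (s.var rE) S →
      s'.arr aTouch = s.arr aTouch →
      τ' ≤ τ + s.var rE * (400 * D + 2020) + 200 * g.cost (g.cover S) + 2 → Q s' τ') :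
    WP W Prog.collectFans Q s τ := by
  set m₀ := mat D (s.arr aM) with hm₀
  simp only [Prog.collectFans, wp_seq, wp_const]
  refine ⟨hW.small (by omega), ?_⟩
  refine wp_while (fun k t σ => ∃ S R, Frame [r1, rI, rA, rB, rU, rV, rT, rJ, rS, rG, rW, rQ, rAcc,
        rCnt, rAl, rC, rP, rGo, rX, rY, rF, rBn, rBc, rBa, rBb, rCl, rLim, rH]
        [aM, aMark, aPred, aKey, aFu, aFv, aFx, aFy, aFc, aCount] s t ∧
      k = s.var rE - t.var rI ∧ t.var rI ≤ s.var rE ∧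
      Collected g m₀ t S R ∧ Treated g s (t.var rI) S ∧
      σ ≤ τ + t.var rI * (400 * D + 2020) + 200 * g.cost (g.cover S) + 1) ?_ ?_ (s.var rE) ?_
  · rintro k t σ ⟨S, R, hf, rfl, hi, hc, htr, hσ⟩ hlt
    have hEt : t.var rE = s.var rE := hf.1 _ (by simp)
    have hEu : t.arr aEu = s.arr aEu := hf.2 _ (by simp)
    have hEv : t.arr aEv = s.arr aEv := hf.2 _ (by simp)
    rw [hEt] at hlt
    obtain ⟨hN, hu1, hu2⟩ := hedge _ hlt
    have han : s.arr aEu (t.var rI) < n := g.lt' hN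
    have hbn : s.arr aEv (t.var rI) < n := g.lt hN
    simp only [wp_seq, wp_load, wp_mov, var_setVar, arr_setVar, Nat.reduceEqDiff, reduceIte, hc.base.zero,
      hEu, hEv, add_zero]
    refine ⟨hW.small (by omega), hW.small (by omega), ?_⟩
    refine wp_tryEdge (m₀ := m₀) (S := S) (R := R) (u := s.arr aEu (t.var rI))
      (v := s.arr aEv (t.var rI)) hW ?_ (by simp) (by simp) hN hu1 ?_
    · exact hc.frame (X := [rA, rB, rU, rV]) (A := [])
        (by simp (maxDischargeDepth := 20) [Frame.setVar, Frame.refl]) (by simp) (by simp)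
    intro t1 σ1 S1 R1 hf1 hc1 hS1 hw1 hσ1
    have e0 : t1.var r0 = 0 := hc1.base.zero
    have eA : t1.var rA = s.arr aEu (t.var rI) := by rw [hf1.1 _ (by simp)]; simp
    have eB : t1.var rB = s.arr aEv (t.var rI) := by rw [hf1.1 _ (by simp)]; simp
    simp only [wp_mov, var_setVar, Nat.reduceEqDiff, reduceIte, e0, eA, eB, add_zero]
    refine ⟨hW.small (by omega), hW.small (by omega), ?_⟩
    refine wp_tryEdge (m₀ := m₀) (S := S1) (R := R1) (u := s.arr aEv (t.var rI))
      (v := s.arr aEu (t.var rI)) hW ?_ (by simp) (by simp) (g.symm hN) hu2 ?_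
    · exact hc1.frame (X := [rU, rV]) (A := [])
        (by simp (maxDischargeDepth := 20) [Frame.setVar, Frame.refl]) (by simp) (by simp)
    intro t2 σ2 S2 R2 hf2 hc2 hS2 hw2 hσ2
    have eI : t2.var rI = t.var rI := by
      rw [hf2.1 _ (by simp)]; simp only [var_setVar, Nat.reduceEqDiff, reduceIte]
      rw [hf1.1 _ (by simp)]; simp
    simp only [wp_arith, eval_add, eI, hc2.base.one]
    refine ⟨hW.sq (by omega), _, ?_, S2, R2, ?_, rfl, ?_, ?_, ?_, ?_⟩
    · simp only [var_setVar, reduceIte]; omega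
    · have h1 : Frame [r1, rI, rA, rB, rU, rV, rT, rJ, rS, rG, rW, rQ, rAcc,
        rCnt, rAl, rC, rP, rGo, rX, rY, rF, rBn, rBc, rBa, rBb, rCl, rLim, rH]
        [aM, aMark, aPred, aKey, aFu, aFv, aFx, aFy, aFc, aCount] s t1 :=
        Frame.trans (by simp (maxDischargeDepth := 20) [Frame.setVar, hf]) hf1 (by simp) (by simp)
      have h2 := Frame.trans (s := s) (X := [r1, rI, rA, rB, rU, rV, rT, rJ, rS, rG, rW, rQ, rAcc,
        rCnt, rAl, rC, rP, rGo, rX, rY, rF, rBn, rBc, rBa, rBb, rCl, rLim, rH])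
        (A := [aM, aMark, aPred, aKey, aFu, aFv, aFx, aFy, aFc, aCount])
        (by simp (maxDischargeDepth := 20) [Frame.setVar, h1]) hf2 (by simp) (by simp)
      exact h2.setVar (by simp)
    · simp only [var_setVar, reduceIte]; omega
    · exact hc2.frame (X := [rI]) (A := [])
        (by simp (maxDischargeDepth := 20) [Frame.setVar, Frame.refl]) (by simp) (by simp)
    · simp only [var_setVar, reduceIte]
      intro j hj
      rcases Nat.lt_succ_iff_lt_or_eq.1 hj with hj | rfl
      · exact htr.mono (hS1.trans hS2) j hj
      · refine ⟨fun hw => ?_, hw2⟩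
        obtain ⟨p, hp, hp'⟩ := hw1 hw
        exact ⟨p, hp, NatGraph.cover_mono hS2 hp'⟩
    · simp only [var_setVar, reduceIte, add_mul]
      omega
  · rintro k t σ ⟨S, R, hf, rfl, hi, hc, htr, hσ⟩ hlt
    rw [hf.1 rE (by simp)] at hlt
    have hI : t.var rI = s.var rE := by omega
    rw [hI] at htr hσ
    exact post t _ S R hc htr (hf.2 _ (by simp)) (by omega)
  -- Zeroed memory encodes the empty collection: no marks, claims, fans or counts.
  · have e : ∀ x, 4 ≤ x → x ≠ 5 → (s.setVar r1 1).var x = 0 := by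
      intro x h h'; simp [h', hx x h]
    have hf : Frame [r1] [] s (s.setVar r1 1) := (Frame.refl s).setVar (by simp)
    refine ⟨∅, ∅, (Frame.refl s).trans hf (by simp) (by simp), ?_, ?_, ?_, ?_, ?_⟩
    · rw [e rI (by simp) (by simp)]; rfl
    · rw [e rI (by simp) (by simp)]; omega
    · have hF := e rF (by simp) (by simp)
      have hBn := e rBn (by simp) (by simp)
      have hBc := e rBc (by simp) (by simp)
      have hBa := e rBa (by simp) (by simp)
      have hBb := e rBb (by simp) (by simp)
      refine ⟨⟨by simpa using hD, by simp, e _ (by simp) (by simp)⟩, hg.frame hf (by simp), hm, ?_,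
        ?_, ?_, ?_, ?_, ?_, ?_, ?_, ?_, ?_, ?_, ?_, ?_, ?_, ?_, ?_, ?_⟩
      · exact fun _ _ _ h => h
      · intro a; simp [NatGraph.cover, ha]
      · simp
      · simp
      · intro a _ c _; rfl
      · intro u _ c _; exact ha _ (by simp) _
      · simp
      · simp
      · rw [hF]; simp
      · rw [hF]; intro f hf; omega
      · rw [hF]; intro f hf; omega
      · rw [hF]; intro f hf; omega
      · intro c; rw [hF]; simp [ha]
      · intro c; rw [hBn]; simp [ha]
      · rw [hBn]; omega
      · rw [hBc, hBa, hBb]; simp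
      · rw [hBa, hBb]; exact fun h => ⟨h, h⟩
    · rw [e rI (by simp) (by simp)]; intro j hj; omega
    · omega

end Subprograms

/-! ### The second pass -/

theorem ShiftInv.congr {pc K : ℕ → ℕ} {u v t c α β : ℕ} {T : Finset ℕ} {r : ℕ → ℕ} {X : Set ℕ}
    (h : ShiftInv g m m pc K u v T r t c X α β) (hm : ∀ a, ∀ b < D, m' a b = m a b) :
    ShiftInv g m' m' pc K u v T r t c X α β := by
  refine ⟨h.col.congr fun a _ => hm a, h.tree, ?_, h.target, h.lt, ?_, ?_, ?_,
    fun _ _ _ h => h, fun _ _ _ _ => rfl, ?_, fun _ _ _ _ _ _ => rfl, h.center, h.target_mem,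
    h.parent_mem⟩
  · intro w hw hr
    have hk := h.tree.key_lt w hw
    obtain ⟨h1, h2⟩ := h.live w hw hr
    exact ⟨by rw [hm _ _ hk, h1], fun p hp => by rw [hm _ _ hk, h2 p hp]⟩
  · rw [hm _ _ h.lt, h.free]
  · rw [hm _ _ h.lt, h.free']
  · intro c hc; rw [hm _ _ hc]; exact h.uncolored c hc
  · intro a ha e he hee w hw
    rw [hm _ _ he] at hw
    exact h.closed a ha e he hee w hw

/-- The state `t` after some of the stored fans of the best pair of colors have been treated,
starting from `s`.  The touched vertices are those in `X`, among them the ends in `Z` of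
alternating paths, and the fans with centers in `P` have been shifted. -/
structure Recolored (g : NatGraph n D) (s t : State) (X Z P : Finset ℕ) : Prop where
  frame : Frame [rI, rU, rV, rX, rY, rQ, rH, rZ, rC, rAl, rGo, rT] [aM, aTouch] s t
  col : g.Col (mat D (t.arr aM))
  colored : ∀ a < n, ∀ b, Colored D (mat D (s.arr aM)) a b → Colored D (mat D (t.arr aM)) a b
  touch : ∀ a, t.arr aTouch a = if a ∈ X then 1 else 0
  active : X ⊆ g.active
  closed : Closed (mat D (t.arr aM)) (s.var rBa) (s.var rBb) X
  outside : ∀ a < n, a ∉ X → ∀ e < D, e = s.var rBa ∨ e = s.var rBb →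
    mat D (t.arr aM) a e = mat D (s.arr aM) a e
  card_ends : Z.card ≤ 4 * P.card
  mem_ends : ∀ a ∈ X, mat D (s.arr aM) a (s.var rBa) = 0 ∨ mat D (s.arr aM) a (s.var rBb) = 0 →
    a ∈ Z
  fan : ∀ f < s.var rF, s.arr aFc f = s.var rBc → s.arr aFu f ∉ X → s.arr aFx f ∉ X →
    s.arr aFy f ∉ X → ∃ T r, ValidFan g (mat D (t.arr aM)) (mat D (s.arr aPred) (s.arr aFu f))
      (s.arr aKey) (s.arr aFu f) (s.arr aFv f) (s.arr aFx f) (s.arr aFy f) (s.var rBa) (s.var rBb)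
      T r
  done : ∀ u ∈ P, ∃ f < s.var rF, s.arr aFu f = u ∧ s.arr aFv f ∈ g.N u ∧
    Colored D (mat D (t.arr aM)) u (s.arr aFv f)
  done_sub : P ⊆ X

/-- The class number $\alpha D + \beta$ with $\beta < D$ determines the pair by division with
remainder. -/
theorem Collected.best_fan {m₀ : ℕ → ℕ → ℕ} {s : State} {S R : Finset ℕ}
    (h : Collected g m₀ s S R) {f : ℕ} (hf : f < s.var rF) (hc : s.arr aFc f = s.var rBc) :
    ∃ T r, ValidFan g (mat D (s.arr aM)) (mat D (s.arr aPred) (s.arr aFu f)) (s.arr aKey)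
      (s.arr aFu f) (s.arr aFv f) (s.arr aFx f) (s.arr aFy f) (s.var rBa) (s.var rBb) T r := by
  obtain ⟨α, β, T, r, h1, h2⟩ := h.fan f hf
  have hα := h2.ltα
  obtain ⟨ha, hb⟩ := h.best_lt (by omega)
  rw [hc, h.best_eq] at h1
  have hβ := h2.ltβ
  have e1 : s.var rBb = β := by
    have := congrArg (· % D) h1
    simpa [Nat.mul_add_mod', Nat.mod_eq_of_lt hb, Nat.mod_eq_of_lt hβ] using this
  have e2 : s.var rBa = α := by
    rw [e1] at h1
    exact Nat.eq_of_mul_eq_mul_right (by omega) (Nat.add_right_cancel h1)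
  rw [e1, e2]
  exact ⟨T, r, h2⟩

section Subprograms

variable {W : ℕ} {Q : State → ℕ → Prop} {s t : State} {τ : ℕ}

-- `U` is the path from the center, touched but not exchanged, and `V` the exchanged path from `x`
-- or `y`. Both avoid `X` and each other, so the touched set grows by $|U| + |V|$, which pays for
-- the walks. Touching `U` as well keeps the touched set closed when the shift recolors edges at the
-- center.
set_option maxHeartbeats 800000 in
theorem wp_colorFan {m₀ : ℕ → ℕ → ℕ} {S R X Z P : Finset ℕ} {f : ℕ} (hW : WordSize n D W)
    (hs : Collected g m₀ s S R) (h : Recolored g s t X Z P) (hf : f < s.var rF)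
    (hcls : s.arr aFc f = s.var rBc) (hu : t.var rU = s.arr aFu f) (hv : t.var rV = s.arr aFv f)
    (hx : t.var rX = s.arr aFx f) (hy : t.var rY = s.arr aFy f)
    (huX : s.arr aFu f ∉ X) (hxX : s.arr aFx f ∉ X) (hyX : s.arr aFy f ∉ X)
    (post : ∀ t' τ' X' Z' P', Recolored g s t' X' Z' P' → t'.var rI = t.var rI → X ⊆ X' →
      s.arr aFu f ∈ X' → τ' + 40 * X.card ≤ τ + 40 * D + 200 + 40 * X'.card → Q t' τ') :
    WP W Prog.colorFan Q t τ := by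
  have hDn := hW.deg_le
  obtain ⟨T, r, hfan⟩ := h.fan f hf hcls huX hxX hyX
  set u := s.arr aFu f with hud
  set v := s.arr aFv f with hvd
  set x := s.arr aFx f with hxd
  set y := s.arr aFy f with hyd
  set α := s.var rBa with hαd
  set β := s.var rBb with hβd
  set M := mat D (t.arr aM) with hMd
  have hαD := hfan.ltα
  have hβD := hfan.ltβ
  have hb := hs.base.frame h.frame (by simp)
  have hxN : x ∈ g.N u := hfan.tree.mem_nbr hfan.left
  have hyN : y ∈ g.N u := hfan.tree.mem_nbr hfan.right
  have hun : u < n := g.lt' hxN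
  have hxn : x < n := g.lt hxN
  have hyn : y < n := g.lt hyN
  have hBa : t.var rBa = α := h.frame.1 _ (by simp)
  have hBb : t.var rBb = β := h.frame.1 _ (by simp)
  simp only [Prog.colorFan, wp_seq, wp_mov, var_setVar, Nat.reduceEqDiff, reduceIte, hb.zero, hu,
    hBa, hBb, add_zero]
  refine ⟨hW.small (by omega), hW.small (by omega), hW.small (by omega), ?_⟩
  have hf0 : Frame [rI, rU, rV, rX, rY, rQ, rH, rZ, rC, rAl, rGo, rT] [] t
      (((t.setVar rZ u).setVar rC β).setVar rAl α) := by
    simp (maxDischargeDepth := 20) [Frame.setVar, Frame.refl]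
  refine wp_walk (g := g) false hW (hb.frame hf0 (by simp)) h.col ?_ ?_ ?_ ?_ ?_ ?_
  · simpa using (NatGraph.mem_active hxN).2
  · simpa using hβD
  · simpa using hαD
  · simpa using hfan.color_ne.symm
  · simpa using hfan.freeα
  simp only [var_setVar, arr_setVar, Nat.reduceEqDiff, reduceIte, ← hMd]
  intro t1 σ1 U hf1 huU hzU hUa hUc hUe hUd hUt hUm hσ1
  simp only [Bool.false_eq_true, reduceIte] at hUm
  have hUX : Disjoint U X := hUd X h.closed.symm huX
  have hf01 : Frame [rI, rU, rV, rX, rY, rQ, rH, rZ, rC, rAl, rGo, rT] [aM, aTouch] t t1 :=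
    ((Frame.refl t).trans hf0 (by simp) (by simp)).trans hf1 (by simp) (by simp)
  have hb1 := hb.frame hf01 (by simp)
  have hx1 : t1.var rX = x := by rw [hf1.1 _ (by simp)]; simpa using hx
  have hy1 : t1.var rY = y := by rw [hf1.1 _ (by simp)]; simpa using hy
  have hu1 : t1.var rU = u := by rw [hf1.1 _ (by simp)]; simpa using hu
  have hv1 : t1.var rV = v := by rw [hf1.1 _ (by simp)]; simpa using hv
  have hI1 : t1.var rI = t.var rI := by rw [hf1.1 _ (by simp)]; simp
  have hBa1 : t1.var rBa = α := by rw [hf01.1 _ (by simp), hBa]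
  have hBb1 : t1.var rBb = β := by rw [hf01.1 _ (by simp), hBb]
  -- A neighbor of the center on its path at which `β` is free can only be the other end.
  have hmem : ∀ w, w ∈ g.N u → w ∈ U → M w β = 0 → w = t1.var rZ := by
    intro w hw hwU hw0
    refine (hUe w hwU (Or.inl hw0)).resolve_left ?_
    rintro rfl
    exact g.irrefl _ hw
  -- The remainder of the program for either choice `w` of the start of the shift.
  have hrest : ∀ t2 σ2 w, Frame [rX] [] t1 t2 → t2.var rX = w →
      (w = y ∧ y ∉ U ∨ w = x ∧ x ∉ U ∧ y ∈ U) → σ2 ≤ σ1 + 10 →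
      WP W (Prog.mov rZ rX) (WP W (Prog.mov rC rBa) (WP W (Prog.mov rAl rBb)
        (WP W (Prog.walk true) (WP W (Prog.mov rC rBa) (WP W Prog.shiftFan Q))))) t2 σ2 := by
    intro t2 σ2 w hf2 hX2 hw hσ2
    have hb2 := hb1.frame hf2 (by simp)
    have hBa2 : t2.var rBa = α := by rw [hf2.1 _ (by simp), hBa1]
    have hBb2 : t2.var rBb = β := by rw [hf2.1 _ (by simp), hBb1]
    have hM2 : ∀ a, ∀ b < D, mat D (t2.arr aM) a b = M a b := by
      rw [hf2.2 _ (by simp)]; exact hUm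
    have hwN : w ∈ g.N u := by rcases hw with ⟨rfl, -⟩ | ⟨rfl, -⟩ <;> assumption
    have hwn : w < n := g.lt hwN
    have hw0 : M w β = 0 := by
      rcases hw with ⟨rfl, -⟩ | ⟨rfl, -⟩
      · exact hfan.free_right
      · exact hfan.free_left
    have hwU : w ∉ U := by
      rcases hw with ⟨rfl, h⟩ | ⟨rfl, h, -⟩ <;> exact h
    have hwX : w ∉ X := by rcases hw with ⟨rfl, -⟩ | ⟨rfl, -⟩ <;> assumption
    simp only [wp_mov, var_setVar, Nat.reduceEqDiff, reduceIte, hb2.zero, hX2, hBa2, hBb2, add_zero]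
    refine ⟨hW.small (by omega), hW.small (by omega), hW.small (by omega), ?_⟩
    have hf23 : Frame [rI, rX, rQ, rH, rZ, rC, rAl, rGo, rT] [] t2
        (((t2.setVar rZ w).setVar rC α).setVar rAl β) := by
      simp (maxDischargeDepth := 20) [Frame.setVar, Frame.refl]
    have hcol2 : g.Col (mat D (t2.arr aM)) := h.col.congr fun a _ => hM2 a
    refine wp_walk (g := g) true hW (hb2.frame hf23 (by simp)) hcol2 ?_ ?_ ?_ ?_ ?_ ?_
    · simpa using (NatGraph.mem_active hwN).1
    · simpa using hαD
    · simpa using hβD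
    · simpa using hfan.color_ne
    · simpa [hM2 _ _ hβD] using hw0
    simp only [var_setVar, arr_setVar, Nat.reduceEqDiff, reduceIte]
    intro t3 σ3 V hf3 hwV hzV hVa hVc hVe hVd hVt hVm hσ3
    have hCl : ∀ Y, Closed (mat D (t2.arr aM)) α β Y ↔ Closed M α β Y := by
      intro Y
      refine forall₂_congr fun a _ => forall₂_congr fun c hc => ?_
      rw [hM2 a c (by rcases hc with rfl | rfl <;> assumption)]
    rw [hCl] at hVc
    simp only [hCl] at hVd
    simp only [hM2 _ _ hαD, hM2 _ _ hβD] at hVe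
    have hVX : Disjoint V X := hVd X h.closed hwX
    have hVU : Disjoint V U := hVd U hUc.symm hwU
    have huV : u ∉ V := fun h' => Finset.disjoint_left.1 hVU h' huU
    set Y := X ∪ U ∪ V with hYd
    have hYc : Closed M α β Y := (h.closed.union hUc.symm).union hVc
    have hXY : X ⊆ Y := fun a ha => by simp [hYd, ha]
    have hUY : U ⊆ Y := fun a ha => by simp [hYd, ha]
    have hVY : V ⊆ Y := fun a ha => by simp [hYd, ha]
    have hcard : Y.card = X.card + U.card + V.card := by
      rw [hYd, Finset.card_union_of_disjoint, Finset.card_union_of_disjoint hUX.symm]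
      exact Finset.disjoint_union_left.2 ⟨hVX.symm, hVU.symm⟩
    have hM3 : ∀ a, ∀ b < D, mat D (t3.arr aM) a b = flipAt α β V M a b := by
      intro a b hb
      rw [hVm a b hb]
      simp only [flipAt]
      rw [hM2 _ _ hb, hM2 _ _ (swap_lt hαD hβD hb)]
    have hinv := hfan.shiftInv (X := Y) h.col hVc huV hwV ?_ hYc (hUY huU) (hVY hwV)
    -- In the case `w = x` the vertex `y` is on the path `U`, so it is not exchanged and belongs to
    -- the touched set, as the shift requires.
    swap
    · rcases hw with ⟨h1, -⟩ | ⟨h1, -, h2⟩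
      · exact Or.inl h1
      · exact Or.inr ⟨h1, fun h' => Finset.disjoint_left.1 hVU h' h2, hUY h2⟩
    replace hinv := hinv.congr hM3
    have hf13 : Frame [rI, rU, rV, rX, rY, rQ, rH, rZ, rC, rAl, rGo, rT] [aM, aTouch] t1 t3 :=
      (((Frame.refl t1).trans hf2 (by simp) (by simp)).trans hf23 (by simp) (by simp)).trans hf3
        (by simp) (by simp)
    have hb3 := hb1.frame hf13 (by simp)
    have hBa3 : t3.var rBa = α := by rw [hf13.1 _ (by simp), hBa1]
    have hX3 : t3.var rX = w := by rw [hf3.1 _ (by simp)]; simpa using hX2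
    have hu3 : t3.var rU = u := by
      rw [hf3.1 _ (by simp), hf23.1 _ (by simp), hf2.1 _ (by simp), hu1]
    have hv3 : t3.var rV = v := by
      rw [hf3.1 _ (by simp), hf23.1 _ (by simp), hf2.1 _ (by simp), hv1]
    have hI3 : t3.var rI = t.var rI := by
      rw [hf3.1 _ (by simp), var_setVar, if_neg (by simp), var_setVar, if_neg (by simp),
        var_setVar, if_neg (by simp), hf2.1 _ (by simp), hI1]
    have hfs3 : Frame [rI, rU, rV, rX, rY, rQ, rH, rZ, rC, rAl, rGo, rT] [aM, aTouch] s t3 :=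
      (h.frame.trans hf01 (by simp) (by simp)).trans hf13 (by simp) (by simp)
    have hP3 : t3.arr aPred = s.arr aPred := hfs3.2 _ (by simp)
    have hK3 : t3.arr aKey = s.arr aKey := hfs3.2 _ (by simp)
    simp only [wp_mov, hBa3, hb3.zero, add_zero]
    refine ⟨hW.small (by omega), ?_⟩
    refine wp_shiftFan (g := g) (u := u) (v := v) (α := α) (β := β) (T := T) (r := r)
      (X := (Y : Set ℕ)) hW
      (hb3.frame (X := [rC]) (A := []) ((Frame.refl _).setVar (by simp)) (by simp))
      (by simpa using hu3) (by simpa using hv3) ?_ ?_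
    · simpa only [arr_setVar, hP3, hK3, var_setVar, Nat.reduceEqDiff, reduceIte, hX3] using hinv
    simp only [arr_setVar]
    intro t4 σ4 hf4 hsh hσ4
    have huP : u ∉ P := fun h' => huX (h.done_sub h')
    -- The new ends are those of the two paths: four for one more center in `P`.
    refine post t4 σ4 Y (Z ∪ {u, t1.var rZ, w, t3.var rZ}) (insert u P) ?_ ?_ hXY (hUY huU) ?_
    · have hfs4 : Frame [rI, rU, rV, rX, rY, rQ, rH, rZ, rC, rAl, rGo, rT] [aM, aTouch] s t4 :=
        (hfs3.setVar (x := rC) (by simp)).trans hf4 (by simp) (by simp)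
      have hmono : ∀ a < n, ∀ b, Colored D M a b → Colored D (mat D (t4.arr aM)) a b := by
        intro a ha b hab
        refine hsh.colored a ha b ?_
        obtain ⟨c, hc, e⟩ := hab.flipAt (S := V) hαD hβD
        exact ⟨c, hc, by rw [hM3 a c hc, e]⟩
      refine ⟨hfs4, hsh.col, ?_, ?_, ?_, ?_, ?_, ?_, ?_, ?_, ?_, ?_⟩
      · exact fun a ha b hab => hmono a ha b (h.colored a ha b hab)
      · intro a
        rw [hf4.2 _ (by simp), arr_setVar, hVt, hf2.2 _ (by simp), hUt, h.touch]
        simp only [hYd, Finset.mem_union]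
        by_cases h1 : a ∈ V <;> by_cases h2 : a ∈ U <;> simp [h1, h2]
      · exact Finset.union_subset (Finset.union_subset h.active hUa) hVa
      · intro a ha c hc b hab
        exact hsh.closed a ha c (by rcases hc with rfl | rfl <;> assumption) hc b hab
      · intro a ha haY e he hee
        rw [hsh.outside a ha haY e he hee, hM3 a e he,
          flipAt_of_notMem fun h' => haY (hVY h')]
        exact h.outside a ha (fun h' => haY (hXY h')) e he hee
      · rw [Finset.card_insert_of_notMem huP]
        have h1 := Finset.card_union_le Z {u, t1.var rZ, w, t3.var rZ}
        have h2 : ({u, t1.var rZ, w, t3.var rZ} : Finset ℕ).card ≤ 4 := Finset.card_le_four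
        have := h.card_ends
        omega
      · intro a ha ha0
        by_cases haX : a ∈ X
        · exact Finset.mem_union_left _ (h.mem_ends a haX ha0)
        · have han : a < n := by
            simp only [hYd, Finset.mem_union] at ha
            rcases ha with (ha | ha) | ha
            · exact absurd ha haX
            · exact NatGraph.active_lt (hUa ha)
            · exact NatGraph.active_lt (hVa ha)
          -- Outside `X` the colors `α` and `β` are still as they were in `s`, so ends found in the
          -- current coloring are ends for the coloring at the start of the pass.
          rw [← h.outside a han haX α hαD (Or.inl rfl),
            ← h.outside a han haX β hβD (Or.inr rfl)] at ha0
          refine Finset.mem_union_right _ ?_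
          simp only [hYd, Finset.mem_union] at ha
          simp only [Finset.mem_insert, Finset.mem_singleton]
          rcases ha with (ha | ha) | ha
          · exact absurd ha haX
          · rcases hUe a ha ha0.symm with h1 | h1 <;> simp [h1]
          · rcases hVe a ha ha0 with h1 | h1 <;> simp [h1]
      · intro f' hf' hcls' hu' hx' hy'
        obtain ⟨T', r', hfan'⟩ := h.fan f' hf' hcls' (fun h' => hu' (hXY h'))
          (fun h' => hx' (hXY h')) (fun h' => hy' (hXY h'))
        -- Another untouched fan survives both operations: the exchange misses its `u`, `x` and `y`,
        -- and the shift stays within a disjoint closed neighborhood.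
        refine ⟨T', r', (hfan'.flipAt (S := V) (fun h' => hu' (hVY h')) (fun h' => hx' (hVY h'))
          (fun h' => hy' (hVY h'))).congr fun a ha c hc => ?_⟩
        rw [← hM3 a c hc]
        refine hsh.rows a ?_ c hc
        refine Finset.disjoint_left.1 (hs.disjoint _ (hs.center f' hf').1 _ (hs.center f hf).1 ?_) ha
        intro e
        exact hu' (e ▸ hUY huU)
      · intro a ha
        rcases Finset.mem_insert.1 ha with rfl | ha
        · exact ⟨f, hf, rfl, hfan.tree.root, hsh.new⟩
        · obtain ⟨f', hf', h1, h2, h3⟩ := h.done a ha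
          exact ⟨f', hf', h1, h2, hmono a (g.lt' h2) _ h3⟩
      · exact Finset.insert_subset (hUY huU) (h.done_sub.trans hXY)
    · rw [hf4.1 _ (by simp)]; simpa using hI3
    · omega
  rw [wp_ifEq, wp_skip, hy1]
  refine ⟨fun hz => ?_, fun hz => ?_⟩
  -- The path ends at `y`. If `x` were on it, it would be the same end, contrary to `x ≠ y`.
  · refine hrest _ _ x (Frame.refl _) hx1 (Or.inr ⟨rfl, fun hxU => ?_, ?_⟩) (by omega)
    · exact hfan.ne ((hmem x hxN hxU hfan.free_left).trans hz)
    · exact hz ▸ hzU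
  · rw [wp_mov, hy1, hb1.zero, add_zero]
    refine ⟨hW.small (by omega), ?_⟩
    refine hrest _ _ y ((Frame.refl _).setVar (by simp)) (by simp)
      (Or.inl ⟨rfl, fun hyU => ?_⟩) (by omega)
    exact hz (hmem y hyN hyU hfan.free_right).symm

theorem wp_colorFans {m₀ : ℕ → ℕ → ℕ} {S R : Finset ℕ} (hW : WordSize n D W)
    (hs : Collected g m₀ s S R) (ht : ∀ a, s.arr aTouch a = 0)
    (post : ∀ s' τ' X Z P, Recolored g s s' X Z P →
      (∀ f < s.var rF, s.arr aFc f = s.var rBc →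
        s.arr aFu f ∈ X ∨ s.arr aFx f ∈ X ∨ s.arr aFy f ∈ X) →
      τ' ≤ τ + s.var rF * (40 * D + 230) + 40 * X.card + 10 → Q s' τ') :
    WP W Prog.colorFans Q s τ := by
  have hDn := hW.deg_le
  have hFn : s.var rF ≤ n := by
    have h1 := hs.card
    have h2 : S.card ≤ n := by
      calc _ ≤ (Finset.range n).card :=
            Finset.card_le_card (hs.active.trans (Finset.filter_subset _ _))
        _ = n := Finset.card_range n
    omega
  simp only [Prog.colorFans, wp_seq, wp_const]
  refine ⟨hW.small (by omega), ?_⟩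
  refine wp_while (fun k t σ => ∃ X Z P, Recolored g s t X Z P ∧ k = s.var rF - t.var rI ∧
    t.var rI ≤ s.var rF ∧ (∀ f < t.var rI, s.arr aFc f = s.var rBc →
        s.arr aFu f ∈ X ∨ s.arr aFx f ∈ X ∨ s.arr aFy f ∈ X) ∧
      σ ≤ τ + t.var rI * (40 * D + 230) + 40 * X.card + 9) ?_ ?_ (s.var rF) ?_
  · rintro k t σ ⟨X, Z, P, h, rfl, hi, htouch, hσ⟩ hlt
    have hb := hs.base.frame h.frame (by simp)
    have hFt : t.var rF = s.var rF := h.frame.1 _ (by simp)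
    have hBc : t.var rBc = s.var rBc := h.frame.1 _ (by simp)
    have e9 : t.arr aFu = s.arr aFu := h.frame.2 _ (by simp)
    have e10 : t.arr aFv = s.arr aFv := h.frame.2 _ (by simp)
    have e11 : t.arr aFx = s.arr aFx := h.frame.2 _ (by simp)
    have e12 : t.arr aFy = s.arr aFy := h.frame.2 _ (by simp)
    have e13 : t.arr aFc = s.arr aFc := h.frame.2 _ (by simp)
    rw [hFt] at hlt
    have hframe : ∀ t', Frame [rI, rU, rV, rX, rY, rQ, rH] [] t t' → Recolored g s t' X Z P := by
      intro t' hf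
      refine ⟨h.frame.trans hf (by simp) (by simp), ?_, ?_, ?_, h.active, ?_, ?_, h.card_ends,
        h.mem_ends, ?_, ?_, h.done_sub⟩
      all_goals
        first
        | rw [hf.2 aM (by simp)]
        | rw [hf.2 aTouch (by simp)]
      · exact h.col
      · exact h.colored
      · exact h.touch
      · exact h.closed
      · exact h.outside
      · exact h.fan
      · exact h.done
    -- The end of the loop body is abstracted to `Q'`, with the one fact `hnext` that serves
    -- treated, skipped and foreign fans alike.
    obtain ⟨Q', hQ', hnext⟩ : ∃ Q', Q' = WP W (.arith .add rI rI r1)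
        (fun s' τ' => ∃ k' < s.var rF - t.var rI, ∃ X Z P,
          Recolored g s s' X Z P ∧ k' = s.var rF - s'.var rI ∧
          s'.var rI ≤ s.var rF ∧ (∀ f < s'.var rI, s.arr aFc f = s.var rBc →
            s.arr aFu f ∈ X ∨ s.arr aFx f ∈ X ∨ s.arr aFy f ∈ X) ∧
          τ' + 1 ≤ τ + s'.var rI * (40 * D + 230) + 40 * X.card + 9) ∧
        ∀ t' σ' X' Z' P', Recolored g s t' X' Z' P' → t'.var rI = t.var rI → X ⊆ X' →
        (s.arr aFc (t.var rI) = s.var rBc → s.arr aFu (t.var rI) ∈ X' ∨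
          s.arr aFx (t.var rI) ∈ X' ∨ s.arr aFy (t.var rI) ∈ X') →
        σ' + 40 * X.card ≤ σ + 40 * D + 228 + 40 * X'.card → Q' t' σ' := by
      refine ⟨_, rfl, ?_⟩
      intro t' σ' X' Z' P' h' hI' hXX' hnew hσ'
      have hb' := hs.base.frame h'.frame (by simp)
      simp only [wp_arith, eval_add, hI', hb'.one]
      refine ⟨hW.small (by omega), _, ?_, X', Z', P', ?_, rfl, ?_, ?_, ?_⟩
      · simp only [var_setVar, reduceIte]; omega
      · obtain ⟨k1, k2, k3, k4, k5, k6, k7, k8, k9, k10, k11, k12⟩ := h'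
        exact ⟨k1.setVar (by simp), k2, k3, k4, k5, k6, k7, k8, k9, k10, k11, k12⟩
      · simp only [var_setVar, reduceIte]; omega
      · simp only [var_setVar, reduceIte]
        intro f hf hc
        rcases Nat.lt_succ_iff_lt_or_eq.1 hf with hf | rfl
        · rcases htouch f hf hc with h1 | h1 | h1
          · exact Or.inl (hXX' h1)
          · exact Or.inr (Or.inl (hXX' h1))
          · exact Or.inr (Or.inr (hXX' h1))
        · exact hnew hc
      · simp only [var_setVar, reduceIte, add_mul]; omega
    rw [wp_seq, wp_seq, ← hQ']
    simp only [wp_load, wp_ifEq, wp_skip, var_setVar, Nat.reduceEqDiff, reduceIte, e13, hBc]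
    refine ⟨fun hc => ?_, fun hc => ?_⟩
    swap
    · refine hnext _ _ X Z P (hframe _ ?_) (by simp) subset_rfl (fun h' => absurd h' hc) (by omega)
      simp (maxDischargeDepth := 20) [Frame.setVar, Frame.refl]
    have htle : ∀ a, t.arr aTouch a ≤ 1 := by
      intro a; rw [h.touch]; split_ifs <;> simp
    have hu1 := htle (s.arr aFu (t.var rI))
    have hx1 := htle (s.arr aFx (t.var rI))
    have hy1 := htle (s.arr aFy (t.var rI))
    have h2W : 3 < W := hW.small (by omega)
    simp only [Prog.colorStep, wp_seq, wp_load, wp_arith, wp_ifLt, wp_skip, eval_add, var_setVar,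
      arr_setVar, Nat.reduceEqDiff, reduceIte, e9, e10, e11, e12, hb.one]
    refine ⟨by omega, by omega, fun hq => ?_, fun hq => ?_⟩
    · have hnot : ∀ a, t.arr aTouch a = 0 → a ∉ X := by
        intro a ha haX
        rw [h.touch, if_pos haX] at ha
        omega
      refine wp_colorFan (f := t.var rI) hW hs (hframe _ ?_) hlt hc (by simp) (by simp) (by simp)
        (by simp) (hnot _ (by omega)) (hnot _ (by omega)) (hnot _ (by omega)) ?_
      · simp (maxDischargeDepth := 20) [Frame.setVar, Frame.refl]
      intro t' σ' X' Z' P' h' hI' hXX' hu' hσ'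
      refine hnext t' σ' X' Z' P' h' ?_ hXX' (fun _ => Or.inl hu') (by omega)
      rw [hI']; simp
    · refine hnext _ _ X Z P (hframe _ ?_) (by simp) subset_rfl (fun _ => ?_) (by omega)
      · simp (maxDischargeDepth := 20) [Frame.setVar, Frame.refl]
      · by_contra! hcon
        rw [h.touch, h.touch, h.touch, if_neg hcon.1, if_neg hcon.2.1, if_neg hcon.2.2] at hq
        omega
  · rintro k t σ ⟨X, Z, P, h, rfl, hi, htouch, hσ⟩ hlt
    rw [h.frame.1 rF (by simp)] at hlt
    have hI : t.var rI = s.var rF := by omega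
    rw [hI] at htouch hσ
    exact post t _ X Z P h htouch (by omega)
  · refine ⟨∅, ∅, ∅, ⟨(Frame.refl s).setVar (by simp), hs.col, fun _ _ _ h => h, by simpa using ht,
      by simp, ?_, fun _ _ _ _ _ _ => rfl, by simp, by simp, ?_, by simp, by simp⟩, ?_, ?_, ?_, ?_⟩
    · intro a ha; simp at ha
    · exact fun f hf hc _ _ _ => hs.best_fan hf hc
    · simp
    · simp
    · simp
    · simp

end Subprograms

/-! ### Counting and conclusion -/

/-- The edges with an end in a closed neighborhood that meets one of the fans with centers
in `S`. -/
def NatGraph.near (g : NatGraph n D) (S : Finset ℕ) : Finset (Sym2 ℕ) :=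
  S.biUnion fun u => (g.ball u).biUnion fun p => (g.ball p).biUnion fun w =>
    (g.N w).image fun v => s(w, v)

theorem NatGraph.card_near_le (S : Finset ℕ) :
    (g.near S).card ≤ S.card * ((D + 1) * ((D + 1) * D)) := by
  have hball : ∀ v, (g.ball v).card ≤ D + 1 := fun v =>
    (Finset.card_insert_le _ _).trans (Nat.add_le_add_right (g.deg_le v) 1)
  refine Finset.card_biUnion_le_card_mul _ _ _ fun u _ => ?_
  refine (Finset.card_biUnion_le_card_mul _ _ ((D + 1) * D) fun p _ => ?_).trans
    (Nat.mul_le_mul_right _ (hball u))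
  exact (Finset.card_biUnion_le_card_mul _ _ D fun w _ =>
    Finset.card_image_le.trans (g.deg_le w)).trans (Nat.mul_le_mul_right _ (hball p))

theorem NatGraph.mem_near {S : Finset ℕ} {w v p : ℕ} (hv : v ∈ g.N w) (hp : p ∈ g.ball w)
    (hS : p ∈ g.cover S) : s(w, v) ∈ g.near S := by
  obtain ⟨u, hu, hpu⟩ := Finset.mem_biUnion.1 hS
  have hw : w ∈ g.ball p := by
    rcases Finset.mem_insert.1 hp with rfl | hp
    · exact NatGraph.self_mem_ball _
    · exact Finset.mem_insert_of_mem (g.symm hp)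
  exact Finset.mem_biUnion.2 ⟨u, hu, Finset.mem_biUnion.2 ⟨p, hpu, Finset.mem_biUnion.2
    ⟨w, hw, Finset.mem_image.2 ⟨v, hv, rfl⟩⟩⟩⟩

theorem NatGraph.cover_subset_active {S : Finset ℕ} (hS : S ⊆ g.active) :
    g.cover S ⊆ g.active := by
  refine Finset.biUnion_subset.2 fun u hu => Finset.insert_subset (hS hu) fun w hw => ?_
  exact (NatGraph.mem_active hw).1

theorem NatGraph.card_le_cost (S : Finset ℕ) : S.card ≤ g.cost S := by
  rw [NatGraph.cost, Finset.card_eq_sum_ones]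
  exact Finset.sum_le_sum fun _ _ => Nat.le_add_left _ _

section Counting

variable {m₀ : ℕ → ℕ → ℕ} {s t : State} {S R X Z P : Finset ℕ}

/-- Each fan of the class has a touched vertex among `u`, `x`, `y`. As `α` was free at `u`, and `β`
at `x` and `y`, that vertex is one of the ends in `Z`; disjoint closed neighborhoods make the choice
injective. -/
theorem Collected.card_class_le (h : Collected g m₀ s S R) (hr : Recolored g s t X Z P)
    (ht : ∀ f < s.var rF, s.arr aFc f = s.var rBc →
      s.arr aFu f ∈ X ∨ s.arr aFx f ∈ X ∨ s.arr aFy f ∈ X) :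
    s.arr aCount (s.var rBc) ≤ 4 * P.card := by
  refine le_trans ?_ hr.card_ends
  rw [h.count]
  have key : ∀ f, f < s.var rF ∧ s.arr aFc f = s.var rBc → ∃ p ∈ Z, p ∈ g.ball (s.arr aFu f) := by
    rintro f ⟨hf, hc⟩
    obtain ⟨T, r, hfan⟩ := h.best_fan hf hc
    rcases ht f hf hc with hX | hX | hX
    · exact ⟨_, hr.mem_ends _ hX (Or.inl hfan.freeα), NatGraph.self_mem_ball _⟩
    · exact ⟨_, hr.mem_ends _ hX (Or.inr hfan.free_left),
        Finset.mem_insert_of_mem (hfan.tree.mem_nbr hfan.left)⟩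
    · exact ⟨_, hr.mem_ends _ hX (Or.inr hfan.free_right),
        Finset.mem_insert_of_mem (hfan.tree.mem_nbr hfan.right)⟩
  choose! p hp using key
  refine Finset.card_le_card_of_injOn p (fun f hf => ?_) fun f hf f' hf' e => ?_
  · rw [Finset.mem_coe, Finset.mem_filter, Finset.mem_range] at hf
    exact (hp f hf).1
  · rw [Finset.mem_coe, Finset.mem_filter, Finset.mem_range] at hf hf'
    by_contra hne
    refine Finset.disjoint_left.1 (h.disjoint _ (h.center f hf.1).1 _ (h.center f' hf'.1).1
      fun e => hne (h.inj f hf.1 f' hf'.1 e)) (hp f hf).2 ?_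
    rw [e]; exact (hp f' hf').2

/-- Pigeonhole over the ordered pairs of distinct colors, of which there are $D^2 - D$. -/
theorem Collected.card_stored_le (h : Collected g m₀ s S R) :
    s.var rF ≤ s.arr aCount (s.var rBc) * (D * D - D) := by
  have h1 := Finset.card_le_mul_card_image (f := s.arr aFc) (Finset.range (s.var rF))
    (s.arr aCount (s.var rBc)) fun c _ => by
      rw [← h.count]; exact (h.count_le c).trans h.best
  rw [Finset.card_range] at h1
  refine h1.trans (Nat.mul_le_mul_left _ ?_)
  calc _ ≤ ((Finset.range D).offDiag.image fun q => q.1 * D + q.2).card := by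
        refine Finset.card_le_card fun c hc => ?_
        obtain ⟨f, hf, rfl⟩ := Finset.mem_image.1 hc
        obtain ⟨α, β, T, r, h1, h2⟩ := h.fan f (Finset.mem_range.1 hf)
        refine Finset.mem_image.2 ⟨(α, β), ?_, h1.symm⟩
        rw [Finset.mem_offDiag]
        exact ⟨Finset.mem_range.2 h2.ltα, Finset.mem_range.2 h2.ltβ, h2.color_ne⟩
    _ ≤ _ := by
        refine Finset.card_image_le.trans ?_
        rw [Finset.offDiag_card, Finset.card_range]

/-- Used for the running time only: distinct fans have distinct uncolored edges, since an edge
shared by two centers would join their closed neighborhoods. -/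
theorem Collected.card_stored_le_edges (h : Collected g m₀ s S R) {E : ℕ} {e : ℕ → Sym2 ℕ}
    (he : ∀ u, ∀ v ∈ g.N u, ¬ Colored D m₀ u v → ∃ i < E, s(u, v) = e i) : s.var rF ≤ E := by
  have hN : ∀ f < s.var rF, s.arr aFv f ∈ g.N (s.arr aFu f) := fun f hf => by
    obtain ⟨α, β, T, r, -, h2⟩ := h.fan f hf
    exact h2.tree.root
  calc s.var rF = (Finset.range (s.var rF)).card := (Finset.card_range _).symm
    _ ≤ ((Finset.range E).image e).card := by
        refine Finset.card_le_card_of_injOn (fun f => s(s.arr aFu f, s.arr aFv f))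
          (fun f hf => ?_) fun f hf f' hf' hff => ?_
        · have hf := Finset.mem_range.1 (Finset.mem_coe.1 hf)
          obtain ⟨i, hi, hie⟩ := he _ _ (hN f hf) (h.center f hf).2.2
          exact Finset.mem_image.2 ⟨i, Finset.mem_range.2 hi, hie.symm⟩
        · have hf := Finset.mem_range.1 (Finset.mem_coe.1 hf)
          have hf' := Finset.mem_range.1 (Finset.mem_coe.1 hf')
          have hff : s(s.arr aFu f, s.arr aFv f) = s(s.arr aFu f', s.arr aFv f') := hff
          refine h.inj f hf f' hf' ?_
          by_contra hne
          refine Finset.disjoint_left.1 (h.disjoint _ (h.center f hf).1 _ (h.center f' hf').1 hne)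
            (NatGraph.self_mem_ball _) ?_
          rcases Sym2.eq_iff.1 hff with h1 | h1
          · exact absurd h1.1 hne
          · rw [h1.1]; exact Finset.mem_insert_of_mem (hN f' hf')
    _ ≤ E := Finset.card_image_le.trans (Finset.card_range E).le

/-- Reduces to $(D+1)^2D \le 9D^5$ and $4(D^2-D)(D+1)^2D \le 9D^5$ for $D \ge 1$. Writing `D + 1`
for `D` removes the truncated difference. -/
theorem card_bound {r d k D : ℕ} (hk : k ≤ r + 4 * d * (D * D - D)) (hD : 0 < D) :
    k * ((D + 1) * ((D + 1) * D)) ≤ 9 * D ^ 5 * (r + d) := by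
  obtain ⟨D, rfl⟩ : ∃ D', D = D' + 1 := ⟨D - 1, by omega⟩
  have e : (D + 1) * (D + 1) - (D + 1) = D * (D + 1) := by
    rw [add_mul, one_mul, Nat.add_sub_cancel]
  rw [e] at hk
  refine (Nat.mul_le_mul_right _ hk).trans ?_
  have h1 : (D + 1 + 1) * ((D + 1 + 1) * (D + 1)) ≤ 9 * (D + 1) ^ 5 := by
    ring_nf; nlinarith [Nat.zero_le D, Nat.zero_le (D ^ 2), Nat.zero_le (D ^ 3),
      Nat.zero_le (D ^ 4), Nat.zero_le (D ^ 5)]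
  have h2 : 4 * (D * (D + 1)) * ((D + 1 + 1) * ((D + 1 + 1) * (D + 1))) ≤ 9 * (D + 1) ^ 5 := by
    ring_nf; nlinarith [Nat.zero_le D, Nat.zero_le (D ^ 2), Nat.zero_le (D ^ 3),
      Nat.zero_le (D ^ 4), Nat.zero_le (D ^ 5)]
  nlinarith [Nat.mul_le_mul_left r h1, Nat.mul_le_mul_left d h2]

end Counting

/-- The witnesses are the centers `R ∪ P` of all shifted fans and the set `g.near S`. That centers
are pairwise nonadjacent is recorded because it makes the newly colored edges of different centers
distinct. -/
theorem wp_main {W : ℕ} {Q : State → ℕ → Prop} {s : State} {τ : ℕ} (hW : WordSize n D W)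
    (hD : s.var rD = D) (hg : HasGraph g s)
    (hm : g.Col (mat D (s.arr aM))) (hx : ∀ x, 4 ≤ x → s.var x = 0)
    (ha : ∀ a, 6 ≤ a → ∀ i, s.arr a i = 0) (hE : s.var rE ≤ n * n)
    (hedge : ∀ i < s.var rE, s.arr aEv i ∈ g.N (s.arr aEu i) ∧
      ¬ Colored D (mat D (s.arr aM)) (s.arr aEu i) (s.arr aEv i) ∧
      ¬ Colored D (mat D (s.arr aM)) (s.arr aEv i) (s.arr aEu i))
    (hweak : ∀ i < s.var rE, g.WeakAt (s.arr aEu i) (s.arr aEv i) ∨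
      g.WeakAt (s.arr aEv i) (s.arr aEu i))
    (hall : ∀ u, ∀ v ∈ g.N u, ¬ Colored D (mat D (s.arr aM)) u v →
      ∃ i < s.var rE, s(u, v) = s(s.arr aEu i, s.arr aEv i))
    (post : ∀ s' τ' P N, g.Col (mat D (s'.arr aM)) →
      (∀ a < n, ∀ b, Colored D (mat D (s.arr aM)) a b → Colored D (mat D (s'.arr aM)) a b) →
      (∀ u ∈ P, ∃ v ∈ g.N u, ¬ Colored D (mat D (s.arr aM)) u v ∧
        Colored D (mat D (s'.arr aM)) u v) →
      (∀ u ∈ P, ∀ u' ∈ P, u' ∉ g.N u) →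
      (∀ i < s.var rE, s(s.arr aEu i, s.arr aEv i) ∈ N) →
      Finset.card N ≤ 9 * D ^ 5 * Finset.card P →
      τ' ≤ τ + s.var rE * (440 * D + 2250) + 240 * g.cost g.active + 20 → Q s' τ') :
    WP W Prog.main Q s τ := by
  rw [Prog.main, wp_seq]
  refine wp_collectFans hW hD hg hm hx ha hE hedge ?_
  intro s1 σ1 S R hc htr htouch hσ1
  refine wp_colorFans hW hc (fun a => by rw [htouch, ha _ (by simp)]) ?_
  intro s2 σ2 X Z P hr hX hσ2
  have hdis : Disjoint R P := by
    refine Finset.disjoint_left.2 fun u hR hP => ?_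
    obtain ⟨f, hf, rfl, -⟩ := hr.done u hP
    exact (hc.center f hf).2.1 hR
  have hsub : R ∪ P ⊆ S := by
    refine Finset.union_subset hc.shifted_sub fun u hu => ?_
    obtain ⟨f, hf, rfl, -⟩ := hr.done u hu
    exact (hc.center f hf).1
  refine post s2 σ2 (R ∪ P) (g.near S) hr.col
    (fun a ha b h => hr.colored a ha b (hc.colored a ha b h)) ?_ ?_ ?_ ?_ ?_
  · intro u hu
    rcases Finset.mem_union.1 hu with hu | hu
    · obtain ⟨v, hv, h1, h2⟩ := hc.shifted u hu
      exact ⟨v, hv, h1, hr.colored u (g.lt' hv) v h2⟩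
    · obtain ⟨f, hf, rfl, h1, h2⟩ := hr.done u hu
      exact ⟨_, h1, (hc.center f hf).2.2, h2⟩
  · intro u hu u' hu' hN
    have hne : u ≠ u' := by rintro rfl; exact g.irrefl _ hN
    exact Finset.disjoint_left.1 (hc.disjoint u (hsub hu) u' (hsub hu') hne)
      (Finset.mem_insert_of_mem hN) (NatGraph.self_mem_ball _)
  · intro i hi
    have hN := (hedge i hi).1
    rcases hweak i hi with h | h
    · obtain ⟨p, hp, hp'⟩ := (htr i hi).1 h
      exact NatGraph.mem_near hN hp hp'
    · obtain ⟨p, hp, hp'⟩ := (htr i hi).2 h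
      rw [Sym2.eq_swap]
      exact NatGraph.mem_near (g.symm hN) hp hp'
  · refine (NatGraph.card_near_le S).trans ?_
    rcases Nat.eq_zero_or_pos D with rfl | hD0
    · simp
    rw [Finset.card_union_of_disjoint hdis]
    refine card_bound ?_ hD0
    rw [hc.card]
    exact Nat.add_le_add_left (hc.card_stored_le.trans
      (Nat.mul_le_mul_right _ (hc.card_class_le hr hX))) _
  · have h1 := hc.card_stored_le_edges hall
    have h2 : g.cost (g.cover S) ≤ g.cost g.active :=
      Finset.sum_le_sum_of_subset (NatGraph.cover_subset_active hc.active)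
    have h3 : X.card ≤ g.cost g.active :=
      (Finset.card_le_card hr.active).trans (NatGraph.card_le_cost _)
    have h4 := Nat.mul_le_mul_right (40 * D + 230) h1
    -- The number of fans is at most $|E_w|$, so the costs per fan of the second pass are merged
    -- with those per edge of the first.
    have e : s.var rE * (440 * D + 2250) =
        s.var rE * (400 * D + 2020) + s.var rE * (40 * D + 230) := by ring
    omega

/-! ### Translation between `SimpleGraph` on `Fin n` and graphs and matrices on natural numbers -/

section Bridge

theorem EdgeColoringRAM.EncodesColoring.mat_eq_iff {G : SimpleGraph (Fin n)} {π : PartialEdgeColoring G D} {M : ℕ → ℕ}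
    (h : EncodesColoring π M) {v : Fin n} {c : Fin D} {w : ℕ} :
    mat D M v c = w + 1 ↔ ∃ hw : w < n, π.color s(v, ⟨w, hw⟩) = some c := by
  obtain ⟨h1, h2⟩ := h v c
  constructor
  · intro e
    by_contra! hcon
    by_cases hex : ∃ x, π.color s(v, x) = some c
    · obtain ⟨x, hx⟩ := hex
      have h3 : (x : ℕ) + 1 = w + 1 := (h1 x hx).symm.trans e
      obtain rfl : (x : ℕ) = w := by omega
      exact hcon x.2 hx
    · rw [mat, h2 fun x hx => hex ⟨x, hx⟩] at e
      omega
  · rintro ⟨hw, e⟩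
    exact h1 ⟨w, hw⟩ e

theorem EdgeColoringRAM.PartialEdgeColoring.mem_colored {G : SimpleGraph (Fin n)} {π : PartialEdgeColoring G D} {e : Sym2 (Fin n)} :
    e ∈ π.colored ↔ ∃ c, π.color e = some c := by
  rw [PartialEdgeColoring.colored, Finset.mem_filter, ← Option.ne_none_iff_exists']
  simp

theorem EdgeColoringRAM.EncodesColoring.colored_iff {G : SimpleGraph (Fin n)} {π : PartialEdgeColoring G D} {M : ℕ → ℕ}
    (h : EncodesColoring π M) {v w : Fin n} : Colored D (mat D M) v w ↔ s(v, w) ∈ π.colored := by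
  rw [PartialEdgeColoring.mem_colored]
  constructor
  · rintro ⟨c, hc, e⟩
    obtain ⟨_, e⟩ := (h.mat_eq_iff (c := ⟨c, hc⟩)).1 e
    exact ⟨_, e⟩
  · rintro ⟨c, e⟩
    exact ⟨c, c.2, h.mat_eq_iff.2 ⟨w.2, e⟩⟩

variable (G : SimpleGraph (Fin n)) [DecidableRel G.Adj]

/-- The graph `G` as a graph on natural numbers. -/
def natGraph : NatGraph n G.maxDegree where
  N v := if h : v < n then (G.neighborFinset ⟨v, h⟩).map Fin.valEmbedding else ∅
  lt {v w} h := by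
    split_ifs at h with hv
    · obtain ⟨x, -, rfl⟩ := Finset.mem_map.1 h; exact x.2
    · simp at h
  symm {v w} h := by
    split_ifs at h with hv
    · obtain ⟨x, hx, rfl⟩ := Finset.mem_map.1 h
      rw [Fin.valEmbedding_apply, dif_pos x.2]
      refine Finset.mem_map.2 ⟨⟨v, hv⟩, ?_, rfl⟩
      rw [SimpleGraph.mem_neighborFinset] at hx ⊢
      exact hx.symm
    · simp at h
  irrefl v h := by
    split_ifs at h with hv
    · obtain ⟨x, hx, e⟩ := Finset.mem_map.1 h
      rw [SimpleGraph.mem_neighborFinset] at hx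
      exact hx.ne (Fin.ext e.symm)
    · simp at h
  deg_le v := by
    split_ifs with hv
    · rw [Finset.card_map]; exact G.degree_le_maxDegree _
    · simp

variable {G}

theorem natGraph_N (v : Fin n) : (natGraph G).N v = (G.neighborFinset v).map Fin.valEmbedding :=
  dif_pos v.2

theorem card_natGraph_N (v : Fin n) : ((natGraph G).N v).card = G.degree v := by
  rw [natGraph_N, Finset.card_map]; rfl

theorem mem_natGraph_N {v w : Fin n} : (w : ℕ) ∈ (natGraph G).N v ↔ G.Adj v w := by
  rw [natGraph_N, ← SimpleGraph.mem_neighborFinset]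
  exact Finset.mem_map' Fin.valEmbedding

/-- Since `D` is the maximum degree, "degree `D`" is the same as "degree not less than `D`", which
is what the program tests. -/
theorem EdgeColoringRAM.IsWeakAt.natGraph {u v : Fin n} (h : IsWeakAt G G.maxDegree u v) :
    (_root_.natGraph G).WeakAt u v := by
  have hv := G.degree_le_maxDegree v
  have e : (((_root_.natGraph G).N u).filter
      fun w => ¬ ((_root_.natGraph G).N w).card < G.maxDegree).card =
      degCount G G.maxDegree u := by
    rw [natGraph_N, Finset.filter_map, Finset.card_map, degCount]
    congr 1
    refine Finset.filter_congr fun w _ => ?_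
    have := G.degree_le_maxDegree w
    rw [Function.comp_apply, Fin.valEmbedding_apply, card_natGraph_N]
    omega
  rw [NatGraph.WeakAt, e, card_natGraph_N]
  rw [IsWeakAt] at h
  split_ifs at h ⊢ <;> omega

/-- At a vertex with a neighbor, $d + 1 \le 2d$. Leaving out isolated vertices keeps $n$ out of the
time bound. -/
theorem cost_natGraph_le : (natGraph G).cost (natGraph G).active ≤ 4 * G.edgeFinset.card := by
  have h1 : ∀ v ∈ (natGraph G).active, ((natGraph G).N v).card + 1 ≤
      2 * ((natGraph G).N v).card := by
    intro v hv
    have := Finset.card_pos.2 (Finset.mem_filter.1 hv).2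
    omega
  calc _ ≤ ∑ v ∈ (natGraph G).active, 2 * ((natGraph G).N v).card := Finset.sum_le_sum h1
    _ ≤ ∑ v ∈ Finset.range n, 2 * ((natGraph G).N v).card :=
        Finset.sum_le_sum_of_subset (Finset.filter_subset _ _)
    _ = ∑ v : Fin n, 2 * G.degree v := by
        rw [Finset.sum_range]
        exact Finset.sum_congr rfl fun v _ => by rw [card_natGraph_N]
    _ = 4 * G.edgeFinset.card := by
        rw [← Finset.mul_sum, G.sum_degrees_eq_twice_card_edges]; ring

theorem EdgeColoringRAM.EncodesColoring.col {π : PartialEdgeColoring G G.maxDegree} {M : ℕ → ℕ}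
    (h : EncodesColoring π M) : (natGraph G).Col (mat G.maxDegree M) := by
  refine ⟨fun v hv c hc w e => ?_, fun v hv c hc w e => ?_, fun v hv c hc c' hc' w e e' => ?_⟩
  · obtain ⟨hw, e⟩ := (h.mat_eq_iff (v := ⟨v, hv⟩) (c := ⟨c, hc⟩)).1 e
    refine (mem_natGraph_N (v := ⟨v, hv⟩) (w := ⟨w, hw⟩)).2 ?_
    by_contra hadj
    rw [π.color_eq_none _ hadj] at e
    cases e
  · obtain ⟨hw, e⟩ := (h.mat_eq_iff (v := ⟨v, hv⟩) (c := ⟨c, hc⟩)).1 e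
    rw [Sym2.eq_swap] at e
    exact (h.mat_eq_iff (v := ⟨w, hw⟩) (c := ⟨c, hc⟩)).2 ⟨hv, e⟩
  · obtain ⟨hw, e⟩ := (h.mat_eq_iff (v := ⟨v, hv⟩) (c := ⟨c, hc⟩)).1 e
    obtain ⟨_, e'⟩ := (h.mat_eq_iff (v := ⟨v, hv⟩) (c := ⟨c', hc'⟩)).1 e'
    rw [e] at e'
    exact congrArg Fin.val (Option.some.inj e')

/-- The color of a pair is read off at either end; `symm` and `inj` make the two readings agree. -/
theorem NatGraph.Col.exists_coloring {M : ℕ → ℕ} (hm : (natGraph G).Col (mat G.maxDegree M))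
    (h0 : ∀ v : Fin n, ∀ c < G.maxDegree, ∀ w, mat G.maxDegree M v c = w + 1 → w < n) :
    ∃ π : PartialEdgeColoring G G.maxDegree, EncodesColoring π M := by
  classical
  have huniq : ∀ (u v u' v' : Fin n) (c c' : Fin G.maxDegree), s(u, v) = s(u', v') →
      mat G.maxDegree M u c = v + 1 → mat G.maxDegree M u' c' = v' + 1 → c = c' := by
    intro u v u' v' c c' he e e'
    rcases Sym2.eq_iff.1 he with ⟨rfl, rfl⟩ | ⟨rfl, rfl⟩
    · exact Fin.ext (hm.inj u u.2 c c.2 c' c'.2 v e e')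
    · exact Fin.ext (hm.inj u u.2 c c.2 c' c'.2 v e (hm.symm v v.2 c' c'.2 u e'))
  let color : Sym2 (Fin n) → Option (Fin G.maxDegree) := fun e =>
    if h : ∃ c : Fin G.maxDegree, ∃ u v : Fin n, e = s(u, v) ∧ mat G.maxDegree M u c = v + 1
    then some h.choose else none
  have hcolor : ∀ (u v : Fin n) (c : Fin G.maxDegree),
      color s(u, v) = some c ↔ mat G.maxDegree M u c = v + 1 := by
    intro u v c
    simp only [color]
    constructor
    · intro h
      split_ifs at h with hex
      obtain ⟨u', v', he, e⟩ := hex.choose_spec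
      rw [Option.some.inj h] at e
      rcases Sym2.eq_iff.1 he with ⟨rfl, rfl⟩ | ⟨rfl, rfl⟩
      · exact e
      · exact hm.symm v v.2 c c.2 u e
    · intro h
      have hex : ∃ c : Fin G.maxDegree, ∃ u' v' : Fin n, s(u, v) = s(u', v') ∧
          mat G.maxDegree M u' c = v' + 1 := ⟨c, u, v, rfl, h⟩
      rw [dif_pos hex]
      obtain ⟨u', v', he, e⟩ := hex.choose_spec
      rw [huniq u v u' v' c _ he h e]
  refine ⟨⟨color, ?_, ?_⟩, ?_⟩
  · intro e he
    simp only [color]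
    rw [dif_neg]
    rintro ⟨c, u, v, rfl, h⟩
    exact he (mem_natGraph_N.1 (hm.adj u u.2 c c.2 v h))
  · intro u v w c hv hw
    rw [hcolor] at hv hw
    exact Fin.ext (by omega)
  · intro v c
    refine ⟨fun w hw => (hcolor v w c).1 hw, fun h => ?_⟩
    by_contra hne
    obtain ⟨w, hw⟩ := Nat.exists_eq_succ_of_ne_zero hne
    exact h ⟨w, h0 v c c.2 w hw⟩ ((hcolor v _ c).2 hw)

theorem card_edgeFinset_le_sq : G.edgeFinset.card ≤ n * n := by
  have h := G.card_edgeFinset_le_card_choose_two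
  rw [Fintype.card_fin, Nat.choose_two_right] at h
  exact h.trans ((Nat.div_le_self _ _).trans (Nat.mul_le_mul_left _ (Nat.sub_le _ _)))

/-- The input condition speaks only of entries that are vertices. Since a list of length $d(v)$
contains all $d(v)$ neighbors, there is no room for other entries. -/
theorem EdgeColoringRAM.IsInput.hasGraph {Ew : Finset (Sym2 (Fin n))} {π : PartialEdgeColoring G G.maxDegree}
    {s : State} (h : IsInput G Ew π s) : HasGraph (natGraph G) s := by
  have hn := card_edgeFinset_le_sq (G := G)
  refine ⟨fun v hv => ?_, fun v hv => ?_, fun v hv w => ?_⟩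
  · rw [card_natGraph_N ⟨v, hv⟩]; exact h.degree ⟨v, hv⟩
  · have := h.start_le ⟨v, hv⟩
    have e : ((natGraph G).N v).card = G.degree ⟨v, hv⟩ := card_natGraph_N ⟨v, hv⟩
    dsimp only at this
    omega
  · have e : ((natGraph G).N v).card = G.degree ⟨v, hv⟩ := card_natGraph_N ⟨v, hv⟩
    have hsub : (natGraph G).N v ⊆ (Finset.range (G.degree ⟨v, hv⟩)).image
        fun i => s.arr aAdj (s.arr aStart v + i) := by
      intro w hw
      obtain ⟨i, hi, e⟩ := (h.adjacent ⟨v, hv⟩ ⟨w, (natGraph G).lt hw⟩).1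
        (mem_natGraph_N (v := ⟨v, hv⟩) (w := ⟨w, (natGraph G).lt hw⟩).1 hw)
      exact Finset.mem_image.2 ⟨i, Finset.mem_range.2 hi, e⟩
    rw [e, Finset.eq_of_subset_of_card_le hsub
      (Finset.card_image_le.trans (by rw [Finset.card_range, e]))]
    simp

end Bridge

end Coloring

theorem mainTheorem6 :
    -- one program, with a time constant and a word size exponent that serve all inputs
    ∃ (p : Prog) (C k : ℕ),
      ∀ (n : ℕ) (G : SimpleGraph (Fin n)) [DecidableRel G.Adj]
        (Ew : Finset (Sym2 (Fin n))) (π : PartialEdgeColoring G G.maxDegree) (s : State),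
        (∀ e ∈ Ew, IsWeakEdge G G.maxDegree e) →
        π.colored = G.edgeFinset \ Ew →
        IsInput G Ew π s →
        ∃ (s' : State) (t : ℕ) (π' : PartialEdgeColoring G G.maxDegree),
          p.Runs ((n + 2) ^ k) s s' t ∧
          t ≤ C * (G.edgeFinset.card + Ew.card * G.maxDegree + 1) ∧
          EncodesColoring π' (s'.arr 3) ∧
          G.edgeFinset \ Ew ⊆ π'.colored ∧
          (Ew.card : ℝ) / (9 * (G.maxDegree : ℝ) ^ 5) ≤
            ((π'.colored \ (G.edgeFinset \ Ew)).card : ℝ) := by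
  -- The time is at most $|E_w|(440\Delta + 2250) + 240 \cdot 4|E| + 20$, and 3000 exceeds $440 +
  -- 2250$, $960$ and $20$. The exponent 4 ensures $4(n+1)^2 \le (n+2)^4$.
  refine ⟨Prog.main, 3000, 4, ?_⟩
  intro n G _ Ew π s hweak hcol hin
  have hDn : G.maxDegree ≤ n := by
    refine G.maxDegree_le_of_forall_degree_le _ fun v => ?_
    have := G.degree_lt_card_verts v
    rw [Fintype.card_fin] at this
    exact this.le
  have hW : WordSize n G.maxDegree ((n + 2) ^ 4) := by
    refine ⟨hDn, ?_⟩
    have e : (n + 2) ^ 4 = (n + 2) * (n + 2) * ((n + 2) * (n + 2)) := by ring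
    rw [e]
    exact Nat.mul_le_mul (by nlinarith) (Nat.mul_le_mul (by omega) (by omega))
  have hsub : ∀ e ∈ Ew, e ∈ G.edgeFinset := by
    intro e he
    obtain ⟨u, v, rfl, h, -⟩ := hweak e he
    exact SimpleGraph.mem_edgeFinset.2 h
  have hE : s.var rE = Ew.card := hin.weak
  set e : ℕ → Sym2 ℕ := fun i => s(s.arr aEu i, s.arr aEv i) with he
  -- every edge of `Ew` is in the list, so every entry of the list is an edge of `Ew`
  have himg : (Finset.range Ew.card).image e = Ew.image (Sym2.map Fin.val) := by
    refine (Finset.eq_of_subset_of_card_le ?_ ?_).symm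
    · intro q hq
      obtain ⟨q', hq', rfl⟩ := Finset.mem_image.1 hq
      induction q' with
      | _ u v =>
        obtain ⟨i, hi, h⟩ := (hin.weakList u v).1 hq'
        refine Finset.mem_image.2 ⟨i, Finset.mem_range.2 hi, ?_⟩
        simp only [he, Sym2.map_mk]
        rcases h with ⟨h1, h2⟩ | ⟨h1, h2⟩
        · rw [h1, h2]
        · rw [h1, h2, Sym2.eq_swap]
    · rw [Finset.card_image_of_injective _ (Sym2.map.injective Fin.val_injective)]
      exact Finset.card_image_le.trans (Finset.card_range _).le
  have hlist : ∀ i < s.var rE, ∃ u v : Fin n, s.arr aEu i = u ∧ s.arr aEv i = v ∧ s(u, v) ∈ Ew := by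
    intro i hi
    have h1 : e i ∈ Ew.image (Sym2.map Fin.val) := by
      rw [← himg]
      exact Finset.mem_image_of_mem _ (Finset.mem_range.2 (hE ▸ hi))
    obtain ⟨q, hq, h2⟩ := Finset.mem_image.1 h1
    induction q with
    | _ u v =>
      simp only [he, Sym2.map_mk] at h2
      rcases Sym2.eq_iff.1 h2 with ⟨h3, h4⟩ | ⟨h3, h4⟩
      · exact ⟨u, v, h3.symm, h4.symm, hq⟩
      · exact ⟨v, u, h4.symm, h3.symm, Sym2.eq_swap ▸ hq⟩
  have hunc : ∀ u v : Fin n, G.Adj u v →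
      (¬ Colored G.maxDegree (mat G.maxDegree (s.arr aM)) u v ↔ s(u, v) ∈ Ew) := by
    intro u v h
    rw [hin.coloring.colored_iff, hcol, Finset.mem_sdiff, SimpleGraph.mem_edgeFinset,
      SimpleGraph.mem_edgeSet]
    simp [h]
  have hadj : ∀ u v : Fin n, s(u, v) ∈ Ew → G.Adj u v := fun u v h =>
    SimpleGraph.mem_edgeFinset.1 (hsub _ h)
  obtain ⟨s', t, hrun, hQ⟩ : WP ((n + 2) ^ 4) Prog.main (fun s' t =>
      ∃ (P : Finset ℕ) (N : Finset (Sym2 ℕ)), (natGraph G).Col (mat G.maxDegree (s'.arr aM)) ∧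
      (∀ a < n, ∀ b, Colored G.maxDegree (mat G.maxDegree (s.arr aM)) a b →
        Colored G.maxDegree (mat G.maxDegree (s'.arr aM)) a b) ∧
      (∀ u ∈ P, ∃ v ∈ (natGraph G).N u, ¬ Colored G.maxDegree (mat G.maxDegree (s.arr aM)) u v ∧
        Colored G.maxDegree (mat G.maxDegree (s'.arr aM)) u v) ∧
      (∀ u ∈ P, ∀ u' ∈ P, u' ∉ (natGraph G).N u) ∧
      (∀ i < s.var rE, e i ∈ N) ∧ N.card ≤ 9 * G.maxDegree ^ 5 * P.card ∧
      t ≤ 0 + s.var rE * (440 * G.maxDegree + 2250) +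
        240 * (natGraph G).cost (natGraph G).active + 20) s 0 := by
    refine wp_main hW hin.colors hin.hasGraph hin.coloring.col hin.var_zero hin.arr_zero ?_ ?_ ?_ ?_
      fun s' τ' P N h1 h2 h3 h4 h5 h6 h7 => ⟨P, N, h1, h2, h3, h4, h5, h6, h7⟩
    · rw [hE]
      exact (Finset.card_le_card hsub).trans card_edgeFinset_le_sq
    · intro i hi
      obtain ⟨u, v, e1, e2, h⟩ := hlist i hi
      rw [e1, e2]
      have hE' := hadj u v h
      exact ⟨mem_natGraph_N.2 hE', (hunc u v hE').2 h,
        (hunc v u hE'.symm).2 (Sym2.eq_swap ▸ h)⟩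
    · intro i hi
      obtain ⟨u, v, e1, e2, h⟩ := hlist i hi
      rw [e1, e2]
      obtain ⟨a, b, hab, -, hw⟩ := hweak _ h
      rcases Sym2.eq_iff.1 hab with ⟨rfl, rfl⟩ | ⟨rfl, rfl⟩
      · exact Or.inl hw.natGraph
      · exact Or.inr hw.natGraph
    · intro u v hv hnc
      obtain ⟨u, rfl⟩ : ∃ x : Fin n, (x : ℕ) = u := ⟨⟨u, (natGraph G).lt' hv⟩, rfl⟩
      obtain ⟨v, rfl⟩ : ∃ x : Fin n, (x : ℕ) = v := ⟨⟨v, (natGraph G).lt hv⟩, rfl⟩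
      have h1 := (hunc u v (mem_natGraph_N.1 hv)).1 hnc
      have h2 : Sym2.map Fin.val s(u, v) ∈ (Finset.range Ew.card).image e := by
        rw [himg]; exact Finset.mem_image_of_mem _ h1
      obtain ⟨i, hi, h3⟩ := Finset.mem_image.1 h2
      exact ⟨i, hE ▸ Finset.mem_range.1 hi, h3.symm⟩
  obtain ⟨P, N, hm', hpres, hnew, hindep, hN, hcard, htime⟩ := hQ
  obtain ⟨π', hπ'⟩ := hm'.exists_coloring
    fun v c hc w h => (natGraph G).lt (hm'.adj v v.2 c hc w h)
  refine ⟨s', t, π', hrun, ?_, hπ', ?_, ?_⟩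
  · have hcost := cost_natGraph_le (G := G)
    -- An edge in $E_w$ forces $\Delta \ge 1$, so the terms in $|E_w|$ alone are absorbed.
    have hED : Ew.card ≤ Ew.card * G.maxDegree := by
      rcases Nat.eq_zero_or_pos Ew.card with h | h
      · rw [h]; simp
      · obtain ⟨u, v, -, -, h⟩ := hlist 0 (hE ▸ h)
        have h1 := (G.degree_pos_iff_exists_adj u).2 ⟨v, hadj u v h⟩
        exact Nat.le_mul_of_pos_right _ (h1.trans_le (G.degree_le_maxDegree u))
    rw [hE] at htime
    have e1 : Ew.card * (440 * G.maxDegree + 2250) =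
      440 * (Ew.card * G.maxDegree) + 2250 * Ew.card := by ring
    omega
  · intro q hq
    rw [← hcol] at hq
    induction q with
    | _ u v => exact hπ'.colored_iff.1 (hpres u u.2 v (hin.coloring.colored_iff.2 hq))
  · have hcardN : Ew.card ≤ N.card := by
      rw [← Finset.card_image_of_injective Ew (Sym2.map.injective Fin.val_injective), ← himg]
      refine Finset.card_le_card (Finset.image_subset_iff.2 fun i hi => hN i ?_)
      rw [hE]; exact Finset.mem_range.1 hi
    have hcardP : P.card ≤ (π'.colored \ (G.edgeFinset \ Ew)).card := by
      rw [← Finset.card_image_of_injective (π'.colored \ (G.edgeFinset \ Ew))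
        (Sym2.map.injective Fin.val_injective)]
      choose! f hf using hnew
      -- The edge determines its center, because its other end is adjacent to that center and so is
      -- not a center in `P`.
      refine Finset.card_le_card_of_injOn (fun u => s(u, f u)) (fun u hu => ?_)
        fun u hu u' hu' h => ?_
      · obtain ⟨h1, h2, h3⟩ := hf u hu
        obtain ⟨x, hx⟩ : ∃ x : Fin n, (x : ℕ) = u := ⟨⟨u, (natGraph G).lt' h1⟩, rfl⟩
        obtain ⟨y, hy⟩ : ∃ y : Fin n, (y : ℕ) = f u := ⟨⟨f u, (natGraph G).lt h1⟩, rfl⟩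
        rw [← hy, ← hx] at h1 h2 h3
        refine Finset.mem_coe.2 (Finset.mem_image.2 ⟨s(x, y), Finset.mem_sdiff.2 ⟨?_, ?_⟩, ?_⟩)
        · exact hπ'.colored_iff.1 h3
        · rw [← hcol]
          exact fun h => h2 (hin.coloring.colored_iff.2 h)
        · rw [Sym2.map_mk, hx, hy]
      · rcases Sym2.eq_iff.1 h with h | h
        · exact h.1
        · exact absurd (h.2 ▸ (hf u hu).1) (hindep u hu u' hu')
    have hmain : Ew.card ≤ 9 * G.maxDegree ^ 5 * (π'.colored \ (G.edgeFinset \ Ew)).card :=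
      hcardN.trans (hcard.trans (Nat.mul_le_mul_left _ hcardP))
    -- Only nonnegativity of the denominator is needed, so $\Delta = 0$, where the quotient is 0, is
    -- covered.
    refine div_le_of_le_mul₀ (by positivity) (by positivity) ?_
    rw [mul_comm]
    exact_mod_cast hmain
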